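/- Let $T\in(0,\infty)$, $L,\rho\in[0,\infty)$, $\beta\in(0,\tfrac1{12}]$, $d\in\mathbb N=\{1,2,\dots\}$, let $f\colon[0,T]\times\mathbb R^d\times\mathbb R\to\mathbb R$ and $g\colon\mathbb R^d\to\mathbb R$ be continuous, let $V\colon\mathbb R^d\to[1,\infty)$ be measurable, let $\|\cdot\|$ be a norm on $\mathbb R^d$, and let $\Theta=\bigcup_{n\in\mathbb N}\mathbb Z^n$. On a probability space $(\Omega,\mathcal F,\mathbb P)$ let $\mathfrak r^\theta\colon\Omega\to[0,1]$, $\theta\in\Theta$, be i.i.d. random variables with $\mathbb P(\mathfrak r^\theta\le t)=t$ for all $t\in(0,1)$, and let $\mathbf z^\theta\colon\Omega\to\mathbb R^d$, $\theta\in\Theta$, be i.i.d. standard normal random vectors such that the families $(\mathfrak r^\theta)_{\theta\in\Theta}$ and $(\mathbf z^\theta)_{\theta\in\Theta}$ are independent. For $s,t\in[0,T]$, $x\in\mathbb R^d$, $\theta\in\Theta$ let $X^\theta_{s,t}(x)=x+|t-s|^{1/2}\mathbf z^\theta$, and for $v\colon[0,T]\times\mathbb R^d\to\mathbb R$ let $(F(v))(t,x)=f(t,x,v(t,x))$.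 For $M\in\mathbb N$, $n\in\mathbb N_0$, $\theta\in\Theta$ let $U^\theta_{n,M}\colon[0,T]\times\mathbb R^d\times\Omega\to\mathbb R$ be given by $$U^\theta_{n,M}(t,x)=\frac{\mathbf 1_{\mathbb N}(n)}{M^n}\sum_{i=1}^{M^n}g\bigl(X^{(\theta,0,-i)}_{t,T}(x)\bigr)+\sum_{\ell=0}^{n-1}\frac{T-t}{M^{n-\ell}}\sum_{i=1}^{M^{n-\ell}}\Bigl(F\bigl(U^{(\theta,\ell,i)}_{\ell,M}\bigr)-\mathbf 1_{\mathbb N}(\ell)F\bigl(U^{(\theta,-\ell,i)}_{\ell-1,M}\bigr)\Bigr)\Bigl(t+(T-t)\mathfrak r^{(\theta,\ell,i)},\,X^{(\theta,\ell,i)}_{t,\,t+(T-t)\mathfrak r^{(\theta,\ell,i)}}(x)\Bigr).$$ Let $0$ denote the index $(0)\in\mathbb Z^1\subseteq\Theta$, let $c=(\max\{\mathbb E[\|\mathbf z^0\|^4],1\})^{1/4}$, and let $\mathbb V(t,x)=e^{\rho(T-t)}V(x)$. Assume that for all $s,t\in[0,T]$, $x,y\in\mathbb R^d$, $v_1,v_2,w_1,w_2\in\mathbb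 R$ it holds that $$\max\bigl\{|f(s,x,v_1)-f(t,y,v_2)|,\,T^{-1}|g(x)-g(y)|\bigr\}\le T^{-3/2}|V(x)+V(y)|^\beta\bigl(|s-t|^{1/2}+\|x-y\|\bigr)+L|v_1-v_2|,$$ $$\begin{aligned}&\bigl|[f(s,x,v_1)-f(s,x,w_1)]-[f(t,y,v_2)-f(t,y,w_2)]\bigr|\le L|(v_1-w_1)-(v_2-w_2)|\\&\quad+T^{-3/2}|V(x)+V(y)|^\beta\bigl[c|s-t|^{1/2}+\|x-y\|\bigr]|v_1-w_1|+T^{-1}|V(x)+V(y)|^\beta\bigl(|v_1-w_1|+|v_2-w_2|\bigr)|w_1-w_2|,\end{aligned}$$ and $\max\{|Tf(t,x,0)|^{1/\beta},|g(x)|^{1/\beta},\mathbb E[V(X^0_{s,t}(x))]\}\le e^{\rho|t-s|}V(x)$. Then: (i) There exists a unique measurable $u\colon[0,T]\times\mathbb R^d\to\mathbb R$ such that for all $t\in[0,T]$, $x\in\mathbb R^d$ one has $\mathbb E[|g(X^0_{t,T}(x))|]+\int_t^T\mathbb E[|(F(u))(s,X^0_{t,s}(x))|]\,ds+\sup_{r\in[0,T],\,y\in\mathbb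 R^d}\frac{|u(r,y)|}{|V(y)|^\beta}<\infty$ and $$u(t,x)=\mathbb E\bigl[g(X^0_{t,T}(x))\bigr]+\int_t^T\mathbb E\bigl[(F(u))(s,X^0_{t,s}(x))\bigr]\,ds.$$ (ii) For all $\theta\in\Theta$, $n\in\mathbb N_0$, $M\in\mathbb N$ the function $U^\theta_{n,M}$ is measurable. (iii) For all $M\in\mathbb N$, $N\in\mathbb N_0$, $$\sup_{s\in[0,T]}\sup_{x\in\mathbb R^d}\frac{\bigl(\mathbb E[|U^0_{N,M}(s,x)-u(s,x)|^2]\bigr)^{1/2}}{(\mathbb V(s,x))^\beta}\le e^{M/2}M^{-N/2}\bigl(50e^{2LT}\bigr)^{N+1}.$$ (iv) For all $M\in\mathbb N$, $N\in\mathbb N_0$, $$\sup_{\substack{s,t\in[0,T]\\ s\ne t}}\ \sup_{\substack{x,y\in\mathbb R^d\\ x\ne y}}\frac{T^{1/2}\bigl(\mathbb E\bigl[\bigl|[U^0_{N,M}(s,x)-u(s,x)]-[U^0_{N,M}(t,y)-u(t,y)]\bigr|^2\bigr]\bigr)^{1/2}}{\bigl[c|s-t|^{1/2}+\|x-y\|\bigr]\bigl(\mathbb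 V(s,x)+\mathbb V(t,y)\bigr)^{1/4}}\le e^{M/2}M^{-N/2}\bigl(50e^{2LT}\bigr)^{N+1}.$$ -/

import Mathlib

open MeasureTheory ProbabilityTheory Set
open scoped ENNReal

namespace MLP

/-- The index set `⋃_{n ≥ 1} ℤⁿ`, realised as the nonempty finite sequences of integers. -/
def Index : Type := {l : List ℤ // l ≠ []}

/-- The index `(0) ∈ ℤ¹`. -/
def Index.zero : Index := ⟨[0], by simp⟩

/-- The index `(θ, a, b) ∈ ℤⁿ⁺²` obtained from `θ ∈ ℤⁿ`. -/
def Index.append (θ : Index) (a b : ℤ) : Index := ⟨θ.1 ++ [a, b], by simp⟩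

/-- The standard normal distribution on `ℝᵈ`: independent `N(0,1)` coordinates. -/
noncomputable def stdNormal (d : ℕ) : Measure (Fin d → ℝ) :=
  Measure.pi fun _ => gaussianReal 0 1

/-- `X_{s,t}(x) = x + |t - s|^{1/2} z`, for a random vector `z`. -/
noncomputable def flow {Ω : Type*} {d : ℕ} (z : Ω → Fin d → ℝ) (s t : ℝ) (x : Fin d → ℝ)
    (ω : Ω) : Fin d → ℝ :=
  x + √|t - s| • z ω

/-- The operator `(F v)(t, x) = f (t, x, v (t, x))`. -/
def nemytskii {d : ℕ} (f : ℝ → (Fin d → ℝ) → ℝ → ℝ) (v : ℝ → (Fin d → ℝ) → ℝ) :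
    ℝ → (Fin d → ℝ) → ℝ :=
  fun t x => f t x (v t x)

/-- The multilevel Picard approximations; `approx T f g r z M n θ t x ω` is
`U_{n,M}^θ (t, x, ω)`. Only the values for `t ∈ [0, T]` are meaningful. -/
noncomputable def approx {Ω : Type*} {d : ℕ} (T : ℝ) (f : ℝ → (Fin d → ℝ) → ℝ → ℝ)
    (g : (Fin d → ℝ) → ℝ) (r : Index → Ω → ℝ) (z : Index → Ω → Fin d → ℝ) (M : ℕ) :
    ℕ → Index → ℝ → (Fin d → ℝ) → Ω → ℝ
  | n, θ, t, x, ω =>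
    ((if n = 0 then 0 else 1) / (M : ℝ) ^ n) *
        ∑ i ∈ Finset.Icc 1 (M ^ n), g (flow (z (θ.append 0 (-(i : ℤ)))) t T x ω)
      + ∑ l : Fin n, ((T - t) / (M : ℝ) ^ (n - l.1)) *
          ∑ i ∈ Finset.Icc 1 (M ^ (n - l.1)),
            (let s : ℝ := t + (T - t) * r (θ.append (l.1 : ℤ) (i : ℤ)) ω
             let y : Fin d → ℝ := flow (z (θ.append (l.1 : ℤ) (i : ℤ))) t s x ω
             nemytskii f (fun s' y' =>
                 approx T f g r z M l.1 (θ.append (l.1 : ℤ) (i : ℤ)) s' y' ω) s y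
               - (if l.1 = 0 then 0 else 1) * nemytskii f (fun s' y' =>
                 approx T f g r z M (l.1 - 1) (θ.append (-(l.1 : ℤ)) (i : ℤ)) s' y' ω) s y)
termination_by n => n
decreasing_by all_goals omega

/-- `u`, restricted to `[0, T] × ℝᵈ`, is a measurable solution with weighted growth of the
stochastic fixed point equation
`u(t,x) = E[g(X_{t,T}(x))] + ∫_t^T E[(F u)(s, X_{t,s}(x))] ds`.
Values of `u` outside `[0, T] × ℝᵈ` play no role. -/
structure IsSolution {Ω : Type*} [MeasurableSpace Ω] (μ : Measure Ω) {d : ℕ} (T β : ℝ)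
    (f : ℝ → (Fin d → ℝ) → ℝ → ℝ) (g V : (Fin d → ℝ) → ℝ) (z : Ω → Fin d → ℝ)
    (u : ℝ → (Fin d → ℝ) → ℝ) : Prop where
  measurable : Measurable fun p : Icc (0 : ℝ) T × (Fin d → ℝ) => u p.1 p.2
  finite : ∀ t ∈ Icc (0 : ℝ) T, ∀ x : Fin d → ℝ,
    (∫⁻ ω, ENNReal.ofReal |g (flow z t T x ω)| ∂μ)
      + (∫⁻ s in Icc t T, (∫⁻ ω, ENNReal.ofReal |nemytskii f u s (flow z t s x ω)| ∂μ))
      + (⨆ s ∈ Icc (0 : ℝ) T, ⨆ y : Fin d → ℝ, ENNReal.ofReal (|u s y| / |V y| ^ β)) < ⊤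
  equation : ∀ t ∈ Icc (0 : ℝ) T, ∀ x : Fin d → ℝ,
    u t x = (∫ ω, g (flow z t T x ω) ∂μ)
      + (∫ s in t..T, (∫ ω, nemytskii f u s (flow z t s x ω) ∂μ))

/-- The constant `(max {E[‖z‖⁴], 1})^{1/4}`. -/
noncomputable def momentConst {Ω : Type*} [MeasurableSpace Ω] (μ : Measure Ω) {d : ℕ}
    (nrm : Seminorm ℝ (Fin d → ℝ)) (z : Ω → Fin d → ℝ) : ℝ :=
  (max (∫ ω, nrm (z ω) ^ 4 ∂μ) 1) ^ (1 / 4 : ℝ)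

/-- The space-time weight `e^{ρ (T - t)} V(x)`. -/
noncomputable def weight {d : ℕ} (T ρ : ℝ) (V : (Fin d → ℝ) → ℝ) (t : ℝ) (x : Fin d → ℝ) : ℝ :=
  Real.exp (ρ * (T - t)) * V x

end MLP

/-! Replacing the time integral by (T - t) times an expectation over a uniform time turns the fixed
point map into a single expectation over a uniform time and a Gaussian vector (`driveLaw`, `drift`,
`picard`). The weight e^{ρ(T-t)} V(x) does not increase in mean along the flow (`lintegral_wt_le`),
so weighted bounds survive the map. With the additional factor e^{3L(T-t)/2} the map contracts by
2/3 (`drift_contract`), because the integral of θ e^{θ(1-r)} over [0, 1] is at most e^θ. Picard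
iteration then gives existence, uniqueness and a spatial Lipschitz bound. Driving two space-time
points by the same Gaussian vector upgrades this to 1/2-Hölder continuity in time (`sol_holder`).

The approximation of level n + 1 estimates the same map by independent averages whose means
telescope. Its L² error therefore consists of the statistical errors of the averages and one bias,
namely the error of the nonlinear integrand at level n (`eLpNorm_multilevel_le`). With b_l the L²
error of that integrand at level l, this reads: M^{-(n+1)/2} times initial terms, plus the sum over
l < n of M^{-(n-l)/2} (b_{l+1} + b_l), plus b_n.

The bias b_n has no Monte Carlo factor. The missing M^{-1/2} comes from the time integration: errors
are measured with the weight e^{M(T-t)/(2T)}, and squaring and integrating over the uniform time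
gains 1/M (`eLpNorm_prod_exp_le`). So b_l carries l + 1 factors M^{-1/2}, every term of the
recursion carries n + 1 of them, and a geometric sum closes the induction (`sum_geometric_error_le`,
`pointError_phi`). The price is e^{M/2}.

The increment bound comes from the same recursion applied to the difference of two points sharing
all random inputs (`phi_error_le` with ε = 1). The assumption on differences of f controls
increments of F(U) - F(u) by the increment of the error, the pointwise error times the distance, and
the pointwise error times the increment of u. The last term contains three factors of the weight to
the power β. Cauchy–Schwarz against the fourth moment of the Gaussian vector admits the power 1/4,
hence the requirement 3β ≤ 1/4.

Independence is treated once, on a canonical space: each approximation is a deterministic function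
`phi` of the inputs strictly below its index, and these have a product law (`approx_eq_phi`,
`measurePreserving_noiseAt`). -/

namespace MLP

/-! ### Integral inequalities -/

/-- Jensen's inequality for the concave power, through its tangent at `a`, which is the weighted
AM-GM inequality with weights 1 - p and p. Working with lower integrals avoids any integrability
hypothesis. -/
theorem lintegral_rpow_le {α : Type*} [MeasurableSpace α] {γ : Measure α} [IsProbabilityMeasure γ]
    {A : α → ℝ} (hA : Measurable A) (hA0 : ∀ x, 0 ≤ A x) {a p : ℝ} (ha : 0 < a) (hp : 0 ≤ p)
    (hp1 : p ≤ 1) (h : ∫⁻ x, ENNReal.ofReal (A x) ∂γ ≤ ENNReal.ofReal a) :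
    ∫⁻ x, ENNReal.ofReal (A x ^ p) ∂γ ≤ ENNReal.ofReal (a ^ p) := by
  have key : ∀ x, A x ^ p ≤ a ^ p * (1 - p) + a ^ p * p / a * A x := by
    intro x
    have h1 := Real.geom_mean_le_arith_mean2_weighted (sub_nonneg.2 hp1) hp zero_le_one
      (div_nonneg (hA0 x) ha.le) (by ring)
    rw [Real.one_rpow, one_mul, Real.div_rpow (hA0 x) ha.le,
      div_le_iff₀ (Real.rpow_pos_of_pos ha p)] at h1
    calc A x ^ p ≤ _ := h1
      _ = _ := by ring
  have hap : 0 ≤ a ^ p := Real.rpow_nonneg ha.le p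
  calc ∫⁻ x, ENNReal.ofReal (A x ^ p) ∂γ
      ≤ ∫⁻ x, (ENNReal.ofReal (a ^ p * (1 - p))
        + ENNReal.ofReal (a ^ p * p / a) * ENNReal.ofReal (A x)) ∂γ := by
        refine lintegral_mono fun x => ?_
        rw [← ENNReal.ofReal_mul (by positivity),
          ← ENNReal.ofReal_add (mul_nonneg hap (by linarith))
            (mul_nonneg (by positivity) (hA0 x))]
        exact ENNReal.ofReal_le_ofReal (key x)
    _ = ENNReal.ofReal (a ^ p * (1 - p))
        + ENNReal.ofReal (a ^ p * p / a) * ∫⁻ x, ENNReal.ofReal (A x) ∂γ := by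
        rw [lintegral_add_left measurable_const, lintegral_const, measure_univ, mul_one,
          lintegral_const_mul _ hA.ennreal_ofReal]
    _ ≤ ENNReal.ofReal (a ^ p * (1 - p))
        + ENNReal.ofReal (a ^ p * p / a) * ENNReal.ofReal a := by gcongr
    _ = ENNReal.ofReal (a ^ p) := by
        rw [← ENNReal.ofReal_mul (by positivity),
          ← ENNReal.ofReal_add (mul_nonneg hap (by linarith)) (by positivity)]
        congr 1
        field_simp
        ring

/-- Cauchy–Schwarz separates the weight from the distance. The weight then appears with exponent 4p
≤ 1, where Jensen applies. For the distance, (D + qN)⁴ ≤ 8(D⁴ + q⁴N⁴) has mean at most 16D⁴ because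
qc ≤ D. This is the source of the exponent 1/4 and of the factor 2 in all increment estimates. -/
theorem lintegral_weight_mul_sq_le {α : Type*} [MeasurableSpace α] {γ : Measure α}
    [IsProbabilityMeasure γ] {A N : α → ℝ} (hA : Measurable A) (hA0 : ∀ x, 0 ≤ A x)
    (hN : Measurable N) (hN0 : ∀ x, 0 ≤ N x) {a c p q D : ℝ} (ha : 0 < a) (hp : 0 ≤ p)
    (hp4 : p ≤ 1 / 4) (h : ∫⁻ x, ENNReal.ofReal (A x) ∂γ ≤ ENNReal.ofReal a)
    (hc : 0 ≤ c) (hN4 : ∫⁻ x, ENNReal.ofReal (N x ^ 4) ∂γ ≤ ENNReal.ofReal (c ^ 4))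
    (hq : 0 ≤ q) (hD : q * c ≤ D) :
    ∫⁻ x, ENNReal.ofReal ((A x ^ p * (D + q * N x)) ^ 2) ∂γ
      ≤ ENNReal.ofReal ((a ^ p * (2 * D)) ^ 2) := by
  have hD0 : 0 ≤ D := (mul_nonneg hq hc).trans hD
  have hA4 := lintegral_rpow_le hA hA0 ha (p := 4 * p) (by linarith) (by linarith) h
  have hd4 : ∫⁻ x, ENNReal.ofReal ((D + q * N x) ^ 4) ∂γ ≤ ENNReal.ofReal (16 * D ^ 4) := by
    calc ∫⁻ x, ENNReal.ofReal ((D + q * N x) ^ 4) ∂γ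
        ≤ ∫⁻ x, (ENNReal.ofReal (8 * D ^ 4)
          + ENNReal.ofReal (8 * q ^ 4) * ENNReal.ofReal (N x ^ 4)) ∂γ := by
          refine lintegral_mono fun x => ?_
          rw [← ENNReal.ofReal_mul (by positivity),
            ← ENNReal.ofReal_add (by positivity) (by positivity)]
          refine ENNReal.ofReal_le_ofReal ?_
          have := add_pow_le hD0 (mul_nonneg hq (hN0 x)) 4
          norm_num at this
          nlinarith [this]
      _ = ENNReal.ofReal (8 * D ^ 4)
          + ENNReal.ofReal (8 * q ^ 4) * ∫⁻ x, ENNReal.ofReal (N x ^ 4) ∂γ := by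
          rw [lintegral_add_left measurable_const, lintegral_const, measure_univ, mul_one,
            lintegral_const_mul _ (hN.pow_const 4).ennreal_ofReal]
      _ ≤ ENNReal.ofReal (8 * D ^ 4) + ENNReal.ofReal (8 * q ^ 4) * ENNReal.ofReal (c ^ 4) := by
          gcongr
      _ ≤ ENNReal.ofReal (16 * D ^ 4) := by
          rw [← ENNReal.ofReal_mul (by positivity),
            ← ENNReal.ofReal_add (by positivity) (by positivity)]
          refine ENNReal.ofReal_le_ofReal ?_
          have := pow_le_pow_left₀ (mul_nonneg hq hc) hD 4
          rw [mul_pow] at this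
          linarith
  have hCS := ENNReal.lintegral_mul_le_Lp_mul_Lq γ Real.HolderConjugate.two_two
    (f := fun x => ENNReal.ofReal (A x ^ (2 * p)))
    (g := fun x => ENNReal.ofReal ((D + q * N x) ^ 2))
    (by fun_prop) (by fun_prop)
  have e1 : ∀ x, ENNReal.ofReal (A x ^ (2 * p)) ^ (2 : ℝ) = ENNReal.ofReal (A x ^ (4 * p)) := by
    intro x
    rw [ENNReal.ofReal_rpow_of_nonneg (Real.rpow_nonneg (hA0 x) _) (by norm_num),
      ← Real.rpow_mul (hA0 x)]
    ring_nf
  have e2 : ∀ x, ENNReal.ofReal ((D + q * N x) ^ 2) ^ (2 : ℝ)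
      = ENNReal.ofReal ((D + q * N x) ^ 4) := by
    intro x
    rw [ENNReal.ofReal_rpow_of_nonneg (by positivity) (by norm_num), Real.rpow_two]
    ring_nf
  simp only [Pi.mul_apply, e1, e2] at hCS
  calc ∫⁻ x, ENNReal.ofReal ((A x ^ p * (D + q * N x)) ^ 2) ∂γ
      = ∫⁻ x, ENNReal.ofReal (A x ^ (2 * p)) * ENNReal.ofReal ((D + q * N x) ^ 2) ∂γ := by
        refine lintegral_congr fun x => ?_
        rw [← ENNReal.ofReal_mul (Real.rpow_nonneg (hA0 x) _), mul_pow, mul_comm 2 p,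
          Real.rpow_mul (hA0 x), Real.rpow_two]
    _ ≤ _ := hCS
    _ ≤ ENNReal.ofReal (a ^ (4 * p)) ^ (1 / 2 : ℝ)
        * ENNReal.ofReal (16 * D ^ 4) ^ (1 / 2 : ℝ) := by gcongr
    _ = ENNReal.ofReal ((a ^ p * (2 * D)) ^ 2) := by
        rw [ENNReal.ofReal_rpow_of_nonneg (by positivity) (by norm_num),
          ENNReal.ofReal_rpow_of_nonneg (by positivity) (by norm_num),
          ← ENNReal.ofReal_mul (by positivity), ← Real.rpow_mul ha.le,
          show 16 * D ^ 4 = (4 * D ^ 2) ^ (2 : ℝ) by rw [Real.rpow_two]; ring,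
          ← Real.rpow_mul (by positivity), mul_pow, ← Real.rpow_natCast (a ^ p), ← Real.rpow_mul ha.le]
        congr 1
        rw [show 4 * p * (1 / 2) = p * 2 by ring, show (2 : ℝ) * (1 / 2) = 1 by norm_num,
          Real.rpow_one]
        push_cast
        ring

/-- The integral equals e^θ - 1. The prefactor θ absorbs either the Lipschitz constant (contraction
of the fixed point map) or M (gain of M^{-1/2} in the error recursion). -/
theorem lintegral_exp_le {θ : ℝ} (hθ : 0 ≤ θ) :
    ∫⁻ r in Icc (0 : ℝ) 1, ENNReal.ofReal (θ * Real.exp (θ * (1 - r)))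
      ≤ ENNReal.ofReal (Real.exp θ) := by
  have hd : ∀ r : ℝ, HasDerivAt (fun r => -Real.exp (θ * (1 - r)))
      (θ * Real.exp (θ * (1 - r))) r := by
    intro r
    have h1 : HasDerivAt (fun r : ℝ => θ * (1 - r)) (θ * (-1)) r :=
      ((hasDerivAt_id r).const_sub 1).const_mul θ
    exact (h1.exp.neg).congr_deriv (by ring)
  have hc : Continuous fun r : ℝ => θ * Real.exp (θ * (1 - r)) := by fun_prop
  have hi : ∫ r in (0 : ℝ)..1, θ * Real.exp (θ * (1 - r)) = Real.exp θ - 1 := by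
    rw [intervalIntegral.integral_eq_sub_of_hasDerivAt (fun r _ => hd r)
      (hc.intervalIntegrable 0 1)]
    simp
    ring
  rw [← ofReal_integral_eq_lintegral_ofReal (hc.integrableOn_Icc)
    (ae_of_all _ fun r => by positivity), integral_Icc_eq_integral_Ioc,
    ← intervalIntegral.integral_of_le zero_le_one, hi]
  exact ENNReal.ofReal_le_ofReal (by linarith)

/-! ### The `L²` seminorm -/

theorem eLpNorm_two_le_iff {α : Type*} [MeasurableSpace α] {μ : Measure α} {f : α → ℝ} {b : ℝ}
    (hb : 0 ≤ b) : eLpNorm f 2 μ ≤ ENNReal.ofReal b ↔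
      ∫⁻ x, ENNReal.ofReal (f x ^ 2) ∂μ ≤ ENNReal.ofReal (b ^ 2) := by
  have h1 : ∀ x, ‖f x‖ₑ ^ (2 : ℝ) = ENNReal.ofReal (f x ^ 2) := by
    intro x
    rw [Real.enorm_eq_ofReal_abs, ENNReal.ofReal_rpow_of_nonneg (abs_nonneg _) (by norm_num),
      Real.rpow_two, sq_abs]
  rw [eLpNorm_eq_lintegral_rpow_enorm_toReal (by norm_num) (by norm_num)]
  simp only [ENNReal.toReal_ofNat, h1]
  rw [one_div, ENNReal.rpow_inv_le_iff (by norm_num),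
    ENNReal.ofReal_rpow_of_nonneg hb (by norm_num), Real.rpow_two]

/-- Tonelli: the L² norm may be estimated with the first variable frozen. Here the frozen variable
is the evaluation point, and the second one is the noise of the lower level. -/
theorem eLpNorm_two_prod_le {α β : Type*} [MeasurableSpace α] [MeasurableSpace β] {μ : Measure α}
    {ν : Measure β} [SFinite ν] {A : α × β → ℝ} (hA : Measurable A) {B : α → ℝ}
    (hB : ∀ᵐ x ∂μ, 0 ≤ B x ∧ eLpNorm (fun y => A (x, y)) 2 ν ≤ ENNReal.ofReal (B x)) {b : ℝ}
    (hb : 0 ≤ b) (h : ∫⁻ x, ENNReal.ofReal (B x ^ 2) ∂μ ≤ ENNReal.ofReal (b ^ 2)) :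
    eLpNorm A 2 (μ.prod ν) ≤ ENNReal.ofReal b := by
  rw [eLpNorm_two_le_iff hb, lintegral_prod _ (by fun_prop)]
  refine le_trans (lintegral_mono_ae ?_) h
  filter_upwards [hB] with x hx
  exact (eLpNorm_two_le_iff hx.1).1 hx.2

theorem abs_integral_le_of_eLpNorm_two {α : Type*} [MeasurableSpace α] {μ : Measure α}
    [IsProbabilityMeasure μ] {f : α → ℝ} (hf : AEStronglyMeasurable f μ) {b : ℝ} (hb : 0 ≤ b)
    (h : eLpNorm f 2 μ ≤ ENNReal.ofReal b) : |∫ x, f x ∂μ| ≤ b := by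
  rw [← ENNReal.ofReal_le_ofReal_iff hb, ← Real.enorm_eq_ofReal_abs]
  calc ‖∫ x, f x ∂μ‖ₑ ≤ ∫⁻ x, ‖f x‖ₑ ∂μ := enorm_integral_le_lintegral_enorm f
    _ = eLpNorm f 1 μ := eLpNorm_one_eq_lintegral_enorm.symm
    _ ≤ eLpNorm f 2 μ := eLpNorm_le_eLpNorm_of_exponent_le (by norm_num) hf
    _ ≤ _ := h

theorem eLpNorm_sub_const_le_of_variance {α : Type*} [MeasurableSpace α] {μ : Measure α}
    [IsProbabilityMeasure μ] {X : α → ℝ} (hX : MemLp X 2 μ) {b : ℝ} (hb : 0 ≤ b)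
    (h : Var[X; μ] ≤ b ^ 2) : eLpNorm (fun x => X x - ∫ y, X y ∂μ) 2 μ ≤ ENNReal.ofReal b := by
  rw [eLpNorm_two_le_iff hb, ← evariance_eq_lintegral_ofReal, ← hX.ofReal_variance_eq]
  exact ENNReal.ofReal_le_ofReal h

theorem variance_le_of_eLpNorm_two {α : Type*} [MeasurableSpace α] {μ : Measure α}
    [IsProbabilityMeasure μ] {X : α → ℝ} (hX : AEStronglyMeasurable X μ) {b : ℝ} (hb : 0 ≤ b)
    (h : eLpNorm X 2 μ ≤ ENNReal.ofReal b) : Var[X; μ] ≤ b ^ 2 := by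
  refine (variance_le_expectation_sq hX).trans ?_
  rw [integral_eq_lintegral_of_nonneg_ae (ae_of_all _ fun x => by simp [sq_nonneg])
    (by simpa using hX.pow 2)]
  exact ENNReal.toReal_le_of_le_ofReal (sq_nonneg b) ((eLpNorm_two_le_iff hb).1 h)

/-- The `L²` Monte Carlo error of an average of pairwise independent random variables. -/
theorem eLpNorm_average_sub_le {α ι : Type*} [MeasurableSpace α] {μ : Measure α}
    [IsProbabilityMeasure μ] {s : Finset ι} (hs : s.Nonempty) {Y : ι → α → ℝ}
    (hY : ∀ i ∈ s, AEStronglyMeasurable (Y i) μ)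
    (hind : (s : Set ι).Pairwise fun i j => IndepFun (Y i) (Y j) μ) {e b : ℝ} (hb : 0 ≤ b)
    (he : ∀ i ∈ s, ∫ x, Y i x ∂μ = e) (hYb : ∀ i ∈ s, eLpNorm (Y i) 2 μ ≤ ENNReal.ofReal b) :
    eLpNorm (fun x => (s.card : ℝ)⁻¹ * ∑ i ∈ s, Y i x - e) 2 μ
      ≤ ENNReal.ofReal ((√s.card)⁻¹ * b) := by
  have hL : ∀ i ∈ s, MemLp (Y i) 2 μ := fun i hi =>
    ⟨hY i hi, (hYb i hi).trans_lt ENNReal.ofReal_lt_top⟩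
  have hc : (0 : ℝ) < s.card := by exact_mod_cast hs.card_pos
  set X : α → ℝ := fun x => (s.card : ℝ)⁻¹ * (∑ i ∈ s, Y i) x with hXdef
  have hX : MemLp X 2 μ := (memLp_finsetSum' s hL).const_mul _
  have hmean : ∫ x, X x ∂μ = e := by
    simp only [hXdef, Finset.sum_apply]
    rw [integral_const_mul, integral_finsetSum _ fun i hi => (hL i hi).integrable (by norm_num),
      Finset.sum_congr rfl he, Finset.sum_const, nsmul_eq_mul]
    field_simp
  have hvar : Var[X; μ] ≤ ((√s.card)⁻¹ * b) ^ 2 := by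
    rw [hXdef, variance_const_mul, IndepFun.variance_sum hL hind]
    have : ∑ i ∈ s, Var[Y i; μ] ≤ s.card * b ^ 2 := by
      rw [← nsmul_eq_mul, ← Finset.sum_const]
      exact Finset.sum_le_sum fun i hi => variance_le_of_eLpNorm_two (hY i hi) hb (hYb i hi)
    rw [mul_pow, inv_pow, inv_pow, Real.sq_sqrt hc.le]
    calc ((s.card : ℝ) ^ 2)⁻¹ * ∑ i ∈ s, Var[Y i; μ]
        ≤ ((s.card : ℝ) ^ 2)⁻¹ * (s.card * b ^ 2) := by gcongr
      _ = (s.card : ℝ)⁻¹ * b ^ 2 := by field_simp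
  have := eLpNorm_sub_const_le_of_variance hX (by positivity) hvar
  rw [hmean] at this
  simpa [hXdef] using this

/-! ### Independence -/

/-- The restricted process generates the supremum of the σ-algebras of its coordinates, and suprema
over disjoint index sets of an independent family are independent. -/
theorem indepFun_restrict_of_disjoint {Ω ι : Type*} {𝓧 : Type*} [MeasurableSpace Ω]
    [MeasurableSpace 𝓧] {μ : Measure Ω} {X : ι → Ω → 𝓧} (hX : ∀ i, Measurable (X i))
    (h : iIndepFun X μ) {A B : Set ι} (hAB : Disjoint A B) :
    IndepFun (fun ω (i : A) => X i ω) (fun ω (i : B) => X i ω) μ := by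
  have key := indep_iSup_of_disjoint (fun i => (hX i).comap_le)
    ((iIndepFun_iff_iIndep _ _ _).1 h) hAB
  rw [IndepFun_iff_Indep]
  have e : ∀ A : Set ι, MeasurableSpace.comap (fun ω (i : A) => X i ω) MeasurableSpace.pi
      = ⨆ i ∈ A, MeasurableSpace.comap (X i) inferInstance := by
    intro A
    rw [MeasurableSpace.comap_process_pi (fun (i : A) ω => X i ω), iSup_subtype]
  rw [e, e]
  exact key

/-- Rectangles form a generating π-system for each pair. On an intersection of rectangles, first the
independence of the two families and then the independence within each family factorises the
probability. -/
theorem iIndepFun_prodMk {Ω ι : Type*} {𝓧 𝓨 : Type*} [MeasurableSpace Ω]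
    [MeasurableSpace 𝓧] [MeasurableSpace 𝓨] {μ : Measure Ω} {X : ι → Ω → 𝓧} {Y : ι → Ω → 𝓨}
    (hX : ∀ i, Measurable (X i)) (hY : ∀ i, Measurable (Y i)) (hXi : iIndepFun X μ)
    (hYi : iIndepFun Y μ) (hXY : IndepFun (fun ω i => X i ω) (fun ω i => Y i ω) μ) :
    iIndepFun (fun i ω => (X i ω, Y i ω)) μ := by
  rw [iIndepFun_iff_iIndep]
  refine iIndepSets.iIndep (fun i => ((hX i).prodMk (hY i)).comap_le)
    (fun i => (fun S => (fun ω => (X i ω, Y i ω)) ⁻¹' S) ''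
      (image2 (· ×ˢ ·) {s | MeasurableSet s} {t | MeasurableSet t}))
    (fun i => ?_) (fun i => ?_) ?_
  · exact isPiSystem_prod.comap _
  · rw [← generateFrom_prod, MeasurableSpace.comap_generateFrom]
  · rw [iIndepSets_iff]
    intro s F hF
    have hF' : ∀ i : ι, ∃ A : Set 𝓧, ∃ B : Set 𝓨, MeasurableSet A ∧ MeasurableSet B ∧
        (i ∈ s → F i = X i ⁻¹' A ∩ Y i ⁻¹' B) := by
      intro i
      by_cases hi : i ∈ s
      · obtain ⟨S, ⟨A, hA, B, hB, rfl⟩, hS⟩ := hF i hi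
        exact ⟨A, B, hA, hB, fun _ => hS ▸ rfl⟩
      · exact ⟨univ, univ, .univ, .univ, fun h => absurd h hi⟩
    choose A B hA hB hAB using hF'
    have e1 : ⋂ i ∈ s, F i = (fun ω i => X i ω) ⁻¹' (⋂ i ∈ s, (fun x => x i) ⁻¹' A i)
        ∩ (fun ω i => Y i ω) ⁻¹' (⋂ i ∈ s, (fun x => x i) ⁻¹' B i) := by
      ext ω
      simp only [mem_iInter, mem_inter_iff, mem_preimage]
      constructor
      · intro h
        refine ⟨fun i hi => ?_, fun i hi => ?_⟩
        · have := h i hi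
          rw [hAB i hi] at this
          exact this.1
        · have := h i hi
          rw [hAB i hi] at this
          exact this.2
      · intro h i hi
        rw [hAB i hi]
        exact ⟨h.1 i hi, h.2 i hi⟩
    rw [e1, hXY.measure_inter_preimage_eq_mul _ _
      (Finset.measurableSet_biInter s fun i _ => measurable_pi_apply i (hA i))
      (Finset.measurableSet_biInter s fun i _ => measurable_pi_apply i (hB i))]
    simp only [preimage_iInter, preimage_preimage]
    rw [(iIndepFun_iff_measure_inter_preimage_eq_mul.1 hXi) s fun i _ => hA i,
      (iIndepFun_iff_measure_inter_preimage_eq_mul.1 hYi) s fun i _ => hB i,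
      ← Finset.prod_mul_distrib]
    refine Finset.prod_congr rfl fun i hi => ?_
    rw [hAB i hi]
    exact ((hXY.comp (measurable_pi_apply i)
      (measurable_pi_apply i)).measure_inter_preimage_eq_mul _ _ (hA i) (hB i)).symm

/-! ### The laws of the driving random variables -/

theorem map_eq_uniform {Ω : Type*} [MeasurableSpace Ω] {μ : Measure Ω} [IsProbabilityMeasure μ]
    {r : Ω → ℝ} (hr : Measurable r) (hr01 : ∀ ω, r ω ∈ Icc (0 : ℝ) 1)
    (hlaw : ∀ t ∈ Ioo (0 : ℝ) 1, μ {ω | r ω ≤ t} = ENNReal.ofReal t) :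
    μ.map r = volume.restrict (Icc (0 : ℝ) 1) := by
  have := Measure.isProbabilityMeasure_map (μ := μ) hr.aemeasurable
  refine Measure.ext_of_Iic _ _ fun t => ?_
  rw [Measure.map_apply hr measurableSet_Iic, Measure.restrict_apply measurableSet_Iic]
  rcases lt_trichotomy t 0 with ht | rfl | ht
  · have e1 : r ⁻¹' Iic t = ∅ := by
      ext ω; simpa using ht.trans_le (hr01 ω).1
    have e2 : Iic t ∩ Icc 0 1 = ∅ := by
      ext x; simp only [mem_inter_iff, mem_Iic, mem_Icc, mem_empty_iff_false, iff_false]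
      rintro ⟨h1, h2, -⟩; linarith
    rw [e1, e2, measure_empty, measure_empty]
  · have e2 : Iic (0 : ℝ) ∩ Icc 0 1 = {0} := by
      ext x; simp only [mem_inter_iff, mem_Iic, mem_Icc, mem_singleton_iff]
      constructor
      · rintro ⟨h1, h2, -⟩; linarith
      · rintro rfl; norm_num
    rw [e2, Real.volume_singleton]
    -- The distribution function is given only on the open interval (0, 1), so an atom at 0 is
    -- excluded by letting the threshold decrease to 0.
    refine le_antisymm (ENNReal.le_of_forall_pos_le_add fun ε hε _ => ?_) zero_le
    have hm : min (ε : ℝ) (1 / 2) ∈ Ioo (0 : ℝ) 1 :=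
      ⟨lt_min (by exact_mod_cast hε) (by norm_num),
        (min_le_right _ _).trans_lt (by norm_num)⟩
    rw [zero_add]
    calc μ (r ⁻¹' Iic 0) ≤ μ {ω | r ω ≤ min (ε : ℝ) (1 / 2)} :=
          measure_mono fun ω hω => le_trans (mem_Iic.1 hω) hm.1.le
      _ = ENNReal.ofReal (min (ε : ℝ) (1 / 2)) := hlaw _ hm
      _ ≤ ENNReal.ofReal ε := ENNReal.ofReal_le_ofReal (min_le_left _ _)
      _ = ε := ENNReal.ofReal_coe_nnreal
  · rcases lt_or_ge t 1 with h1 | h1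
    · have e2 : Iic t ∩ Icc 0 1 = Icc 0 t := by
        ext x; simp only [mem_inter_iff, mem_Iic, mem_Icc]
        constructor
        · rintro ⟨h1, h2, -⟩; exact ⟨h2, h1⟩
        · rintro ⟨h2, h3⟩; exact ⟨h3, h2, h3.trans h1.le⟩
      rw [e2, Real.volume_Icc, sub_zero]
      exact hlaw t ⟨ht, h1⟩
    · have e1 : r ⁻¹' Iic t = univ := by
        ext ω; simpa using (hr01 ω).2.trans h1
      have e2 : Iic t ∩ Icc 0 1 = Icc 0 1 := by
        ext x; simp only [mem_inter_iff, mem_Iic, mem_Icc, and_iff_right_iff_imp]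
        exact fun h => h.2.trans h1
      rw [e1, e2, Real.volume_Icc, measure_univ]
      simp

instance isProbabilityMeasure_stdNormal (d : ℕ) : IsProbabilityMeasure (stdNormal d) := by
  unfold stdNormal; infer_instance

theorem continuous_seminorm {d : ℕ} (nrm : Seminorm ℝ (Fin d → ℝ)) : Continuous nrm := by
  have h := nrm.convexOn.continuousOn isOpen_univ
  exact continuousOn_univ.1 h

/-- By subadditivity the seminorm is dominated by a weighted sum of the absolute coordinates, and
Gaussian coordinates have fourth moments. Integrability matters because the constant c is defined by
a Bochner integral, which would otherwise take the default value 0 and bound nothing. -/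
theorem integrable_seminorm_pow_four {d : ℕ} (nrm : Seminorm ℝ (Fin d → ℝ)) :
    Integrable (fun z => nrm z ^ 4) (stdNormal d) := by
  have hcoord : ∀ i : Fin d, MemLp (fun z : Fin d → ℝ => z i * nrm (Pi.single i 1)) 4
      (stdNormal d) := by
    intro i
    have h1 : MemLp (fun z : Fin d → ℝ => z i) 4 (stdNormal d) :=
      (memLp_id_gaussianReal' (μ := 0) (v := 1) 4 (by norm_num)).comp_measurePreserving
        (measurePreserving_eval (fun _ => gaussianReal 0 1) i)
    exact h1.mul_const _
  have hsum := memLp_finsetSum (Finset.univ) (fun i _ => (hcoord i).norm)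
  have hle : MemLp (fun z => nrm z) 4 (stdNormal d) := by
    refine hsum.mono (continuous_seminorm nrm).aestronglyMeasurable (ae_of_all _ fun z => ?_)
    rw [Real.norm_of_nonneg (apply_nonneg nrm z),
      Real.norm_of_nonneg (Finset.sum_nonneg fun i _ => norm_nonneg _)]
    calc nrm z = nrm (∑ i, z i • (Pi.single i 1 : Fin d → ℝ)) := by
          congr 1
          ext j
          simp [Finset.sum_apply, Pi.single_apply]
      _ ≤ ∑ i, nrm (z i • (Pi.single i 1 : Fin d → ℝ)) :=
          Finset.le_sum_of_subadditive nrm (map_zero nrm).le (map_add_le_add nrm) _ _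
      _ = ∑ i, ‖z i * nrm (Pi.single i 1)‖ := by
          refine Finset.sum_congr rfl fun i _ => ?_
          rw [map_smul_eq_mul, norm_mul, Real.norm_of_nonneg (apply_nonneg nrm _)]
  have := hle.integrable_norm_pow (by norm_num)
  refine this.congr (ae_of_all _ fun z => ?_)
  simp [abs_of_nonneg (apply_nonneg nrm z)]

/-! ### The model on the whole time axis -/

/-- The law of a pair of a uniform random variable and a standard normal random vector. -/
noncomputable def driveLaw (d : ℕ) : Measure (ℝ × (Fin d → ℝ)) :=
  (volume.restrict (Icc (0 : ℝ) 1)).prod (stdNormal d)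

instance isProbabilityMeasure_uniform :
    IsProbabilityMeasure (volume.restrict (Icc (0 : ℝ) 1)) := ⟨by simp⟩

instance isProbabilityMeasure_driveLaw (d : ℕ) : IsProbabilityMeasure (driveLaw d) := by
  unfold driveLaw; infer_instance

/-- Data and regularity assumptions of the semilinear problem, with `f` extended to all times. -/
structure Model (d : ℕ) where
  (T L ρ β c : ℝ)
  f : ℝ → (Fin d → ℝ) → ℝ → ℝ
  g : (Fin d → ℝ) → ℝ
  V : (Fin d → ℝ) → ℝ
  nrm : Seminorm ℝ (Fin d → ℝ)
  T_pos : 0 < T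
  L_nonneg : 0 ≤ L
  ρ_nonneg : 0 ≤ ρ
  β_pos : 0 < β
  β_le : β ≤ 1 / 12
  one_le_c : 1 ≤ c
  f_cont : Continuous fun p : ℝ × (Fin d → ℝ) × ℝ => f p.1 p.2.1 p.2.2
  g_cont : Continuous g
  V_meas : Measurable V
  one_le_V : ∀ x, 1 ≤ V x
  moment : ∫⁻ z, ENNReal.ofReal (nrm z ^ 4) ∂stdNormal d ≤ ENNReal.ofReal (c ^ 4)
  f_lip : ∀ s t x y v w, |f s x v - f t y w| ≤
    T⁻¹ * (√T)⁻¹ * (V x + V y) ^ β * (√|s - t| + nrm (x - y)) + L * |v - w|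
  g_lip : ∀ x y, |g x - g y| ≤ (√T)⁻¹ * (V x + V y) ^ β * nrm (x - y)
  f_diff : ∀ s t x y v₁ v₂ w₁ w₂, |(f s x v₁ - f s x w₁) - (f t y v₂ - f t y w₂)| ≤
    L * |(v₁ - w₁) - (v₂ - w₂)|
      + T⁻¹ * (√T)⁻¹ * (V x + V y) ^ β * (c * √|s - t| + nrm (x - y)) * |v₁ - w₁|
      + T⁻¹ * (V x + V y) ^ β * (|v₁ - w₁| + |v₂ - w₂|) * |w₁ - w₂|
  f_bound : ∀ t x, |f t x 0| ≤ T⁻¹ * V x ^ β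
  g_bound : ∀ x, |g x| ≤ V x ^ β
  V_int : ∀ h, 0 ≤ h → h ≤ T → ∀ x,
    ∫⁻ z, ENNReal.ofReal (V (x + √h • z)) ∂stdNormal d ≤ ENNReal.ofReal (Real.exp (ρ * h) * V x)

namespace Model

variable {d : ℕ} (m : Model d)

/-- The weight of the model. -/
noncomputable def wt (t : ℝ) (x : Fin d → ℝ) : ℝ := weight m.T m.ρ m.V t x

/-- The parabolic distance of the model. -/
noncomputable def dst (s t : ℝ) (x y : Fin d → ℝ) : ℝ := m.c * √|s - t| + m.nrm (x - y)

theorem V_pos (x) : 0 < m.V x := zero_lt_one.trans_le (m.one_le_V x)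

theorem wt_pos (t x) : 0 < m.wt t x := mul_pos (Real.exp_pos _) (m.V_pos x)

theorem V_le_wt {t} (ht : t ≤ m.T) (x) : m.V x ≤ m.wt t x :=
  le_mul_of_one_le_left (m.V_pos x).le
    (Real.one_le_exp (mul_nonneg m.ρ_nonneg (sub_nonneg.2 ht)))

theorem one_le_wt {t} (ht : t ≤ m.T) (x) : 1 ≤ m.wt t x := (m.one_le_V x).trans (m.V_le_wt ht x)

theorem sqrt_T_pos : 0 < √m.T := Real.sqrt_pos.2 m.T_pos

theorem dst_nonneg (s t x y) : 0 ≤ m.dst s t x y :=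
  add_nonneg (mul_nonneg (zero_le_one.trans m.one_le_c) (Real.sqrt_nonneg _)) (apply_nonneg _ _)

theorem sqrt_le_dst (s t x y) : √|s - t| ≤ m.dst s t x y :=
  (le_mul_of_one_le_left (Real.sqrt_nonneg _) m.one_le_c).trans
    (le_add_of_nonneg_right (apply_nonneg _ _))

theorem dst_comm (s t x y) : m.dst s t x y = m.dst t s y x := by
  rw [dst, dst, abs_sub_comm, ← map_sub_rev m.nrm]

@[fun_prop]
theorem measurable_V : Measurable m.V := m.V_meas

@[fun_prop]
theorem measurable_g : Measurable m.g := m.g_cont.measurable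

@[fun_prop]
theorem measurable_nrm : Measurable fun x => m.nrm x := (continuous_seminorm m.nrm).measurable

theorem measurable_f {α : Type*} [MeasurableSpace α] {a : α → ℝ} {b : α → Fin d → ℝ} {e : α → ℝ}
    (ha : Measurable a) (hb : Measurable b) (he : Measurable e) :
    Measurable fun x => m.f (a x) (b x) (e x) :=
  m.f_cont.measurable.comp (ha.prodMk (hb.prodMk he))

@[fun_prop]
theorem measurable_wt {α : Type*} [MeasurableSpace α] {a : α → ℝ} {b : α → Fin d → ℝ}
    (ha : Measurable a) (hb : Measurable b) : Measurable fun x => m.wt (a x) (b x) := by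
  unfold wt weight
  fun_prop

theorem f_lip_right (t x v w) : |m.f t x v - m.f t x w| ≤ m.L * |v - w| := by
  simpa using m.f_lip t t x x v w

theorem abs_f_le (t x v) : |m.f t x v| ≤ m.T⁻¹ * m.V x ^ m.β + m.L * |v| := by
  have h1 := m.f_lip_right t x v 0
  have h2 := m.f_bound t x
  rw [sub_zero] at h1
  calc |m.f t x v| = |(m.f t x v - m.f t x 0) + m.f t x 0| := by ring_nf
    _ ≤ _ := abs_add_le _ _
    _ ≤ _ := by linarith

/-- The loss of e^{-ρh} in the exponential factor cancels exactly the growth e^{ρh} allowed for V,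
so the weight is a supermartingale along the flow. -/
theorem lintegral_wt_le {t h : ℝ} (hh : 0 ≤ h) (hT : h ≤ m.T) (x) :
    ∫⁻ z, ENNReal.ofReal (m.wt (t + h) (x + √h • z)) ∂stdNormal d
      ≤ ENNReal.ofReal (m.wt t x) := by
  simp only [wt, weight]
  calc ∫⁻ z, ENNReal.ofReal (Real.exp (m.ρ * (m.T - (t + h))) * m.V (x + √h • z)) ∂stdNormal d
      = ENNReal.ofReal (Real.exp (m.ρ * (m.T - (t + h))))
          * ∫⁻ z, ENNReal.ofReal (m.V (x + √h • z)) ∂stdNormal d := by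
        rw [← lintegral_const_mul _ (by fun_prop)]
        exact lintegral_congr fun z => ENNReal.ofReal_mul (Real.exp_pos _).le
    _ ≤ ENNReal.ofReal (Real.exp (m.ρ * (m.T - (t + h))))
          * ENNReal.ofReal (Real.exp (m.ρ * h) * m.V x) := by
        gcongr
        exact m.V_int h hh hT x
    _ = _ := by
        rw [← ENNReal.ofReal_mul (Real.exp_pos _).le, ← mul_assoc, ← Real.exp_add]
        ring_nf

theorem lintegral_wt_rpow_le {t h p : ℝ} (hh : 0 ≤ h) (hT : h ≤ m.T) (hp : 0 ≤ p) (hp1 : p ≤ 1)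
    (x) : ∫⁻ z, ENNReal.ofReal (m.wt (t + h) (x + √h • z) ^ p) ∂stdNormal d
      ≤ ENNReal.ofReal (m.wt t x ^ p) :=
  lintegral_rpow_le (by fun_prop) (fun _ => (m.wt_pos _ _).le) (m.wt_pos t x) hp hp1
    (m.lintegral_wt_le hh hT x)

theorem lintegral_wt_add_le {s t h k : ℝ} (hh : 0 ≤ h) (hT : h ≤ m.T) (hk : 0 ≤ k) (kT : k ≤ m.T)
    (x y) : ∫⁻ z, ENNReal.ofReal (m.wt (s + h) (x + √h • z) + m.wt (t + k) (y + √k • z))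
      ∂stdNormal d ≤ ENNReal.ofReal (m.wt s x + m.wt t y) := by
  calc _ = ∫⁻ z, (ENNReal.ofReal (m.wt (s + h) (x + √h • z))
          + ENNReal.ofReal (m.wt (t + k) (y + √k • z))) ∂stdNormal d :=
        lintegral_congr fun z => ENNReal.ofReal_add (m.wt_pos _ _).le (m.wt_pos _ _).le
    _ = _ := lintegral_add_left (by fun_prop) _
    _ ≤ ENNReal.ofReal (m.wt s x) + ENNReal.ofReal (m.wt t y) :=
        add_le_add (m.lintegral_wt_le hh hT x) (m.lintegral_wt_le hk kT y)
    _ = _ := (ENNReal.ofReal_add (m.wt_pos _ _).le (m.wt_pos _ _).le).symm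

/-- The random upper bound for the distance of two coupled points. -/
noncomputable def cdst (s t : ℝ) (x y z : Fin d → ℝ) : ℝ := m.dst s t x y + √|s - t| * m.nrm z

theorem dst_le_cdst (s t x y z) : m.dst s t x y ≤ m.cdst s t x y z :=
  le_add_of_nonneg_right (mul_nonneg (Real.sqrt_nonneg _) (apply_nonneg _ _))

theorem cdst_nonneg (s t x y z) : 0 ≤ m.cdst s t x y z :=
  (m.dst_nonneg s t x y).trans (m.dst_le_cdst s t x y z)

/-- Both points are moved by the same Gaussian vector. The coefficient √|s - t| of the random part
of the distance satisfies c √|s - t| ≤ `dst`, which is why c enters the parabolic distance. -/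
theorem lintegral_pair_le {s t h k p : ℝ} (hh : 0 ≤ h) (hT : h ≤ m.T) (hk : 0 ≤ k) (kT : k ≤ m.T)
    (hp : 0 ≤ p) (hp4 : p ≤ 1 / 4) (x y) :
    ∫⁻ z, ENNReal.ofReal (((m.wt (s + h) (x + √h • z) + m.wt (t + k) (y + √k • z)) ^ p
        * m.cdst s t x y z) ^ 2) ∂stdNormal d
      ≤ ENNReal.ofReal (((m.wt s x + m.wt t y) ^ p * (2 * m.dst s t x y)) ^ 2) :=
  lintegral_weight_mul_sq_le (by fun_prop)
    (fun _ => (add_pos (m.wt_pos _ _) (m.wt_pos _ _)).le) m.measurable_nrm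
    (fun _ => apply_nonneg _ _) (add_pos (m.wt_pos _ _) (m.wt_pos _ _)) hp hp4
    (m.lintegral_wt_add_le hh hT hk kT x y) (zero_le_one.trans m.one_le_c) m.moment
    (Real.sqrt_nonneg _) (by
      rw [dst, mul_comm]; exact le_add_of_nonneg_right (apply_nonneg _ _))

/-- Under a common Gaussian vector only the difference of the two scalings acts on it. -/
theorem nrm_sub_le {s t a b : ℝ} (hab : |a - b| ≤ √|s - t|) (x y z) :
    m.nrm ((x + a • z) - (y + b • z)) ≤ m.nrm (x - y) + √|s - t| * m.nrm z := by
  have e : (x + a • z) - (y + b • z) = (x - y) + (a - b) • z := by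
    rw [sub_smul]; abel
  rw [e]
  refine (map_add_le_add m.nrm _ _).trans ?_
  rw [map_smul_eq_mul, Real.norm_eq_abs]
  gcongr

theorem nrm_sub_le_cdst {s t a b : ℝ} (hab : |a - b| ≤ √|s - t|) (x y z) :
    m.nrm ((x + a • z) - (y + b • z)) ≤ m.cdst s t x y z := by
  refine (m.nrm_sub_le hab x y z).trans ?_
  rw [cdst, dst]
  have : 0 ≤ m.c * √|s - t| := mul_nonneg (zero_le_one.trans m.one_le_c) (Real.sqrt_nonneg _)
  linarith

theorem abs_sqrt_sub_sqrt_le {a b : ℝ} (ha : 0 ≤ a) (hb : 0 ≤ b) : |√a - √b| ≤ √|a - b| := by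
  apply Real.abs_le_sqrt
  rcases le_total a b with h | h
  · rw [abs_of_nonpos (by linarith)]
    nlinarith [Real.sq_sqrt ha, Real.sq_sqrt hb, Real.sqrt_le_sqrt h, Real.sqrt_nonneg a]
  · rw [abs_of_nonneg (by linarith)]
    nlinarith [Real.sq_sqrt ha, Real.sq_sqrt hb, Real.sqrt_le_sqrt h, Real.sqrt_nonneg b]

/-! ### The fixed point map -/

/-- The random evaluation time. -/
noncomputable def tm (t : ℝ) (w : ℝ × (Fin d → ℝ)) : ℝ := t + (m.T - t) * w.1

/-- The random evaluation point. -/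
noncomputable def sp (t : ℝ) (x : Fin d → ℝ) (w : ℝ × (Fin d → ℝ)) : Fin d → ℝ :=
  x + √|t - m.tm t w| • w.2

/-- The random terminal point. -/
noncomputable def ep (t : ℝ) (x : Fin d → ℝ) (w : ℝ × (Fin d → ℝ)) : Fin d → ℝ :=
  x + √|t - m.T| • w.2

@[fun_prop]
theorem measurable_tm {α : Type*} [MeasurableSpace α] {a : α → ℝ} {w : α → ℝ × (Fin d → ℝ)}
    (ha : Measurable a) (hw : Measurable w) : Measurable fun p => m.tm (a p) (w p) := by
  unfold tm; fun_prop

@[fun_prop]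
theorem measurable_sp {α : Type*} [MeasurableSpace α] {a : α → ℝ} {b : α → Fin d → ℝ}
    {w : α → ℝ × (Fin d → ℝ)} (ha : Measurable a) (hb : Measurable b) (hw : Measurable w) :
    Measurable fun p => m.sp (a p) (b p) (w p) := by
  unfold sp; fun_prop

@[fun_prop]
theorem measurable_ep {α : Type*} [MeasurableSpace α] {a : α → ℝ} {b : α → Fin d → ℝ}
    {w : α → ℝ × (Fin d → ℝ)} (ha : Measurable a) (hb : Measurable b) (hw : Measurable w) :
    Measurable fun p => m.ep (a p) (b p) (w p) := by
  unfold ep; fun_prop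

variable {m}

theorem tm_mem {t : ℝ} (ht : t ∈ Icc 0 m.T) {w : ℝ × (Fin d → ℝ)} (hw : w.1 ∈ Icc (0 : ℝ) 1) :
    m.tm t w ∈ Icc 0 m.T := by
  unfold tm
  constructor
  · nlinarith [ht.1, ht.2, hw.1, hw.2]
  · nlinarith [ht.1, ht.2, hw.1, hw.2]

/-- The remaining time shrinks by the factor 1 - r. Weights exponential in the remaining time thus
become e^{θ(1-r)}, the integrand of `lintegral_exp_le`. -/
theorem T_sub_tm (t : ℝ) (w : ℝ × (Fin d → ℝ)) : m.T - m.tm t w = (m.T - t) * (1 - w.1) := by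
  unfold tm; ring

theorem sp_eq {t : ℝ} (ht : t ∈ Icc 0 m.T) (x) {w : ℝ × (Fin d → ℝ)} (hw : w.1 ∈ Icc (0 : ℝ) 1) :
    m.sp t x w = x + √((m.T - t) * w.1) • w.2 := by
  have h : 0 ≤ (m.T - t) * w.1 := mul_nonneg (by linarith [ht.2]) hw.1
  unfold sp tm
  rw [show t - (t + (m.T - t) * w.1) = -((m.T - t) * w.1) by ring, abs_neg, abs_of_nonneg h]

theorem ep_eq {t : ℝ} (ht : t ∈ Icc 0 m.T) (x) (w : ℝ × (Fin d → ℝ)) :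
    m.ep t x w = x + √(m.T - t) • w.2 := by
  unfold ep
  rw [abs_sub_comm, abs_of_nonneg (by linarith [ht.2])]

theorem step_nonneg {t : ℝ} (ht : t ∈ Icc 0 m.T) {r : ℝ} (hr : r ∈ Icc (0 : ℝ) 1) :
    0 ≤ (m.T - t) * r := mul_nonneg (by linarith [ht.2]) hr.1

theorem step_le {t : ℝ} (ht : t ∈ Icc 0 m.T) {r : ℝ} (hr : r ∈ Icc (0 : ℝ) 1) :
    (m.T - t) * r ≤ m.T := by nlinarith [ht.1, ht.2, hr.1, hr.2]

theorem lintegral_wt_sp_rpow_le {t : ℝ} (ht : t ∈ Icc 0 m.T) {r p : ℝ} (hr : r ∈ Icc (0 : ℝ) 1)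
    (hp : 0 ≤ p) (hp1 : p ≤ 1) (x) :
    ∫⁻ z, ENNReal.ofReal (m.wt (m.tm t (r, z)) (m.sp t x (r, z)) ^ p) ∂stdNormal d
      ≤ ENNReal.ofReal (m.wt t x ^ p) := by
  simp only [sp_eq ht x (w := (r, _)) hr]
  exact m.lintegral_wt_rpow_le (step_nonneg ht hr) (step_le ht hr) hp hp1 x

theorem lintegral_wt_ep_rpow_le {t : ℝ} (ht : t ∈ Icc 0 m.T) {r p : ℝ}
    (hp : 0 ≤ p) (hp1 : p ≤ 1) (x) :
    ∫⁻ z, ENNReal.ofReal (m.wt m.T (m.ep t x (r, z)) ^ p) ∂stdNormal d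
      ≤ ENNReal.ofReal (m.wt t x ^ p) := by
  simp only [ep_eq ht x]
  have := m.lintegral_wt_rpow_le (t := t) (h := m.T - t) (by linarith [ht.2]) (by linarith [ht.1])
    hp hp1 x
  rwa [show t + (m.T - t) = m.T by ring] at this

/-- Common template for estimates of the fixed point map: `α` carries the inhomogeneous part and `K`
the part proportional to the argument. Integrating first over the Gaussian vector and then over the
uniform time replaces θ e^{θ(1-r)} by e^θ. -/
theorem integrable_driveLaw_of_le {H Q : ℝ × (Fin d → ℝ) → ℝ} (hH : Measurable H)
    (hQ : Measurable Q) {α K q θ : ℝ} (hα : 0 ≤ α) (hK : 0 ≤ K) (hq : 0 ≤ q)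
    (hθ : 0 ≤ θ)
    (hHQ : ∀ r ∈ Icc (0 : ℝ) 1, ∀ z,
      |H (r, z)| ≤ (α + K * (θ * Real.exp (θ * (1 - r)))) * Q (r, z))
    (hQq : ∀ r ∈ Icc (0 : ℝ) 1, ∫⁻ z, ENNReal.ofReal (Q (r, z)) ∂stdNormal d ≤ ENNReal.ofReal q) :
    Integrable H (driveLaw d) ∧ |∫ w, H w ∂driveLaw d| ≤ (α + K * Real.exp θ) * q := by
  have hmain : ∫⁻ w, ‖H w‖ₑ ∂driveLaw d ≤ ENNReal.ofReal ((α + K * Real.exp θ) * q) := by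
    rw [driveLaw, lintegral_prod _ (by fun_prop)]
    calc ∫⁻ r in Icc (0 : ℝ) 1, ∫⁻ z, ‖H (r, z)‖ₑ ∂stdNormal d
        ≤ ∫⁻ r in Icc (0 : ℝ) 1,
          ENNReal.ofReal (α + K * (θ * Real.exp (θ * (1 - r)))) * ENNReal.ofReal q := by
          refine setLIntegral_mono (by fun_prop) fun r hr => ?_
          calc ∫⁻ z, ‖H (r, z)‖ₑ ∂stdNormal d
              ≤ ∫⁻ z, ENNReal.ofReal (α + K * (θ * Real.exp (θ * (1 - r))))
                * ENNReal.ofReal (Q (r, z)) ∂stdNormal d := by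
                refine lintegral_mono fun z => ?_
                rw [Real.enorm_eq_ofReal_abs, ← ENNReal.ofReal_mul (by positivity)]
                exact ENNReal.ofReal_le_ofReal (hHQ r hr z)
            _ ≤ _ := by
                rw [lintegral_const_mul _ (by fun_prop)]
                gcongr
                exact hQq r hr
      _ = (∫⁻ r in Icc (0 : ℝ) 1, (ENNReal.ofReal α
          + ENNReal.ofReal K * ENNReal.ofReal (θ * Real.exp (θ * (1 - r)))))
            * ENNReal.ofReal q := by
          rw [lintegral_mul_const _ (by fun_prop)]
          congr 1
          refine lintegral_congr fun r => ?_
          rw [ENNReal.ofReal_add hα (by positivity), ENNReal.ofReal_mul hK]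
      _ ≤ (ENNReal.ofReal α + ENNReal.ofReal K * ENNReal.ofReal (Real.exp θ))
            * ENNReal.ofReal q := by
          rw [lintegral_add_left measurable_const, lintegral_const, measure_univ, mul_one,
            lintegral_const_mul _ (by fun_prop)]
          gcongr
          exact lintegral_exp_le hθ
      _ = _ := by
          rw [← ENNReal.ofReal_mul hK, ← ENNReal.ofReal_add hα (by positivity),
            ← ENNReal.ofReal_mul (by positivity)]
  refine ⟨⟨hH.aestronglyMeasurable, hmain.trans_lt ENNReal.ofReal_lt_top⟩, ?_⟩
  rw [← ENNReal.ofReal_le_ofReal_iff (by positivity), ← Real.enorm_eq_ofReal_abs]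
  exact (enorm_integral_le_lintegral_enorm _).trans hmain

variable (m)

/-- The expected terminal value. -/
noncomputable def termMean (t : ℝ) (x : Fin d → ℝ) : ℝ := ∫ w, m.g (m.ep t x w) ∂driveLaw d

/-- The integrand of the nonlinear part of the fixed point map. -/
noncomputable def drift (v : ℝ → (Fin d → ℝ) → ℝ) (t : ℝ) (x : Fin d → ℝ)
    (w : ℝ × (Fin d → ℝ)) : ℝ :=
  (m.T - t) * m.f (m.tm t w) (m.sp t x w) (v (m.tm t w) (m.sp t x w))

/-- The fixed point map. -/
noncomputable def picard (v : ℝ → (Fin d → ℝ) → ℝ) (t : ℝ) (x : Fin d → ℝ) : ℝ :=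
  m.termMean t x + ∫ w, m.drift v t x w ∂driveLaw d

/-- `A` bounds `v` in the exponentially weighted norm. -/
def Growth (A : ℝ) (v : ℝ → (Fin d → ℝ) → ℝ) : Prop :=
  ∀ t ∈ Icc 0 m.T, ∀ x,
    |v t x| ≤ A * Real.exp (3 / 2 * m.L * (m.T - t)) * m.wt t x ^ m.β

/-- Lipschitz continuity in space with exponentially weighted constant `A`. -/
def SpaceLip (A : ℝ) (v : ℝ → (Fin d → ℝ) → ℝ) : Prop :=
  ∀ t ∈ Icc 0 m.T, ∀ x y, |v t x - v t y| ≤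
    A * Real.exp (3 / 2 * m.L * (m.T - t))
      * ((√m.T)⁻¹ * m.nrm (x - y) * (m.wt t x + m.wt t y) ^ m.β)

variable {m}

theorem measurable_drift {α : Type*} [MeasurableSpace α] {v : ℝ → (Fin d → ℝ) → ℝ}
    (hv : Measurable fun p : ℝ × (Fin d → ℝ) => v p.1 p.2) {a : α → ℝ} {b : α → Fin d → ℝ}
    {w : α → ℝ × (Fin d → ℝ)} (ha : Measurable a) (hb : Measurable b) (hw : Measurable w) :
    Measurable fun p => m.drift v (a p) (b p) (w p) := by
  unfold drift
  refine (measurable_const.sub ha).mul (m.measurable_f (by fun_prop) (by fun_prop) ?_)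
  exact hv.comp ((m.measurable_tm ha hw).prodMk (m.measurable_sp ha hb hw))

theorem measurable_picard {v : ℝ → (Fin d → ℝ) → ℝ}
    (hv : Measurable fun p : ℝ × (Fin d → ℝ) => v p.1 p.2) :
    Measurable fun p : ℝ × (Fin d → ℝ) => m.picard v p.1 p.2 := by
  unfold picard termMean
  have h1 : StronglyMeasurable (Function.uncurry
      fun (p : ℝ × (Fin d → ℝ)) (w : ℝ × (Fin d → ℝ)) => m.g (m.ep p.1 p.2 w)) :=
    Measurable.stronglyMeasurable (by unfold Function.uncurry; fun_prop)
  have h2 : StronglyMeasurable (Function.uncurry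
      fun (p : ℝ × (Fin d → ℝ)) (w : ℝ × (Fin d → ℝ)) => m.drift v p.1 p.2 w) :=
    Measurable.stronglyMeasurable
      (measurable_drift hv (by fun_prop) (by fun_prop) (by fun_prop))
  exact (h1.integral_prod_right.measurable).add h2.integral_prod_right.measurable

theorem V_rpow_le {t : ℝ} (ht : t ≤ m.T) (x) : m.V x ^ m.β ≤ m.wt t x ^ m.β :=
  Real.rpow_le_rpow (m.V_pos x).le (m.V_le_wt ht x) m.β_pos.le

theorem V_add_rpow_le {s t : ℝ} (hs : s ≤ m.T) (ht : t ≤ m.T) (x y) :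
    (m.V x + m.V y) ^ m.β ≤ (m.wt s x + m.wt t y) ^ m.β :=
  Real.rpow_le_rpow (add_pos (m.V_pos x) (m.V_pos y)).le
    (add_le_add (m.V_le_wt hs x) (m.V_le_wt ht y)) m.β_pos.le

theorem termMean_bound {t : ℝ} (ht : t ∈ Icc 0 m.T) (x) :
    Integrable (fun w => m.g (m.ep t x w)) (driveLaw d) ∧ |m.termMean t x| ≤ m.wt t x ^ m.β := by
  have := integrable_driveLaw_of_le (d := d) (H := fun w => m.g (m.ep t x w))
    (Q := fun w => m.wt m.T (m.ep t x w) ^ m.β) (α := 1) (K := 0) (θ := 0)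
    (q := m.wt t x ^ m.β) (by fun_prop) (by fun_prop)
    zero_le_one le_rfl
    (Real.rpow_nonneg (m.wt_pos _ _).le _) le_rfl
    (fun r _ z => by
      simpa using (m.g_bound _).trans (V_rpow_le le_rfl _))
    (fun r _ => lintegral_wt_ep_rpow_le ht m.β_pos.le (by linarith [m.β_le]) x)
  simpa [termMean] using this

theorem rate_nonneg {t : ℝ} (ht : t ∈ Icc 0 m.T) : 0 ≤ 3 / 2 * m.L * (m.T - t) :=
  mul_nonneg (mul_nonneg (by norm_num) m.L_nonneg) (by linarith [ht.2])

theorem drift_bound {v : ℝ → (Fin d → ℝ) → ℝ}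
    (hv : Measurable fun p : ℝ × (Fin d → ℝ) => v p.1 p.2) {A : ℝ} (hA : 0 ≤ A)
    (hvA : m.Growth A v) {t : ℝ} (ht : t ∈ Icc 0 m.T) (x) :
    Integrable (m.drift v t x) (driveLaw d) ∧ |∫ w, m.drift v t x w ∂driveLaw d| ≤
      (1 + 2 / 3 * A * Real.exp (3 / 2 * m.L * (m.T - t))) * m.wt t x ^ m.β := by
  refine integrable_driveLaw_of_le (Q := fun w => m.wt (m.tm t w) (m.sp t x w) ^ m.β)
    (measurable_drift hv (by fun_prop) (by fun_prop) (by fun_prop)) (by fun_prop)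
    zero_le_one (by positivity)
    (Real.rpow_nonneg (m.wt_pos _ _).le _) (rate_nonneg ht) (fun r hr z => ?_)
    (fun r hr => lintegral_wt_sp_rpow_le ht hr m.β_pos.le (by linarith [m.β_le]) x)
  have hmem := tm_mem (m := m) (w := (r, z)) ht hr
  have h1 := m.abs_f_le (m.tm t (r, z)) (m.sp t x (r, z)) (v (m.tm t (r, z)) (m.sp t x (r, z)))
  have h2 := hvA _ hmem (m.sp t x (r, z))
  have h3 := V_rpow_le (m := m) hmem.2 (m.sp t x (r, z))
  rw [T_sub_tm] at h2
  simp only at h2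
  set q := m.wt (m.tm t (r, z)) (m.sp t x (r, z)) ^ m.β with hq
  have hq0 : 0 ≤ q := Real.rpow_nonneg (m.wt_pos _ _).le _
  have htT : (m.T - t) * m.T⁻¹ ≤ 1 := by
    rw [← div_eq_mul_inv, div_le_one m.T_pos]; linarith [ht.1]
  have ht0 : 0 ≤ m.T - t := by linarith [ht.2]
  unfold drift
  rw [abs_mul, abs_of_nonneg ht0]
  have hTi : 0 ≤ m.T⁻¹ := inv_nonneg.2 m.T_pos.le
  calc _ ≤ (m.T - t) * (m.T⁻¹ * q
        + m.L * (A * Real.exp (3 / 2 * m.L * ((m.T - t) * (1 - r))) * q)) := by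
        refine mul_le_mul_of_nonneg_left (h1.trans ?_) ht0
        have := m.L_nonneg
        gcongr
    -- L(T - t) is written as 2/3 of the rate θ = (3/2) L (T - t), which produces the factor 2/3.
    _ = ((m.T - t) * m.T⁻¹) * q + 2 / 3 * A * (3 / 2 * m.L * (m.T - t) *
          Real.exp (3 / 2 * m.L * (m.T - t) * (1 - r))) * q := by ring_nf
    _ ≤ 1 * q + 2 / 3 * A * (3 / 2 * m.L * (m.T - t) *
          Real.exp (3 / 2 * m.L * (m.T - t) * (1 - r))) * q := by gcongr
    _ = _ := by ring

/-- In a difference f(·, 0) cancels, so the inhomogeneous part is zero and only the factor 2/3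
remains. -/
theorem drift_contract {v w : ℝ → (Fin d → ℝ) → ℝ}
    (hv : Measurable fun p : ℝ × (Fin d → ℝ) => v p.1 p.2)
    (hw : Measurable fun p : ℝ × (Fin d → ℝ) => w p.1 p.2) {A : ℝ} (hA : 0 ≤ A)
    (hvA : m.Growth A fun t x => v t x - w t x) {t : ℝ} (ht : t ∈ Icc 0 m.T) (x) :
    |∫ ω, (m.drift v t x ω - m.drift w t x ω) ∂driveLaw d| ≤
      2 / 3 * A * Real.exp (3 / 2 * m.L * (m.T - t)) * m.wt t x ^ m.β := by
  have := (integrable_driveLaw_of_le (H := fun ω => m.drift v t x ω - m.drift w t x ω)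
    (Q := fun w => m.wt (m.tm t w) (m.sp t x w) ^ m.β) (α := 0) (K := 2 / 3 * A)
    (θ := 3 / 2 * m.L * (m.T - t)) (q := m.wt t x ^ m.β)
    ((measurable_drift hv (by fun_prop) (by fun_prop) (by fun_prop)).sub
      (measurable_drift hw (by fun_prop) (by fun_prop) (by fun_prop))) (by fun_prop)
    le_rfl (by positivity)
    (Real.rpow_nonneg (m.wt_pos _ _).le _) (rate_nonneg ht) (fun r hr z => ?_)
    (fun r hr => lintegral_wt_sp_rpow_le ht hr m.β_pos.le (by linarith [m.β_le]) x)).2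
  · simpa using this
  have hmem := tm_mem (m := m) (w := (r, z)) ht hr
  have h1 := m.f_lip_right (m.tm t (r, z)) (m.sp t x (r, z)) (v (m.tm t (r, z)) (m.sp t x (r, z)))
    (w (m.tm t (r, z)) (m.sp t x (r, z)))
  have h2 := hvA _ hmem (m.sp t x (r, z))
  rw [T_sub_tm] at h2
  simp only at h2
  have ht0 : 0 ≤ m.T - t := by linarith [ht.2]
  unfold drift
  rw [← mul_sub, abs_mul, abs_of_nonneg ht0]
  have := m.L_nonneg
  calc _ ≤ (m.T - t) * (m.L * (A * Real.exp (3 / 2 * m.L * ((m.T - t) * (1 - r)))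
        * m.wt (m.tm t (r, z)) (m.sp t x (r, z)) ^ m.β)) := by
        refine mul_le_mul_of_nonneg_left (h1.trans ?_) ht0
        gcongr
    _ = _ := by ring_nf

end Model
namespace Model

variable {d : ℕ} {m : Model d}

/-! ### Existence and uniqueness of the fixed point -/

theorem lintegral_sp_pair_rpow_le {t : ℝ} (ht : t ∈ Icc 0 m.T) {r : ℝ} (hr : r ∈ Icc (0 : ℝ) 1)
    (x y) :
    ∫⁻ z, ENNReal.ofReal ((m.wt (m.tm t (r, z)) (m.sp t x (r, z))
      + m.wt (m.tm t (r, z)) (m.sp t y (r, z))) ^ m.β) ∂stdNormal d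
      ≤ ENNReal.ofReal ((m.wt t x + m.wt t y) ^ m.β) := by
  refine lintegral_rpow_le (by fun_prop) (fun _ => (add_pos (m.wt_pos _ _) (m.wt_pos _ _)).le)
    (add_pos (m.wt_pos _ _) (m.wt_pos _ _)) m.β_pos.le (by linarith [m.β_le]) ?_
  simp only [sp_eq ht _ (w := (r, _)) hr]
  exact m.lintegral_wt_add_le (step_nonneg ht hr) (step_le ht hr) (step_nonneg ht hr)
    (step_le ht hr) x y

theorem lintegral_ep_pair_rpow_le {t : ℝ} (ht : t ∈ Icc 0 m.T) {r : ℝ} (x y) :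
    ∫⁻ z, ENNReal.ofReal ((m.wt m.T (m.ep t x (r, z)) + m.wt m.T (m.ep t y (r, z))) ^ m.β)
      ∂stdNormal d ≤ ENNReal.ofReal ((m.wt t x + m.wt t y) ^ m.β) := by
  refine lintegral_rpow_le (by fun_prop) (fun _ => (add_pos (m.wt_pos _ _) (m.wt_pos _ _)).le)
    (add_pos (m.wt_pos _ _) (m.wt_pos _ _)) m.β_pos.le (by linarith [m.β_le]) ?_
  simp only [ep_eq ht]
  have h1 : 0 ≤ m.T - t := by linarith [ht.2]
  have h2 : m.T - t ≤ m.T := by linarith [ht.1]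
  have := m.lintegral_wt_add_le (s := t) (t := t) h1 h2 h1 h2 x y
  rwa [show t + (m.T - t) = m.T by ring] at this

theorem termMean_lip {t : ℝ} (ht : t ∈ Icc 0 m.T) (x y) :
    |m.termMean t x - m.termMean t y| ≤
      (√m.T)⁻¹ * m.nrm (x - y) * (m.wt t x + m.wt t y) ^ m.β := by
  have hc : 0 ≤ (√m.T)⁻¹ * m.nrm (x - y) :=
    mul_nonneg (inv_nonneg.2 (Real.sqrt_nonneg _)) (apply_nonneg _ _)
  have := (integrable_driveLaw_of_le (d := d)
    (H := fun w => m.g (m.ep t x w) - m.g (m.ep t y w))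
    (Q := fun w => (m.wt m.T (m.ep t x w) + m.wt m.T (m.ep t y w)) ^ m.β)
    (α := (√m.T)⁻¹ * m.nrm (x - y)) (K := 0) (θ := 0)
    (q := (m.wt t x + m.wt t y) ^ m.β) (by fun_prop) (by fun_prop) hc le_rfl
    (Real.rpow_nonneg (add_pos (m.wt_pos _ _) (m.wt_pos _ _)).le _) le_rfl
    (fun r _ z => ?_) (fun r _ => lintegral_ep_pair_rpow_le ht x y)).2
  · rw [integral_sub (termMean_bound ht x).1 (termMean_bound ht y).1] at this
    simpa [termMean] using this
  · have h1 := m.g_lip (m.ep t x (r, z)) (m.ep t y (r, z))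
    have h2 : m.ep t x (r, z) - m.ep t y (r, z) = x - y := by unfold ep; abel
    rw [h2] at h1
    have h3 := V_add_rpow_le (m := m) le_rfl le_rfl (m.ep t x (r, z)) (m.ep t y (r, z))
    calc _ ≤ _ := h1
      _ ≤ (√m.T)⁻¹ * (m.wt m.T (m.ep t x (r, z)) + m.wt m.T (m.ep t y (r, z))) ^ m.β
          * m.nrm (x - y) := by gcongr
      _ = _ := by ring

/-- At equal times and with equal inputs the two evaluation points keep the difference x - y, so
spatial Lipschitz constants propagate like growth constants. -/
theorem drift_lip {v : ℝ → (Fin d → ℝ) → ℝ}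
    (hv : Measurable fun p : ℝ × (Fin d → ℝ) => v p.1 p.2) {A : ℝ} (hA : 0 ≤ A)
    (hvA : m.SpaceLip A v) {t : ℝ} (ht : t ∈ Icc 0 m.T) (x y) :
    |∫ w, (m.drift v t x w - m.drift v t y w) ∂driveLaw d| ≤
      (1 + 2 / 3 * A * Real.exp (3 / 2 * m.L * (m.T - t)))
        * ((√m.T)⁻¹ * m.nrm (x - y) * (m.wt t x + m.wt t y) ^ m.β) := by
  have hc : 0 ≤ (√m.T)⁻¹ * m.nrm (x - y) :=
    mul_nonneg (inv_nonneg.2 (Real.sqrt_nonneg _)) (apply_nonneg _ _)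
  have := (integrable_driveLaw_of_le (d := d)
    (H := fun w => m.drift v t x w - m.drift v t y w)
    (Q := fun w => (m.wt (m.tm t w) (m.sp t x w) + m.wt (m.tm t w) (m.sp t y w)) ^ m.β)
    (α := (√m.T)⁻¹ * m.nrm (x - y)) (K := 2 / 3 * A * ((√m.T)⁻¹ * m.nrm (x - y)))
    (θ := 3 / 2 * m.L * (m.T - t))
    (q := (m.wt t x + m.wt t y) ^ m.β)
    ((measurable_drift hv (by fun_prop) (by fun_prop) (by fun_prop)).sub
      (measurable_drift hv (by fun_prop) (by fun_prop) (by fun_prop))) (by fun_prop) hc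
    (by positivity) (Real.rpow_nonneg (add_pos (m.wt_pos _ _) (m.wt_pos _ _)).le _)
    (rate_nonneg ht) (fun r hr z => ?_) (fun r hr => lintegral_sp_pair_rpow_le ht hr x y)).2
  · calc _ ≤ _ := this
      _ = _ := by ring
  have hmem := tm_mem (m := m) (w := (r, z)) ht hr
  have hxy : m.sp t x (r, z) - m.sp t y (r, z) = x - y := by unfold sp; abel
  have h1 := m.f_lip (m.tm t (r, z)) (m.tm t (r, z)) (m.sp t x (r, z)) (m.sp t y (r, z))
    (v (m.tm t (r, z)) (m.sp t x (r, z))) (v (m.tm t (r, z)) (m.sp t y (r, z)))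
  have h2 := hvA _ hmem (m.sp t x (r, z)) (m.sp t y (r, z))
  have h3 := V_add_rpow_le (m := m) hmem.2 hmem.2 (m.sp t x (r, z)) (m.sp t y (r, z))
  rw [T_sub_tm] at h2
  rw [hxy] at h1 h2
  simp only [sub_self, abs_zero, Real.sqrt_zero, zero_add] at h1 h2
  set q := (m.wt (m.tm t (r, z)) (m.sp t x (r, z)) + m.wt (m.tm t (r, z)) (m.sp t y (r, z))) ^ m.β
    with hq
  have hq0 : 0 ≤ q := Real.rpow_nonneg (add_pos (m.wt_pos _ _) (m.wt_pos _ _)).le _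
  have htT : (m.T - t) * m.T⁻¹ ≤ 1 := by
    rw [← div_eq_mul_inv, div_le_one m.T_pos]; linarith [ht.1]
  have ht0 : 0 ≤ m.T - t := by linarith [ht.2]
  have hTi : 0 ≤ m.T⁻¹ := inv_nonneg.2 m.T_pos.le
  have hL := m.L_nonneg
  have hn : 0 ≤ m.nrm (x - y) := apply_nonneg _ _
  unfold drift
  rw [← mul_sub, abs_mul, abs_of_nonneg ht0]
  calc _ ≤ (m.T - t) * (m.T⁻¹ * (√m.T)⁻¹ * q * m.nrm (x - y)
        + m.L * (A * Real.exp (3 / 2 * m.L * ((m.T - t) * (1 - r)))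
          * ((√m.T)⁻¹ * m.nrm (x - y) * q))) := by
        refine mul_le_mul_of_nonneg_left (h1.trans ?_) ht0
        gcongr
    _ = ((m.T - t) * m.T⁻¹) * ((√m.T)⁻¹ * m.nrm (x - y)) * q
        + 2 / 3 * A * (3 / 2 * m.L * (m.T - t) *
          Real.exp (3 / 2 * m.L * (m.T - t) * (1 - r))) * ((√m.T)⁻¹ * m.nrm (x - y)) * q := by
        ring_nf
    _ ≤ 1 * ((√m.T)⁻¹ * m.nrm (x - y)) * q
        + 2 / 3 * A * (3 / 2 * m.L * (m.T - t) *
          Real.exp (3 / 2 * m.L * (m.T - t) * (1 - r))) * ((√m.T)⁻¹ * m.nrm (x - y)) * q := by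
        gcongr
    _ = _ := by ring

theorem one_le_exp_rate {t : ℝ} (ht : t ∈ Icc 0 m.T) :
    1 ≤ Real.exp (3 / 2 * m.L * (m.T - t)) := Real.one_le_exp (rate_nonneg ht)

/-- The constant 6 solves 1 + 1 + (2/3)A = A, the two units coming from the terminal value and from
f(·, 0). -/
theorem picard_growth {v : ℝ → (Fin d → ℝ) → ℝ}
    (hv : Measurable fun p : ℝ × (Fin d → ℝ) => v p.1 p.2) (hvA : m.Growth 6 v) :
    m.Growth 6 (m.picard v) := by
  intro t ht x
  have h1 := (termMean_bound ht x).2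
  have h2 := (drift_bound hv (by norm_num) hvA ht x).2
  have h3 := one_le_exp_rate ht
  have hq : 0 ≤ m.wt t x ^ m.β := Real.rpow_nonneg (m.wt_pos _ _).le _
  unfold picard
  refine (abs_add_le _ _).trans ?_
  nlinarith

theorem picard_spaceLip {v : ℝ → (Fin d → ℝ) → ℝ}
    (hv : Measurable fun p : ℝ × (Fin d → ℝ) => v p.1 p.2) {A : ℝ} (hA : 0 ≤ A)
    (hg : m.Growth A v) (hvA : m.SpaceLip 6 v) : m.SpaceLip 6 (m.picard v) := by
  intro t ht x y
  have h1 := termMean_lip ht x y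
  have h2 := drift_lip hv (by norm_num) hvA ht x y
  rw [integral_sub (drift_bound hv hA hg ht x).1
    (drift_bound hv hA hg ht y).1] at h2
  have h3 := one_le_exp_rate ht
  have hq : 0 ≤ (√m.T)⁻¹ * m.nrm (x - y) * (m.wt t x + m.wt t y) ^ m.β :=
    mul_nonneg (mul_nonneg (inv_nonneg.2 (Real.sqrt_nonneg _)) (apply_nonneg _ _))
      (Real.rpow_nonneg (add_pos (m.wt_pos _ _) (m.wt_pos _ _)).le _)
  unfold picard
  rw [show ∀ a b c d : ℝ, (a + b) - (c + d) = (a - c) + (b - d) by intros; ring]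
  refine (abs_add_le _ _).trans ?_
  nlinarith

theorem picard_contract {v w : ℝ → (Fin d → ℝ) → ℝ}
    (hv : Measurable fun p : ℝ × (Fin d → ℝ) => v p.1 p.2)
    (hw : Measurable fun p : ℝ × (Fin d → ℝ) => w p.1 p.2) {A B B' : ℝ} (hA : 0 ≤ A)
    (hB : 0 ≤ B) (hB' : 0 ≤ B') (hvB : m.Growth B v) (hwB : m.Growth B' w)
    (hvA : m.Growth A fun t x => v t x - w t x) :
    m.Growth (2 / 3 * A) fun t x => m.picard v t x - m.picard w t x := by
  intro t ht x
  have h2 := drift_contract hv hw hA hvA ht x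
  rw [integral_sub (drift_bound hv hB hvB ht x).1 (drift_bound hw hB' hwB ht x).1] at h2
  unfold picard
  simpa using h2

variable (m) in
/-- The Picard iterates started from zero. -/
noncomputable def iter : ℕ → ℝ → (Fin d → ℝ) → ℝ
  | 0 => fun _ _ => 0
  | k + 1 => m.picard (iter k)

theorem measurable_iter (k : ℕ) : Measurable fun p : ℝ × (Fin d → ℝ) => m.iter k p.1 p.2 := by
  induction k with
  | zero => exact measurable_const
  | succ k ih => exact measurable_picard ih

theorem iter_growth (k : ℕ) : m.Growth 6 (m.iter k) := by
  induction k with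
  | zero =>
    intro t ht x
    simp only [iter, abs_zero]
    exact mul_nonneg (by positivity) (Real.rpow_nonneg (m.wt_pos _ _).le _)
  | succ k ih => exact picard_growth (measurable_iter k) ih

theorem iter_spaceLip (k : ℕ) : m.SpaceLip 6 (m.iter k) := by
  induction k with
  | zero =>
    intro t ht x y
    simp only [iter, sub_self, abs_zero]
    exact mul_nonneg (by positivity) (mul_nonneg
      (mul_nonneg (inv_nonneg.2 (Real.sqrt_nonneg _)) (apply_nonneg _ _))
      (Real.rpow_nonneg (add_pos (m.wt_pos _ _) (m.wt_pos _ _)).le _))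
  | succ k ih => exact picard_spaceLip (measurable_iter k) (by norm_num) (iter_growth k) ih

theorem iter_succ_sub (k : ℕ) :
    m.Growth ((2 / 3) ^ k * 6) fun t x => m.iter (k + 1) t x - m.iter k t x := by
  induction k with
  | zero =>
    have := iter_growth (m := m) 1
    simpa [iter] using this
  | succ k ih =>
    have := picard_contract (measurable_iter (k + 1)) (measurable_iter k) (by positivity)
      (by norm_num) (by norm_num) (iter_growth (k + 1)) (iter_growth k) ih
    rw [show 2 / 3 * ((2 / 3) ^ k * 6) = (2 / 3 : ℝ) ^ (k + 1) * 6 by ring] at this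
    exact this

variable (m) in
/-- The limit of the Picard iterates. -/
noncomputable def sol (t : ℝ) (x : Fin d → ℝ) : ℝ :=
  Filter.limsup (fun k => m.iter k t x) Filter.atTop

/-- Taking a limsup makes measurability on the whole time axis automatic, whereas convergence is
only known on [0, T]. -/
theorem measurable_sol : Measurable fun p : ℝ × (Fin d → ℝ) => m.sol p.1 p.2 :=
  .limsup fun k => measurable_iter k

theorem iter_dist_le {t : ℝ} (ht : t ∈ Icc 0 m.T) (x) (k : ℕ) :
    dist (m.iter k t x) (m.iter (k + 1) t x) ≤
      (6 * Real.exp (3 / 2 * m.L * (m.T - t)) * m.wt t x ^ m.β) * (2 / 3) ^ k := by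
  rw [dist_comm, Real.dist_eq]
  refine (iter_succ_sub k t ht x).trans_eq ?_
  ring

theorem tendsto_iter {t : ℝ} (ht : t ∈ Icc 0 m.T) (x) :
    Filter.Tendsto (fun k => m.iter k t x) Filter.atTop (nhds (m.sol t x)) := by
  obtain ⟨a, ha⟩ := cauchySeq_tendsto_of_complete
    (cauchySeq_of_le_geometric _ _ (by norm_num) (iter_dist_le ht x))
  rwa [sol, ha.limsup_eq]

theorem sol_growth : m.Growth 6 m.sol := fun t ht x =>
  le_of_tendsto (tendsto_iter ht x).abs (.of_forall fun k => iter_growth k t ht x)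

theorem sol_spaceLip : m.SpaceLip 6 m.sol := fun t ht x y =>
  le_of_tendsto ((tendsto_iter ht x).sub (tendsto_iter ht y)).abs
    (.of_forall fun k => iter_spaceLip k t ht x y)

/-- The tail of the geometric series gives 18 = 6 / (1 - 2/3). -/
theorem iter_sub_sol (k : ℕ) :
    m.Growth ((2 / 3) ^ k * 18) fun t x => m.iter k t x - m.sol t x := by
  intro t ht x
  have := dist_le_of_le_geometric_of_tendsto _ _ (by norm_num) (iter_dist_le ht x)
    (tendsto_iter ht x) k
  rw [Real.dist_eq] at this
  refine this.trans_eq ?_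
  ring

theorem tendsto_zero_of_growth {v : ℕ → ℝ → (Fin d → ℝ) → ℝ} {C : ℝ}
    (hv : ∀ k, m.Growth ((2 / 3) ^ k * C) (v k)) {t : ℝ} (ht : t ∈ Icc 0 m.T) (x) :
    Filter.Tendsto (fun k => v k t x) Filter.atTop (nhds 0) := by
  refine squeeze_zero_norm (fun k => hv k t ht x) ?_
  have h := (tendsto_pow_atTop_nhds_zero_of_lt_one (by norm_num : (0 : ℝ) ≤ 2 / 3)
    (by norm_num)).mul_const (C * Real.exp (3 / 2 * m.L * (m.T - t)) * m.wt t x ^ m.β)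
  rw [zero_mul] at h
  refine h.congr fun k => ?_
  ring

theorem picard_sol {t : ℝ} (ht : t ∈ Icc 0 m.T) (x) : m.picard m.sol t x = m.sol t x := by
  have h1 : ∀ k, m.Growth ((2 / 3) ^ k * 12)
      fun t x => m.iter (k + 1) t x - m.picard m.sol t x := by
    intro k
    have := picard_contract (m := m) (measurable_iter k) measurable_sol (by positivity)
      (by norm_num) (by norm_num) (iter_growth k) sol_growth (iter_sub_sol k)
    rw [show 2 / 3 * ((2 / 3) ^ k * 18) = (2 / 3 : ℝ) ^ k * 12 by ring] at this
    exact this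
  have h2 := tendsto_zero_of_growth h1 ht x
  have h3 := ((tendsto_iter ht x).comp (Filter.tendsto_add_atTop_nat 1)).sub_const
    (m.picard m.sol t x)
  have := tendsto_nhds_unique h2 h3
  linarith

/-- The difference of two fixed points has finite weighted norm, and the contraction improves this
norm by 2/3 arbitrarily often. -/
theorem eq_sol_of_picard {v : ℝ → (Fin d → ℝ) → ℝ}
    (hv : Measurable fun p : ℝ × (Fin d → ℝ) => v p.1 p.2) {A : ℝ} (hA : 0 ≤ A)
    (hvA : m.Growth A v) (heq : ∀ t ∈ Icc 0 m.T, ∀ x, v t x = m.picard v t x) {t : ℝ}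
    (ht : t ∈ Icc 0 m.T) (x) : v t x = m.sol t x := by
  have h : ∀ k, m.Growth ((2 / 3) ^ k * (A + 6)) fun t x => v t x - m.sol t x := by
    intro k
    induction k with
    | zero =>
      intro t ht x
      have h1 := hvA t ht x
      have h2 := sol_growth (m := m) t ht x
      refine (abs_sub _ _).trans ?_
      rw [pow_zero, one_mul]
      linarith
    | succ k ih =>
      have := picard_contract hv measurable_sol (by positivity) hA (by norm_num) hvA sol_growth ih
      intro t ht x
      have h1 := this t ht x
      simp only [picard_sol ht, ← heq t ht] at h1
      refine h1.trans_eq ?_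
      ring
  have := tendsto_nhds_unique (tendsto_zero_of_growth h ht x) tendsto_const_nhds
  linarith

end Model
namespace Model

variable {d : ℕ} {m : Model d}

/-! ### Time integral form and Hölder continuity of the solution -/

variable (m) in
/-- The expectation of the nonlinearity along the flow. -/
noncomputable def mean (v : ℝ → (Fin d → ℝ) → ℝ) (t : ℝ) (x : Fin d → ℝ) (s : ℝ) : ℝ :=
  ∫ z, m.f s (x + √|t - s| • z) (v s (x + √|t - s| • z)) ∂stdNormal d

theorem termMean_eq (t x) : m.termMean t x = ∫ z, m.g (x + √|t - m.T| • z) ∂stdNormal d := by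
  unfold termMean ep driveLaw
  rw [integral_fun_snd (fun z : Fin d → ℝ => m.g (x + √|t - m.T| • z))]
  simp

/-- Substitution of s = t + (T - t)r, the factor T - t in `drift` being the Jacobian. -/
theorem integral_drift_eq {v : ℝ → (Fin d → ℝ) → ℝ}
    (hv : Measurable fun p : ℝ × (Fin d → ℝ) => v p.1 p.2) {A : ℝ} (hA : 0 ≤ A)
    (hvA : m.Growth A v) {t : ℝ} (ht : t ∈ Icc 0 m.T) (x) :
    ∫ w, m.drift v t x w ∂driveLaw d = ∫ s in t..m.T, m.mean v t x s := by
  have hi := (drift_bound hv hA hvA ht x).1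
  unfold driveLaw at hi ⊢
  rw [integral_prod _ hi]
  simp only [drift, sp, tm, integral_const_mul]
  have := intervalIntegral.smul_integral_comp_add_mul (a := 0) (b := 1) (m.mean v t x)
    (m.T - t) t
  rw [mul_zero, add_zero, mul_one, add_sub_cancel] at this
  rw [← this, integral_Icc_eq_integral_Ioc, intervalIntegral.integral_of_le zero_le_one,
    smul_eq_mul]
  rfl

theorem picard_eq {v : ℝ → (Fin d → ℝ) → ℝ}
    (hv : Measurable fun p : ℝ × (Fin d → ℝ) => v p.1 p.2) {A : ℝ} (hA : 0 ≤ A)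
    (hvA : m.Growth A v) {t : ℝ} (ht : t ∈ Icc 0 m.T) (x) :
    m.picard v t x = (∫ z, m.g (x + √|t - m.T| • z) ∂stdNormal d)
      + ∫ s in t..m.T, m.mean v t x s := by
  rw [picard, integral_drift_eq hv hA hvA ht, termMean_eq]

theorem measurable_mean {v : ℝ → (Fin d → ℝ) → ℝ}
    (hv : Measurable fun p : ℝ × (Fin d → ℝ) => v p.1 p.2) (t x) :
    StronglyMeasurable fun s => m.mean v t x s := by
  unfold mean
  refine StronglyMeasurable.integral_prod_right (f := fun (s : ℝ) (z : Fin d → ℝ) =>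
    m.f s (x + √|t - s| • z) (v s (x + √|t - s| • z))) (Measurable.stronglyMeasurable ?_)
  refine m.measurable_f (by fun_prop) (by fun_prop) ?_
  exact hv.comp (f := fun p : ℝ × (Fin d → ℝ) => (p.1, x + √|t - p.1| • p.2)) (by fun_prop)

theorem integrand_bound {v : ℝ → (Fin d → ℝ) → ℝ} {A : ℝ} (hA : 0 ≤ A)
    (hvA : m.Growth A v) {t s : ℝ} (ht : t ∈ Icc 0 m.T) (hs : s ∈ Icc t m.T) (x) :
    ∫⁻ z, ENNReal.ofReal |m.f s (x + √|t - s| • z) (v s (x + √|t - s| • z))| ∂stdNormal d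
      ≤ ENNReal.ofReal ((m.T⁻¹ + m.L * (A * Real.exp (3 / 2 * m.L * m.T))) * m.wt t x ^ m.β) := by
  have hsT : s ∈ Icc 0 m.T := ⟨ht.1.trans hs.1, hs.2⟩
  have hk : 0 ≤ m.T⁻¹ + m.L * (A * Real.exp (3 / 2 * m.L * m.T)) :=
    add_nonneg (inv_nonneg.2 m.T_pos.le) (mul_nonneg m.L_nonneg (by positivity))
  rw [ENNReal.ofReal_mul hk]
  have key := m.lintegral_wt_rpow_le (t := t) (h := s - t) (p := m.β) (by linarith [hs.1])
    (by linarith [hs.2, ht.1]) m.β_pos.le (by linarith [m.β_le]) x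
  rw [add_sub_cancel] at key
  have e : |t - s| = s - t := by rw [abs_sub_comm, abs_of_nonneg (by linarith [hs.1])]
  rw [e]
  calc _ ≤ ∫⁻ z, ENNReal.ofReal (m.T⁻¹ + m.L * (A * Real.exp (3 / 2 * m.L * m.T)))
        * ENNReal.ofReal (m.wt s (x + √(s - t) • z) ^ m.β) ∂stdNormal d := by
        refine lintegral_mono fun z => ?_
        rw [← ENNReal.ofReal_mul hk]
        refine ENNReal.ofReal_le_ofReal ((m.abs_f_le _ _ _).trans ?_)
        have h1 := V_rpow_le (m := m) hsT.2 (x + √(s - t) • z)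
        have h2 := hvA s hsT (x + √(s - t) • z)
        have h3 : Real.exp (3 / 2 * m.L * (m.T - s)) ≤ Real.exp (3 / 2 * m.L * m.T) := by
          have := m.L_nonneg
          gcongr
          linarith [hsT.1]
        have hq : 0 ≤ m.wt s (x + √(s - t) • z) ^ m.β := Real.rpow_nonneg (m.wt_pos _ _).le _
        have hTi : 0 ≤ m.T⁻¹ := inv_nonneg.2 m.T_pos.le
        have := m.L_nonneg
        calc _ ≤ m.T⁻¹ * m.wt s (x + √(s - t) • z) ^ m.β + m.L * (A * Real.exp (3 / 2 * m.L * m.T)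
              * m.wt s (x + √(s - t) • z) ^ m.β) := by
              gcongr
              refine h2.trans ?_
              gcongr
          _ = _ := by ring
    _ = _ := lintegral_const_mul _ (by fun_prop)
    _ ≤ _ := by gcongr

theorem integrable_integrand {v : ℝ → (Fin d → ℝ) → ℝ}
    (hv : Measurable fun p : ℝ × (Fin d → ℝ) => v p.1 p.2) {A : ℝ} (hA : 0 ≤ A)
    (hvA : m.Growth A v) {t s : ℝ} (ht : t ∈ Icc 0 m.T) (hs : s ∈ Icc t m.T) (x) :
    Integrable (fun z => m.f s (x + √|t - s| • z) (v s (x + √|t - s| • z))) (stdNormal d) := by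
  refine ⟨(m.measurable_f (by fun_prop) (by fun_prop) ?_).aestronglyMeasurable, ?_⟩
  · exact hv.comp (f := fun z : Fin d → ℝ => (s, x + √|t - s| • z)) (by fun_prop)
  · refine lt_of_le_of_lt ?_ (ENNReal.ofReal_lt_top (r :=
      (m.T⁻¹ + m.L * (A * Real.exp (3 / 2 * m.L * m.T))) * m.wt t x ^ m.β))
    simpa only [Real.enorm_eq_ofReal_abs] using integrand_bound hA hvA ht hs x

theorem abs_mean_le {v : ℝ → (Fin d → ℝ) → ℝ} {A : ℝ} (hA : 0 ≤ A)
    (hvA : m.Growth A v) {t s : ℝ} (ht : t ∈ Icc 0 m.T) (hs : s ∈ Icc t m.T) (x) :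
    |m.mean v t x s| ≤
      (m.T⁻¹ + m.L * (A * Real.exp (3 / 2 * m.L * m.T))) * m.wt t x ^ m.β := by
  have hk : 0 ≤ m.T⁻¹ + m.L * (A * Real.exp (3 / 2 * m.L * m.T)) :=
    add_nonneg (inv_nonneg.2 m.T_pos.le) (mul_nonneg m.L_nonneg (by positivity))
  rw [← ENNReal.ofReal_le_ofReal_iff (mul_nonneg hk (Real.rpow_nonneg (m.wt_pos _ _).le _)),
    ← Real.enorm_eq_ofReal_abs]
  refine (enorm_integral_le_lintegral_enorm _).trans ?_
  simpa only [Real.enorm_eq_ofReal_abs] using integrand_bound hA hvA ht hs x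

theorem intervalIntegrable_mean {v : ℝ → (Fin d → ℝ) → ℝ}
    (hv : Measurable fun p : ℝ × (Fin d → ℝ) => v p.1 p.2) {A : ℝ} (hA : 0 ≤ A)
    (hvA : m.Growth A v) {t a b : ℝ} (ht : t ∈ Icc 0 m.T) (hab : a ≤ b) (ha : t ≤ a)
    (hb : b ≤ m.T) (x) : IntervalIntegrable (m.mean v t x) volume a b := by
  rw [intervalIntegrable_iff_integrableOn_Ioc_of_le hab]
  refine Measure.integrableOn_of_bounded (by simp) (measurable_mean hv t x).aestronglyMeasurable
    (M := (m.T⁻¹ + m.L * (A * Real.exp (3 / 2 * m.L * m.T))) * m.wt t x ^ m.β) ?_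
  refine (ae_restrict_mem measurableSet_Ioc).mono fun s hs => ?_
  exact abs_mean_le hA hvA ht ⟨ha.trans hs.1.le, hs.2.trans hb⟩ x

/-- Integration of a bound by the weight and the coupled distance. -/
theorem abs_integral_le_pair {s t h k p κ : ℝ} (hh : 0 ≤ h) (hT : h ≤ m.T) (hk : 0 ≤ k)
    (kT : k ≤ m.T) (hp : 0 ≤ p) (hp4 : p ≤ 1 / 4) (hκ : 0 ≤ κ) (x y) {D : (Fin d → ℝ) → ℝ}
    (hD : Measurable D) (hDb : ∀ z, |D z| ≤ κ *
      ((m.wt (s + h) (x + √h • z) + m.wt (t + k) (y + √k • z)) ^ p * m.cdst s t x y z)) :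
    |∫ z, D z ∂stdNormal d| ≤ κ * ((m.wt s x + m.wt t y) ^ p * (2 * m.dst s t x y)) := by
  have hq : 0 ≤ (m.wt s x + m.wt t y) ^ p * (2 * m.dst s t x y) :=
    mul_nonneg (Real.rpow_nonneg (add_pos (m.wt_pos _ _) (m.wt_pos _ _)).le _)
      (mul_nonneg (by norm_num) (m.dst_nonneg _ _ _ _))
  refine abs_integral_le_of_eLpNorm_two hD.aestronglyMeasurable (mul_nonneg hκ hq) ?_
  rw [eLpNorm_two_le_iff (mul_nonneg hκ hq), mul_pow, ENNReal.ofReal_mul (sq_nonneg κ)]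
  refine le_trans ?_ (mul_le_mul_right (m.lintegral_pair_le (s := s) (t := t) hh hT hk kT hp hp4 x y) _)
  rw [← lintegral_const_mul _ (by unfold cdst; fun_prop)]
  refine lintegral_mono fun z => ?_
  rw [← ENNReal.ofReal_mul (sq_nonneg κ), ← mul_pow]
  exact ENNReal.ofReal_le_ofReal (sq_le_sq' (by linarith [neg_abs_le (D z), hDb z])
    ((le_abs_self _).trans (hDb z)))

theorem termMean_holder {s t : ℝ} (hs : s ∈ Icc 0 m.T) (ht : t ∈ Icc 0 m.T) (x y) :
    |m.termMean s x - m.termMean t y| ≤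
      (√m.T)⁻¹ * ((m.wt s x + m.wt t y) ^ m.β * (2 * m.dst s t x y)) := by
  have hi : ∀ {t}, t ∈ Icc 0 m.T → ∀ x,
      Integrable (fun z => m.g (x + √|t - m.T| • z)) (stdNormal d) := by
    intro t ht x
    have := (termMean_bound ht x).1
    unfold driveLaw ep at this
    simpa using this.integral_prod_right
  have e : ∀ {t}, t ∈ Icc 0 m.T → |t - m.T| = m.T - t := fun ht => by
    rw [abs_sub_comm, abs_of_nonneg (by linarith [ht.2])]
  rw [termMean_eq, termMean_eq, ← integral_sub (hi hs x) (hi ht y), e hs, e ht]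
  refine abs_integral_le_pair (h := m.T - s) (k := m.T - t) (by linarith [hs.2])
    (by linarith [hs.1]) (by linarith [ht.2]) (by linarith [ht.1]) m.β_pos.le
    (by linarith [m.β_le]) (inv_nonneg.2 (Real.sqrt_nonneg _)) x y (by fun_prop) fun z => ?_
  rw [add_sub_cancel, add_sub_cancel]
  refine (m.g_lip _ _).trans ?_
  rw [mul_assoc]
  have h1 := V_add_rpow_le (m := m) le_rfl le_rfl (x + √(m.T - s) • z) (y + √(m.T - t) • z)
  have h2 := m.nrm_sub_le_cdst (s := s) (t := t) (a := √(m.T - s)) (b := √(m.T - t))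
    (by
      refine (abs_sqrt_sub_sqrt_le (by linarith [hs.2]) (by linarith [ht.2])).trans_eq ?_
      rw [show m.T - s - (m.T - t) = -(s - t) by ring, abs_neg]) x y z
  gcongr
  exact Real.rpow_nonneg (add_pos (m.wt_pos _ _) (m.wt_pos _ _)).le _

/-- Both means are taken at the same time σ, so only spatial regularity of `v` is needed. The
difference of the starting times enters only through the different scalings of the common Gaussian
vector. -/
theorem mean_holder {v : ℝ → (Fin d → ℝ) → ℝ}
    (hv : Measurable fun p : ℝ × (Fin d → ℝ) => v p.1 p.2) (hg : m.Growth 6 v)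
    (hvL : m.SpaceLip 6 v) {s t σ : ℝ} (hs : s ∈ Icc 0 m.T)
    (ht : t ∈ Icc 0 m.T) (hst : s ≤ t) (hσ : σ ∈ Icc t m.T) (x y) :
    |m.mean v s x σ - m.mean v t y σ| ≤
      ((m.T⁻¹ + m.L * (6 * Real.exp (3 / 2 * m.L * m.T))) * (√m.T)⁻¹)
        * ((m.wt s x + m.wt t y) ^ m.β * (2 * m.dst s t x y)) := by
  have hσT : σ ∈ Icc 0 m.T := ⟨ht.1.trans hσ.1, hσ.2⟩
  have hsσ : σ ∈ Icc s m.T := ⟨hst.trans hσ.1, hσ.2⟩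
  have e : ∀ {t}, t ≤ σ → |t - σ| = σ - t := fun ht => by
    rw [abs_sub_comm, abs_of_nonneg (by linarith)]
  have hTi : 0 ≤ m.T⁻¹ := inv_nonneg.2 m.T_pos.le
  have hsi : 0 ≤ (√m.T)⁻¹ := inv_nonneg.2 (Real.sqrt_nonneg _)
  have hL := m.L_nonneg
  have hmeas : ∀ t x, Measurable fun z =>
      m.f σ (x + √|t - σ| • z) (v σ (x + √|t - σ| • z)) := fun t x =>
    m.measurable_f (by fun_prop) (by fun_prop)
      (hv.comp (f := fun z : Fin d → ℝ => (σ, x + √|t - σ| • z)) (by fun_prop))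
  unfold mean
  rw [← integral_sub (integrable_integrand hv (by norm_num) hg hs hsσ x)
    (integrable_integrand hv (by norm_num) hg ht hσ y)]
  refine abs_integral_le_pair (h := σ - s) (k := σ - t) (by linarith [hsσ.1])
    (by linarith [hσT.2, hs.1]) (by linarith [hσ.1]) (by linarith [hσT.2, ht.1]) m.β_pos.le
    (by linarith [m.β_le]) (by positivity) x y ((hmeas s x).sub (hmeas t y)) fun z => ?_
  rw [add_sub_cancel, add_sub_cancel, e hsσ.1, e hσ.1]
  have h1 := m.f_lip σ σ (x + √(σ - s) • z) (y + √(σ - t) • z) (v σ (x + √(σ - s) • z))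
    (v σ (y + √(σ - t) • z))
  have h2 := hvL σ hσT (x + √(σ - s) • z) (y + √(σ - t) • z)
  have h3 := V_add_rpow_le (m := m) hσT.2 hσT.2 (x + √(σ - s) • z) (y + √(σ - t) • z)
  have h4 := m.nrm_sub_le_cdst (s := s) (t := t) (a := √(σ - s)) (b := √(σ - t))
    (by
      refine (abs_sqrt_sub_sqrt_le (by linarith [hsσ.1]) (by linarith [hσ.1])).trans_eq ?_
      rw [show σ - s - (σ - t) = -(s - t) by ring, abs_neg]) x y z
  have h5 : Real.exp (3 / 2 * m.L * (m.T - σ)) ≤ Real.exp (3 / 2 * m.L * m.T) := by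
    gcongr
    linarith [hσT.1]
  simp only [sub_self, abs_zero, Real.sqrt_zero, zero_add] at h1
  set q := (m.wt σ (x + √(σ - s) • z) + m.wt σ (y + √(σ - t) • z)) ^ m.β with hq
  have hq0 : 0 ≤ q := Real.rpow_nonneg (add_pos (m.wt_pos _ _) (m.wt_pos _ _)).le _
  have hn : 0 ≤ m.nrm ((x + √(σ - s) • z) - (y + √(σ - t) • z)) := apply_nonneg _ _
  calc _ ≤ m.T⁻¹ * (√m.T)⁻¹ * q * m.cdst s t x y z + m.L *
        (6 * Real.exp (3 / 2 * m.L * m.T) * ((√m.T)⁻¹ * m.cdst s t x y z * q)) := by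
        refine h1.trans ?_
        gcongr
        refine h2.trans ?_
        gcongr
    _ = _ := by ring

/-- For positive a, e^{a/2} ≥ (1 + a/4)² ≥ a, the last step being (1 - a/4)² ≥ 0. -/
theorem self_le_exp_half (a : ℝ) : a ≤ Real.exp (a / 2) := by
  have h := Real.add_one_le_exp (a / 4)
  rcases le_or_gt a 0 with ha | ha
  · exact ha.trans (Real.exp_pos _).le
  · rw [show a / 2 = a / 4 + a / 4 by ring, Real.exp_add]
    nlinarith [sq_nonneg (a / 4 - 1), mul_self_le_mul_self (by linarith : 0 ≤ a / 4 + 1) h]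

theorem mul_exp_le (a : ℝ) : a * Real.exp (3 / 2 * a) ≤ Real.exp (2 * a) := by
  rw [show 2 * a = a / 2 + 3 / 2 * a by ring, Real.exp_add]
  exact mul_le_mul_of_nonneg_right (self_le_exp_half a) (Real.exp_pos _).le

/-- The increment splits into the terminal part, the integral over [s, t] and a comparison of
integrands on [t, T]. Only the middle part is not a coupling estimate; it is of order t - s. -/
theorem sol_holder_of_le {s t : ℝ} (hs : s ∈ Icc 0 m.T) (ht : t ∈ Icc 0 m.T) (hst : s ≤ t)
    (x y) : |m.sol s x - m.sol t y| ≤ 25 * Real.exp (2 * (m.L * m.T)) *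
      ((√m.T)⁻¹ * m.dst s t x y * (m.wt s x + m.wt t y) ^ m.β) := by
  have hu := measurable_sol (m := m)
  have hg := sol_growth (m := m)
  set κ := m.T⁻¹ + m.L * (6 * Real.exp (3 / 2 * m.L * m.T)) with hκ
  set W := (m.wt s x + m.wt t y) ^ m.β with hW
  have hW0 : 0 ≤ W := Real.rpow_nonneg (add_pos (m.wt_pos _ _) (m.wt_pos _ _)).le _
  have hκ0 : 0 ≤ κ :=
    add_nonneg (inv_nonneg.2 m.T_pos.le) (mul_nonneg m.L_nonneg (by positivity))
  have hD := m.dst_nonneg s t x y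
  have hsi : 0 ≤ (√m.T)⁻¹ := inv_nonneg.2 (Real.sqrt_nonneg _)
  have i1 := intervalIntegrable_mean hu (by norm_num) hg hs hst le_rfl ht.2 x
  have i2 := intervalIntegrable_mean hu (by norm_num) hg hs ht.2 hst le_rfl x
  have i3 := intervalIntegrable_mean hu (by norm_num) hg ht ht.2 le_rfl le_rfl y
  have e : m.sol s x - m.sol t y = (m.termMean s x - m.termMean t y)
      + (∫ σ in s..t, m.mean m.sol s x σ)
      + ∫ σ in t..m.T, (m.mean m.sol s x σ - m.mean m.sol t y σ) := by
    rw [← picard_sol hs, ← picard_sol ht, picard, picard,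
      integral_drift_eq hu (by norm_num) hg hs, integral_drift_eq hu (by norm_num) hg ht,
      intervalIntegral.integral_sub i2 i3, ← intervalIntegral.integral_add_adjacent_intervals i1 i2]
    ring
  have b1 := termMean_holder hs ht x y
  have b2 : |∫ σ in s..t, m.mean m.sol s x σ| ≤ κ * m.wt s x ^ m.β * |t - s| := by
    rw [← Real.norm_eq_abs]
    refine intervalIntegral.norm_integral_le_of_norm_le_const fun σ hσ => ?_
    rw [uIoc_of_le hst] at hσ
    exact abs_mean_le (by norm_num) hg hs ⟨hσ.1.le, hσ.2.trans ht.2⟩ x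
  have b3 : |∫ σ in t..m.T, (m.mean m.sol s x σ - m.mean m.sol t y σ)| ≤
      κ * (√m.T)⁻¹ * (W * (2 * m.dst s t x y)) * |m.T - t| := by
    rw [← Real.norm_eq_abs]
    refine intervalIntegral.norm_integral_le_of_norm_le_const fun σ hσ => ?_
    rw [uIoc_of_le ht.2] at hσ
    exact mean_holder hu hg sol_spaceLip hs ht hst ⟨hσ.1.le, hσ.2⟩ x y
  -- One of the two factors √|s - t| is spent on √T, the other on the distance.
  have c1 : |t - s| ≤ m.T * ((√m.T)⁻¹ * m.dst s t x y) := by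
    have h1 := m.sqrt_le_dst s t x y
    have h2 : |t - s| = √|s - t| * √|s - t| := by
      rw [Real.mul_self_sqrt (abs_nonneg _), abs_sub_comm]
    have h3 : √|s - t| ≤ √m.T := by
      apply Real.sqrt_le_sqrt
      rw [abs_le]
      constructor <;> linarith [hs.1, hs.2, ht.1, ht.2]
    have h4 : m.T * (√m.T)⁻¹ = √m.T := by
      rw [← div_eq_mul_inv, Real.div_sqrt]
    rw [h2, ← mul_assoc, h4]
    exact mul_le_mul h3 h1 (Real.sqrt_nonneg _) (Real.sqrt_nonneg _)
  have c2 : m.wt s x ^ m.β ≤ W :=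
    Real.rpow_le_rpow (m.wt_pos _ _).le (le_add_of_nonneg_right (m.wt_pos _ _).le) m.β_pos.le
  have c3 : |m.T - t| ≤ m.T := by
    rw [abs_of_nonneg (by linarith [ht.2])]; linarith [ht.1]
  have c4 : κ * m.T ≤ 1 + 6 * Real.exp (2 * (m.L * m.T)) := by
    have h1 := mul_exp_le (m.L * m.T)
    have h2 : m.T⁻¹ * m.T = 1 := inv_mul_cancel₀ m.T_pos.ne'
    calc κ * m.T = m.T⁻¹ * m.T + 6 * (m.L * m.T * Real.exp (3 / 2 * (m.L * m.T))) := by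
          rw [hκ]; ring_nf
      _ ≤ _ := by rw [h2]; linarith
  have c5 : 1 ≤ Real.exp (2 * (m.L * m.T)) :=
    Real.one_le_exp (mul_nonneg (by norm_num) (mul_nonneg m.L_nonneg m.T_pos.le))
  rw [e]
  refine (abs_add_three _ _ _).trans ?_
  set R := (√m.T)⁻¹ * m.dst s t x y with hR
  have hR0 : 0 ≤ R := mul_nonneg hsi hD
  have hRW : 0 ≤ R * W := mul_nonneg hR0 hW0
  have d1 : |m.termMean s x - m.termMean t y| ≤ 2 * (R * W) := by
    refine b1.trans_eq ?_
    rw [hR]; ring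
  have d2 : |∫ σ in s..t, m.mean m.sol s x σ| ≤ κ * m.T * (R * W) := by
    calc _ ≤ _ := b2
      _ ≤ κ * W * (m.T * R) := by gcongr
      _ = _ := by ring
  have d3 : |∫ σ in t..m.T, (m.mean m.sol s x σ - m.mean m.sol t y σ)|
      ≤ 2 * (κ * m.T * (R * W)) := by
    calc _ ≤ _ := b3
      _ ≤ κ * (√m.T)⁻¹ * (W * (2 * m.dst s t x y)) * m.T := by gcongr
      _ = _ := by rw [hR]; ring
  -- With κT ≤ 1 + 6e^{2LT} the total 2 + 3κT is at most 5 + 18e^{2LT}, below 25e^{2LT}.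
  calc _ ≤ 2 * (R * W) + κ * m.T * (R * W) + 2 * (κ * m.T * (R * W)) := by linarith
    _ = (2 + 3 * (κ * m.T)) * (R * W) := by ring
    _ ≤ _ := by
      refine mul_le_mul_of_nonneg_right ?_ hRW
      linarith

theorem sol_holder {s t : ℝ} (hs : s ∈ Icc 0 m.T) (ht : t ∈ Icc 0 m.T) (x y) :
    |m.sol s x - m.sol t y| ≤ 25 * Real.exp (2 * (m.L * m.T)) *
      ((√m.T)⁻¹ * m.dst s t x y * (m.wt s x + m.wt t y) ^ m.β) := by
  rcases le_total s t with h | h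
  · exact sol_holder_of_le hs ht h x y
  · rw [abs_sub_comm, m.dst_comm, add_comm (m.wt s x)]
    exact sol_holder_of_le ht hs h y x

end Model

/-! ### The canonical noise space -/

/-- Positions in the tree of random inputs below a fixed index. -/
abbrev Node : Type := (ℤ × ℤ) × List (ℤ × ℤ)

/-- Random inputs of a multilevel Picard approximation, indexed relative to its own index. -/
abbrev Noise (d : ℕ) : Type := Node → ℝ × (Fin d → ℝ)

/-- The law of the random inputs. -/
noncomputable def noiseLaw (d : ℕ) : Measure (Noise d) :=
  Measure.infinitePi fun _ : Node => driveLaw d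

instance isProbabilityMeasure_noiseLaw (d : ℕ) : IsProbabilityMeasure (noiseLaw d) := by
  unfold noiseLaw; infer_instance

namespace Noise

variable {d : ℕ}

/-- The input attached to the child `(a, b)`. -/
def head (a b : ℤ) (σ : Noise d) : ℝ × (Fin d → ℝ) := σ ((a, b), [])

/-- The inputs strictly below the child `(a, b)`. -/
def sub (a b : ℤ) (σ : Noise d) : Noise d := fun p => σ ((a, b), p.1 :: p.2)

/-- The inputs whose first step has second component `b`, all others being set to zero. -/
def mask (b : ℤ) (σ : Noise d) : Noise d := fun p => if p.1.2 = b then σ p else 0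

@[fun_prop]
theorem measurable_head (a b : ℤ) : Measurable (head (d := d) a b) := measurable_pi_apply _

@[fun_prop]
theorem measurable_sub (a b : ℤ) : Measurable (sub (d := d) a b) :=
  measurable_pi_lambda _ fun _ => measurable_pi_apply _

theorem head_mask (a b : ℤ) (σ : Noise d) : head a b (mask b σ) = head a b σ := by
  simp [head, mask]

theorem sub_mask (a b : ℤ) (σ : Noise d) : sub a b (mask b σ) = sub a b σ := by
  funext p; simp [sub, mask]

theorem iIndepFun_eval : iIndepFun (fun (p : Node) (σ : Noise d) => σ p) (noiseLaw d) :=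
  iIndepFun_infinitePi (X := fun _ w => w) fun _ => measurable_id

/-- The second component of the first step is, up to sign, the Monte Carlo index. The children (l,
i) and (-l, i) used in one summand share it, so masking by it isolates the inputs of one summand,
and different masks see disjoint sets of inputs. -/
theorem indepFun_mask {b b' : ℤ} (h : b ≠ b') :
    IndepFun (mask (d := d) b) (mask b') (noiseLaw d) := by
  have hdisj : Disjoint {p : Node | p.1.2 = b} {p : Node | p.1.2 = b'} := by
    rw [Set.disjoint_left]
    rintro p rfl h2
    exact h h2
  have key := indepFun_restrict_of_disjoint (fun p => measurable_pi_apply p)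
    (iIndepFun_eval (d := d)) hdisj
  have hext : ∀ b : ℤ, Measurable fun (τ : {p : Node | p.1.2 = b} → ℝ × (Fin d → ℝ)) (p : Node) =>
      if h : p.1.2 = b then τ ⟨p, h⟩ else 0 := by
    intro b
    refine measurable_pi_lambda _ fun p => ?_
    by_cases h : p.1.2 = b
    · simpa [h] using measurable_pi_apply _
    · simp [h]
  have := key.comp (hext b) (hext b')
  convert this using 1 <;> (funext σ p; simp [mask])

theorem indepFun_of_mask {b b' : ℤ} (h : b ≠ b') {Y Y' : Noise d → ℝ} (hY : Measurable Y)
    (hY' : Measurable Y') (e : ∀ σ, Y (mask b σ) = Y σ) (e' : ∀ σ, Y' (mask b' σ) = Y' σ) :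
    IndepFun Y Y' (noiseLaw d) := by
  have := (indepFun_mask (d := d) h).comp hY hY'
  rwa [show Y ∘ mask b = Y from funext e, show Y' ∘ mask b' = Y' from funext e'] at this

theorem measurePreserving_head (a b : ℤ) :
    MeasurePreserving (head (d := d) a b) (noiseLaw d) (driveLaw d) :=
  measurePreserving_eval_infinitePi _ _

theorem measurePreserving_sub (a b : ℤ) :
    MeasurePreserving (sub (d := d) a b) (noiseLaw d) (noiseLaw d) :=
  ⟨measurable_sub a b, Measure.map_infinitePi_infinitePi_of_inj
    (P := fun _ : Node => driveLaw d) (f := fun p : Node => ((a, b), p.1 :: p.2))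
    fun p q hpq => by simpa [Prod.ext_iff] using hpq⟩

/-- Heads sit at positions with empty tail and subtrees at positions with nonempty tail. They are
therefore independent for all choices of children, including equal ones: an approximation never uses
the input that selects its evaluation point. -/
theorem measurePreserving_head_sub (a b a' b' : ℤ) :
    MeasurePreserving (fun σ : Noise d => (head a b σ, sub a' b' σ)) (noiseLaw d)
      ((driveLaw d).prod (noiseLaw d)) := by
  refine ⟨(measurable_head a b).prodMk (measurable_sub a' b'), ?_⟩
  have hdisj : Disjoint {p : Node | p.2 = []} {p : Node | p.2 ≠ []} := by
    rw [Set.disjoint_left]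
    exact fun p h h2 => h2 h
  have key := indepFun_restrict_of_disjoint (fun p => measurable_pi_apply p)
    (iIndepFun_eval (d := d)) hdisj
  have h1 : Measurable fun (τ : {p : Node | p.2 = []} → ℝ × (Fin d → ℝ)) =>
    τ ⟨((a, b), []), rfl⟩ := measurable_pi_apply _
  have h2 : Measurable fun (τ : {p : Node | p.2 ≠ []} → ℝ × (Fin d → ℝ)) (p : Node) =>
    τ ⟨((a', b'), p.1 :: p.2), by simp⟩ :=
    measurable_pi_lambda _ fun _ => measurable_pi_apply _
  have hind : IndepFun (head (d := d) a b) (sub a' b') (noiseLaw d) := key.comp h1 h2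
  rw [hind.map_prod_eq_prod_map_map (by fun_prop) (by fun_prop),
    (measurePreserving_head a b).map_eq, (measurePreserving_sub a' b').map_eq]

end Noise

namespace Model

open Noise

variable {d : ℕ} {m : Model d}

/-! ### The approximations on the canonical noise space -/

variable (m) in
/-- The multilevel Picard approximations as functions of the canonical noise. -/
noncomputable def phi (M : ℕ) : ℕ → ℝ → (Fin d → ℝ) → Noise d → ℝ
  | n, t, x, σ =>
    ((if n = 0 then 0 else 1) / (M : ℝ) ^ n) *
        ∑ i ∈ Finset.Icc 1 (M ^ n), m.g (m.ep t x (head 0 (-(i : ℤ)) σ))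
      + ∑ l : Fin n, ((M : ℝ) ^ (n - l.1))⁻¹ * ∑ i ∈ Finset.Icc 1 (M ^ (n - l.1)),
          (m.drift (fun s y => phi M l.1 s y (sub l.1 i σ)) t x (head l.1 i σ)
            - (if l.1 = 0 then 0 else 1) *
              m.drift (fun s y => phi M (l.1 - 1) s y (sub (-(l.1 : ℤ)) i σ)) t x (head l.1 i σ))
termination_by n => n
decreasing_by all_goals omega

theorem phi_zero (M t x) (σ : Noise d) : m.phi M 0 t x σ = 0 := by
  rw [phi]; simp

/-- Level 0 is split off because the zeroth approximation vanishes. The other levels are shifted by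
one, so that level l + 1 is averaged over M^{n-l} samples. -/
theorem phi_succ (M n t x) (σ : Noise d) : m.phi M (n + 1) t x σ =
    ((M : ℝ) ^ (n + 1))⁻¹ *
        ∑ i ∈ Finset.Icc 1 (M ^ (n + 1)), m.g (m.ep t x (head 0 (-(i : ℤ)) σ))
      + (((M : ℝ) ^ (n + 1))⁻¹ * ∑ i ∈ Finset.Icc 1 (M ^ (n + 1)),
          m.drift (fun _ _ => 0) t x (head 0 i σ)
        + ∑ l ∈ Finset.range n, ((M : ℝ) ^ (n - l))⁻¹ * ∑ i ∈ Finset.Icc 1 (M ^ (n - l)),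
          (m.drift (fun s y => m.phi M (l + 1) s y (sub (l + 1) i σ)) t x (head (l + 1) i σ)
            - m.drift (fun s y => m.phi M l s y (sub (-(l + 1)) i σ)) t x (head (l + 1) i σ))) := by
  rw [phi, Fin.sum_univ_succ, Finset.sum_range]
  simp [phi_zero]

theorem drift_comp_measurable {α : Type*} [MeasurableSpace α] {v : ℝ → (Fin d → ℝ) → α → ℝ}
    (hv : Measurable fun p : ℝ × (Fin d → ℝ) × α => v p.1 p.2.1 p.2.2)
    {a : α → ℝ} {b : α → Fin d → ℝ} {w : α → ℝ × (Fin d → ℝ)} (ha : Measurable a)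
    (hb : Measurable b) (hw : Measurable w) :
    Measurable fun p => m.drift (fun s y => v s y p) (a p) (b p) (w p) := by
  unfold drift
  refine (measurable_const.sub ha).mul (m.measurable_f (by fun_prop) (by fun_prop) ?_)
  exact hv.comp ((m.measurable_tm ha hw).prodMk ((m.measurable_sp ha hb hw).prodMk measurable_id))

theorem measurable_phi (M n : ℕ) :
    Measurable fun p : ℝ × (Fin d → ℝ) × Noise d => m.phi M n p.1 p.2.1 p.2.2 := by
  induction n using Nat.strong_induction_on with
  | _ n ih =>
  have hterm : ∀ k < n, ∀ a b a' b' : ℤ, Measurable fun p : ℝ × (Fin d → ℝ) × Noise d =>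
      m.drift (fun s y => m.phi M k s y (sub a b p.2.2)) p.1 p.2.1 (head a' b' p.2.2) := by
    intro k hk a b a' b'
    refine drift_comp_measurable (v := fun s y (p : ℝ × (Fin d → ℝ) × Noise d) =>
      m.phi M k s y (sub a b p.2.2)) ?_ (by fun_prop) (by fun_prop) (by fun_prop)
    exact (ih k hk).comp (f := fun p : ℝ × (Fin d → ℝ) × (ℝ × (Fin d → ℝ) × Noise d) =>
      (p.1, p.2.1, sub a b p.2.2.2.2)) (by fun_prop)
  cases n with
  | zero => simp only [phi_zero]; exact measurable_const
  | succ n =>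
    rw [show (fun p : ℝ × (Fin d → ℝ) × Noise d => m.phi M (n + 1) p.1 p.2.1 p.2.2) = _ from
      funext fun p => phi_succ M n p.1 p.2.1 p.2.2]
    refine .add (.const_mul (Finset.measurable_fun_sum _ fun i _ => by fun_prop) _) (.add
      (.const_mul (Finset.measurable_fun_sum _ fun i _ => ?_) _)
      (Finset.measurable_fun_sum _ fun l hl => .const_mul
        (Finset.measurable_fun_sum _ fun i _ => ?_) _))
    · exact measurable_drift measurable_const (by fun_prop) (by fun_prop) (by fun_prop)
    · have := Finset.mem_range.1 hl
      exact (hterm (l + 1) (by omega) _ _ _ _).sub (hterm l (by omega) _ _ _ _)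

end Model
namespace Model

open Noise

variable {d : ℕ} {m : Model d}

/-! ### The error recursion -/

/-- Injectivity of `j` gives the summands disjoint masks, hence pairwise independence, and averaging
M^k of them gains M^{-k/2}. -/
theorem eLpNorm_monteCarlo_le {M : ℕ} (hM : 1 ≤ M) (k : ℕ) {Y : ℕ → Noise d → ℝ}
    (hY : ∀ i, Measurable (Y i)) {j : ℕ → ℤ} (hj : Function.Injective j)
    (hmask : ∀ i σ, Y i (mask (j i) σ) = Y i σ) {e b : ℝ} (hb : 0 ≤ b)
    (he : ∀ i, ∫ σ, Y i σ ∂noiseLaw d = e)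
    (hYb : ∀ i, eLpNorm (Y i) 2 (noiseLaw d) ≤ ENNReal.ofReal b) :
    eLpNorm (fun σ => ((M : ℝ) ^ k)⁻¹ * ∑ i ∈ Finset.Icc 1 (M ^ k), Y i σ - e) 2 (noiseLaw d)
      ≤ ENNReal.ofReal (((√M) ^ k)⁻¹ * b) := by
  have hpos : 1 ≤ M ^ k := Nat.one_le_pow _ _ hM
  have h := eLpNorm_average_sub_le (μ := noiseLaw d) (s := Finset.Icc 1 (M ^ k)) (Y := Y)
    ⟨1, by simpa using hpos⟩ (fun i _ => (hY i).aestronglyMeasurable)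
    (fun i _ i' _ hii => indepFun_of_mask (hj.ne hii) (hY i) (hY i') (hmask i) (hmask i'))
    hb (fun i _ => he i) (fun i _ => hYb i)
  have hs : √((M : ℝ) ^ k) = (√M) ^ k := by
    rw [Real.sqrt_eq_iff_mul_self_eq (by positivity) (by positivity), ← mul_pow,
      Real.mul_self_sqrt (by positivity)]
  simpa [hs] using h

variable (m) in
/-- The nonlinear part of the fixed point map at `(s, x)` minus `ε` times that at `(t, y)`. -/
noncomputable def jump (ε s t : ℝ) (x y : Fin d → ℝ) (v : ℝ → (Fin d → ℝ) → ℝ)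
    (w : ℝ × (Fin d → ℝ)) : ℝ := m.drift v s x w - ε * m.drift v t y w

theorem measurable_jump_phi (M l : ℕ) (ε s t : ℝ) (x y : Fin d → ℝ) :
    Measurable fun p : (ℝ × (Fin d → ℝ)) × Noise d =>
      m.jump ε s t x y (fun s' z => m.phi M l s' z p.2) p.1 := by
  have h : ∀ t x, Measurable fun p : (ℝ × (Fin d → ℝ)) × Noise d =>
      m.drift (fun s' z => m.phi M l s' z p.2) t x p.1 := fun t x =>
    drift_comp_measurable (v := fun s' z (p : (ℝ × (Fin d → ℝ)) × Noise d) =>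
      m.phi M l s' z p.2) ((measurable_phi M l).comp
        (f := fun p : ℝ × (Fin d → ℝ) × ((ℝ × (Fin d → ℝ)) × Noise d) =>
        (p.1, p.2.1, p.2.2.2)) (by fun_prop)) (by fun_prop) (by fun_prop) (by fun_prop)
  exact (h s x).sub ((h t y).const_mul ε)

theorem measurable_jump {v : ℝ → (Fin d → ℝ) → ℝ}
    (hv : Measurable fun p : ℝ × (Fin d → ℝ) => v p.1 p.2) (ε s t : ℝ) (x y : Fin d → ℝ) :
    Measurable (m.jump ε s t x y v) :=
  (measurable_drift hv (by fun_prop) (by fun_prop) (by fun_prop)).sub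
    ((measurable_drift hv (by fun_prop) (by fun_prop) (by fun_prop)).const_mul ε)

theorem sol_sub_eq {s t : ℝ} (hs : s ∈ Icc 0 m.T) (ht : t ∈ Icc 0 m.T) (x y) (ε : ℝ) :
    m.sol s x - ε * m.sol t y = (∫ w, (m.g (m.ep s x w) - ε * m.g (m.ep t y w)) ∂driveLaw d)
      + ∫ w, m.jump ε s t x y m.sol w ∂driveLaw d := by
  have g1 := (termMean_bound hs x).1
  have g2 := (termMean_bound ht y).1
  have d1 := (drift_bound measurable_sol (by norm_num) sol_growth hs x).1
  have d2 := (drift_bound measurable_sol (by norm_num) sol_growth ht y).1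
  unfold jump
  rw [integral_sub g1 (g2.const_mul ε), integral_sub d1 (d2.const_mul ε), integral_const_mul,
    integral_const_mul, ← picard_sol hs, ← picard_sol ht, picard, picard, termMean, termMean]
  ring

theorem phi_sub_eq (M n : ℕ) (ε s t : ℝ) (x y : Fin d → ℝ) (σ : Noise d) :
    m.phi M (n + 1) s x σ - ε * m.phi M (n + 1) t y σ =
      ((M : ℝ) ^ (n + 1))⁻¹ * ∑ i ∈ Finset.Icc 1 (M ^ (n + 1)),
        (m.g (m.ep s x (head 0 (-(i : ℤ)) σ)) - ε * m.g (m.ep t y (head 0 (-(i : ℤ)) σ)))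
      + (((M : ℝ) ^ (n + 1))⁻¹ * ∑ i ∈ Finset.Icc 1 (M ^ (n + 1)),
          m.jump ε s t x y (fun _ _ => 0) (head 0 i σ)
        + ∑ l ∈ Finset.range n, ((M : ℝ) ^ (n - l))⁻¹ * ∑ i ∈ Finset.Icc 1 (M ^ (n - l)),
          (m.jump ε s t x y (fun s y => m.phi M (l + 1) s y (sub (l + 1) i σ)) (head (l + 1) i σ)
            - m.jump ε s t x y (fun s y => m.phi M l s y (sub (-(l + 1)) i σ))
              (head (l + 1) i σ))) := by
  have h1 : ∀ (S : Finset ℕ) (p q : ℕ → ℝ),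
      ∑ i ∈ S, (p i - ε * q i) = ∑ i ∈ S, p i - ε * ∑ i ∈ S, q i := fun S p q => by
    rw [Finset.sum_sub_distrib, Finset.mul_sum]
  have h2 : ∀ (c : ℕ → ℝ) (S : ℕ → Finset ℕ) (p q p' q' : ℕ → ℕ → ℝ),
      ∑ l ∈ Finset.range n, c l * ∑ i ∈ S l, ((p l i - ε * q l i) - (p' l i - ε * q' l i))
        = ∑ l ∈ Finset.range n, c l * ∑ i ∈ S l, (p l i - p' l i)
          - ε * ∑ l ∈ Finset.range n, c l * ∑ i ∈ S l, (q l i - q' l i) := by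
    intro c S p q p' q'
    rw [Finset.mul_sum, ← Finset.sum_sub_distrib]
    refine Finset.sum_congr rfl fun l _ => ?_
    rw [Finset.sum_congr rfl fun i _ => show (p l i - ε * q l i) - (p' l i - ε * q' l i)
      = (p l i - p' l i) - ε * (q l i - q' l i) by ring, h1]
    ring
  unfold jump
  rw [phi_succ M n s, phi_succ M n t, h1, h1, h2]
  ring

theorem integral_comp_eq {α β : Type*} [MeasurableSpace α] [MeasurableSpace β] {μ : Measure α}
    {ν : Measure β} {p : α → β} (hp : MeasurePreserving p μ ν) {F : β → ℝ} (hF : Measurable F) :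
    ∫ x, F (p x) ∂μ = ∫ y, F y ∂ν := by
  rw [← hp.map_eq, integral_map hp.measurable.aemeasurable hF.aestronglyMeasurable]

theorem eLpNorm_comp_le {α β : Type*} [MeasurableSpace α] [MeasurableSpace β] {μ : Measure α}
    {ν : Measure β} {p : α → β} (hp : MeasurePreserving p μ ν) {F : β → ℝ} (hF : Measurable F)
    {b : ℝ≥0∞} (h : eLpNorm F 2 ν ≤ b) : eLpNorm (fun x => F (p x)) 2 μ ≤ b :=
  (eLpNorm_comp_measurePreserving hF.aestronglyMeasurable hp).trans_le h

/-- The `L²` error of a multilevel sum with levels `A l`, whose telescoping mean approximates the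
mean of `Au`. -/
theorem eLpNorm_multilevel_le {M n : ℕ} (hM : 1 ≤ M) {G J Au : ℝ × (Fin d → ℝ) → ℝ}
    {A : ℕ → (ℝ × (Fin d → ℝ)) × Noise d → ℝ} (mG : Measurable G) (mJ : Measurable J)
    (mAu : Measurable Au) (mA : ∀ l, Measurable (A l)) (hA0 : ∀ p, A 0 p = J p.1)
    {bg b0 : ℝ} {b : ℕ → ℝ} (hbg : 0 ≤ bg) (hb0 : 0 ≤ b0) (hb : ∀ l, 0 ≤ b l)
    (hG : eLpNorm G 2 (driveLaw d) ≤ ENNReal.ofReal bg)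
    (hJ : eLpNorm J 2 (driveLaw d) ≤ ENNReal.ofReal b0)
    (hA : ∀ l ≤ n, eLpNorm (fun p => A l p - Au p.1) 2 ((driveLaw d).prod (noiseLaw d))
      ≤ ENNReal.ofReal (b l)) :
    eLpNorm (fun σ => ((M : ℝ) ^ (n + 1))⁻¹ * ∑ i ∈ Finset.Icc 1 (M ^ (n + 1)),
          G (head 0 (-(i : ℤ)) σ)
        + (((M : ℝ) ^ (n + 1))⁻¹ * ∑ i ∈ Finset.Icc 1 (M ^ (n + 1)), J (head 0 i σ)
          + ∑ l ∈ Finset.range n, ((M : ℝ) ^ (n - l))⁻¹ * ∑ i ∈ Finset.Icc 1 (M ^ (n - l)),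
            (A (l + 1) (head (l + 1) i σ, sub (l + 1) i σ)
              - A l (head (l + 1) i σ, sub (-(l + 1)) i σ)))
        - (∫ w, G w ∂driveLaw d + ∫ w, Au w ∂driveLaw d)) 2 (noiseLaw d)
      ≤ ENNReal.ofReal (((√M) ^ (n + 1))⁻¹ * bg + (((√M) ^ (n + 1))⁻¹ * b0
        + ∑ l ∈ Finset.range n, ((√M) ^ (n - l))⁻¹ * (b (l + 1) + b l)) + b n) := by
  set ν := (driveLaw d).prod (noiseLaw d) with hν
  have mA' : ∀ l, Measurable fun p => A l p - Au p.1 := fun l =>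
    (mA l).sub (mAu.comp measurable_fst)
  have hdiff : ∀ l ≤ n, MemLp (fun p => A l p - Au p.1) 2 ν := fun l hl =>
    ⟨(mA' l).aestronglyMeasurable, (hA l hl).trans_lt ENNReal.ofReal_lt_top⟩
  have hA0L : MemLp (A 0) 2 ν := by
    rw [show A 0 = J ∘ Prod.fst from funext hA0]
    exact MemLp.comp_measurePreserving
      ⟨mJ.aestronglyMeasurable, hJ.trans_lt ENNReal.ofReal_lt_top⟩ measurePreserving_fst
  -- Square integrability of the limit integrand follows from that of level 0 and of the level 0
  -- error.
  have hAuL : MemLp (fun p : (ℝ × (Fin d → ℝ)) × Noise d => Au p.1) 2 ν := by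
    have := hA0L.sub (hdiff 0 (Nat.zero_le n))
    rwa [show A 0 - (fun p => A 0 p - Au p.1) = fun p => Au p.1 by funext p; simp] at this
  have hAL : ∀ l ≤ n, MemLp (A l) 2 ν := fun l hl => by
    have := hAuL.add (hdiff l hl)
    rwa [show (fun p : (ℝ × (Fin d → ℝ)) × Noise d => Au p.1) + (fun p => A l p - Au p.1) = A l by
      funext p; simp] at this
  set a : ℕ → ℝ := fun l => ∫ p, A l p ∂ν with ha
  have hau : ∫ p, Au p.1 ∂ν = ∫ w, Au w ∂driveLaw d := by
    rw [hν, integral_fun_fst Au]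
    simp
  have mhs : ∀ i j i' j', Measurable fun σ : Noise d => (head i j σ, sub i' j' σ) :=
    fun i j i' j' => (measurable_head i j).prodMk (measurable_sub i' j')
  have hexp : ∀ l i j i' j', ∫ σ, A l (head i j σ, sub i' j' σ) ∂noiseLaw d = a l :=
    fun l i j i' j' => integral_comp_eq (measurePreserving_head_sub i j i' j') (mA l)
  have hint : ∀ l ≤ n, ∀ i j i' j',
      Integrable (fun σ => A l (head i j σ, sub i' j' σ)) (noiseLaw d) := fun l hl i j i' j' =>
    (measurePreserving_head_sub i j i' j').integrable_comp_of_integrable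
      ((hAL l hl).integrable (by norm_num))
  have T1 := eLpNorm_monteCarlo_le hM (n + 1) (Y := fun i σ => G (head 0 (-(i : ℤ)) σ))
    (fun i => mG.comp (measurable_head 0 (-(i : ℤ)))) (j := fun i => -(i : ℤ))
    (fun i i' h => by simpa using h) (fun i σ => by simp only [head_mask])
    (e := ∫ w, G w ∂driveLaw d) hbg
    (fun i => integral_comp_eq (measurePreserving_head 0 (-(i : ℤ))) mG)
    (fun i => eLpNorm_comp_le (measurePreserving_head 0 (-(i : ℤ))) mG hG)
  have T2 := eLpNorm_monteCarlo_le hM (n + 1) (Y := fun i σ => J (head 0 (i : ℤ) σ))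
    (fun i => mJ.comp (measurable_head 0 (i : ℤ))) (j := fun i => (i : ℤ))
    (fun i i' h => by simpa using h) (fun i σ => by simp only [head_mask]) (e := a 0) hb0
    (fun i => by
      rw [← hexp 0 0 i 0 i]
      simp only [hA0])
    (fun i => eLpNorm_comp_le (measurePreserving_head 0 (i : ℤ)) mJ hJ)
  have T3 : ∀ l ∈ Finset.range n, eLpNorm (fun σ => ((M : ℝ) ^ (n - l))⁻¹ *
      ∑ i ∈ Finset.Icc 1 (M ^ (n - l)), (A (l + 1) (head (l + 1) i σ, sub (l + 1) i σ)
        - A l (head (l + 1) i σ, sub (-(l + 1)) i σ)) - (a (l + 1) - a l)) 2 (noiseLaw d)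
      ≤ ENNReal.ofReal (((√M) ^ (n - l))⁻¹ * (b (l + 1) + b l)) := by
    intro l hl
    have hln := Finset.mem_range.1 hl
    refine eLpNorm_monteCarlo_le hM (n - l) (Y := fun i σ =>
      A (l + 1) (head (l + 1) i σ, sub (l + 1) i σ) - A l (head (l + 1) i σ, sub (-(l + 1)) i σ))
      (fun i => ((mA (l + 1)).comp (mhs _ _ _ _)).sub ((mA l).comp (mhs _ _ _ _)))
      (j := fun i => (i : ℤ)) (fun i i' h => by simpa using h)
      (fun i σ => by simp only [head_mask, sub_mask])
      (add_nonneg (hb (l + 1)) (hb l)) (fun i => ?_) (fun i => ?_)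
    · rw [integral_sub (hint _ (by omega) _ _ _ _) (hint _ (by omega) _ _ _ _), hexp, hexp]
    -- Both levels are compared with `Au` at the same evaluation point, so it cancels and the two
    -- level errors remain.
    · have e1 : (fun σ : Noise d => A (l + 1) (head (l + 1) i σ, sub (l + 1) i σ)
          - A l (head (l + 1) i σ, sub (-(l + 1)) i σ)) =
          (fun σ => A (l + 1) (head (l + 1) i σ, sub (l + 1) i σ) - Au (head (l + 1) i σ))
          - fun σ => A l (head (l + 1) i σ, sub (-(l + 1)) i σ) - Au (head (l + 1) i σ) := by
        funext σ
        simp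
      rw [e1, ENNReal.ofReal_add (hb _) (hb _)]
      exact (eLpNorm_sub_le
        (((mA' (l + 1)).comp (mhs (l + 1) i (l + 1) i)).aestronglyMeasurable)
        (((mA' l).comp (mhs (l + 1) i (-(l + 1)) i)).aestronglyMeasurable) (by norm_num)).trans
        (add_le_add
          (eLpNorm_comp_le (measurePreserving_head_sub _ _ _ _) (mA' (l + 1)) (hA _ (by omega)))
          (eLpNorm_comp_le (measurePreserving_head_sub _ _ _ _) (mA' l) (hA _ (by omega))))
  -- The bias: the mean of level n against the mean of the limit, bounded by the L² error of level
  -- n.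
  have T4 : |a n - ∫ w, Au w ∂driveLaw d| ≤ b n := by
    have := abs_integral_le_of_eLpNorm_two (hdiff n le_rfl).1 (hb n) (hA n le_rfl)
    rwa [integral_sub ((hAL n le_rfl).integrable (by norm_num)) (hAuL.integrable (by norm_num)),
      hau] at this
  -- The means of the level differences telescope, which leaves level n as the only bias.
  have etel : a 0 + ∑ l ∈ Finset.range n, (a (l + 1) - a l) = a n := by
    rw [Finset.sum_range_sub]; ring
  set F1 : Noise d → ℝ := fun σ => ((M : ℝ) ^ (n + 1))⁻¹ * ∑ i ∈ Finset.Icc 1 (M ^ (n + 1)),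
    G (head 0 (-(i : ℤ)) σ) - ∫ w, G w ∂driveLaw d with hF1
  set F2 : Noise d → ℝ := fun σ => ((M : ℝ) ^ (n + 1))⁻¹ * ∑ i ∈ Finset.Icc 1 (M ^ (n + 1)),
    J (head 0 i σ) - a 0 with hF2
  set F3 : ℕ → Noise d → ℝ := fun l σ =>
    ((M : ℝ) ^ (n - l))⁻¹ * ∑ i ∈ Finset.Icc 1 (M ^ (n - l)),
      (A (l + 1) (head (l + 1) i σ, sub (l + 1) i σ)
        - A l (head (l + 1) i σ, sub (-(l + 1)) i σ)) - (a (l + 1) - a l) with hF3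
  have mF1 : Measurable F1 := ((Finset.measurable_fun_sum _ fun (i : ℕ) _ =>
    mG.comp (measurable_head 0 (-(i : ℤ)))).const_mul _).sub_const _
  have mF2 : Measurable F2 := ((Finset.measurable_fun_sum _ fun (i : ℕ) _ =>
    mJ.comp (measurable_head 0 (i : ℤ))).const_mul _).sub_const _
  have mF3 : ∀ l, Measurable (F3 l) := fun l => ((Finset.measurable_fun_sum _ fun i _ =>
    ((mA (l + 1)).comp (mhs _ _ _ _)).sub ((mA l).comp (mhs _ _ _ _))).const_mul _).sub_const _
  have mF3s : Measurable (∑ l ∈ Finset.range n, F3 l) := by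
    rw [show ∑ l ∈ Finset.range n, F3 l = fun σ => ∑ l ∈ Finset.range n, F3 l σ by
      funext σ; simp]
    exact Finset.measurable_fun_sum _ fun l _ => mF3 l
  have hsum0 : 0 ≤ ∑ l ∈ Finset.range n, ((√M) ^ (n - l))⁻¹ * (b (l + 1) + b l) :=
    Finset.sum_nonneg fun l _ => mul_nonneg (by positivity) (add_nonneg (hb _) (hb _))
  have h12 : eLpNorm (F1 + (F2 + ∑ l ∈ Finset.range n, F3 l)) 2 (noiseLaw d) ≤
      ENNReal.ofReal (((√M) ^ (n + 1))⁻¹ * bg) + (ENNReal.ofReal (((√M) ^ (n + 1))⁻¹ * b0)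
        + ENNReal.ofReal (∑ l ∈ Finset.range n, ((√M) ^ (n - l))⁻¹ * (b (l + 1) + b l))) := by
    refine (eLpNorm_add_le mF1.aestronglyMeasurable (mF2.add mF3s).aestronglyMeasurable
      (by norm_num)).trans (add_le_add T1 ?_)
    refine (eLpNorm_add_le mF2.aestronglyMeasurable mF3s.aestronglyMeasurable
      (by norm_num)).trans (add_le_add T2 ?_)
    refine (eLpNorm_sum_le (fun l _ => (mF3 l).aestronglyMeasurable) (by norm_num)).trans ?_
    rw [ENNReal.ofReal_sum_of_nonneg
      fun l _ => mul_nonneg (by positivity) (add_nonneg (hb _) (hb _))]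
    exact Finset.sum_le_sum T3
  have h4 : eLpNorm (fun _ : Noise d => a n - ∫ w, Au w ∂driveLaw d) 2 (noiseLaw d)
      ≤ ENNReal.ofReal (b n) := by
    rw [eLpNorm_const _ (by norm_num) (IsProbabilityMeasure.ne_zero _), measure_univ,
      ENNReal.one_rpow, mul_one, Real.enorm_eq_ofReal_abs]
    exact ENNReal.ofReal_le_ofReal T4
  rw [ENNReal.ofReal_add (by positivity) (hb n), ENNReal.ofReal_add (by positivity)
    (by positivity), ENNReal.ofReal_add (by positivity) hsum0]
  refine le_of_eq_of_le ?_ ((eLpNorm_add_le (mF1.add (mF2.add mF3s)).aestronglyMeasurable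
    aestronglyMeasurable_const (by norm_num)).trans (add_le_add h12 h4))
  congr 1
  funext σ
  simp only [Pi.add_apply, Finset.sum_apply, hF1, hF2, hF3]
  rw [Finset.sum_sub_distrib, ← etel]
  ring

/-- The parameter ε treats both error notions at once: ε = 0 is the pointwise error and ε = 1 the
error of increments. Linearity of the scheme in the terminal value and in the nonlinear integrand
makes the same multilevel estimate apply. -/
theorem phi_error_le {M n : ℕ} (hM : 1 ≤ M) {s t : ℝ} (hs : s ∈ Icc 0 m.T) (ht : t ∈ Icc 0 m.T)
    (x y) (ε : ℝ) {bg b0 : ℝ} {b : ℕ → ℝ} (hbg : 0 ≤ bg) (hb0 : 0 ≤ b0) (hb : ∀ l, 0 ≤ b l)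
    (hG : eLpNorm (fun w => m.g (m.ep s x w) - ε * m.g (m.ep t y w)) 2 (driveLaw d)
      ≤ ENNReal.ofReal bg)
    (h0 : eLpNorm (m.jump ε s t x y fun _ _ => 0) 2 (driveLaw d) ≤ ENNReal.ofReal b0)
    (hA : ∀ l ≤ n, eLpNorm (fun p : (ℝ × (Fin d → ℝ)) × Noise d =>
      m.jump ε s t x y (fun s' z => m.phi M l s' z p.2) p.1 - m.jump ε s t x y m.sol p.1) 2
        ((driveLaw d).prod (noiseLaw d)) ≤ ENNReal.ofReal (b l)) :
    eLpNorm (fun σ => (m.phi M (n + 1) s x σ - m.sol s x)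
        - ε * (m.phi M (n + 1) t y σ - m.sol t y)) 2 (noiseLaw d)
      ≤ ENNReal.ofReal (((√M) ^ (n + 1))⁻¹ * bg + (((√M) ^ (n + 1))⁻¹ * b0
        + ∑ l ∈ Finset.range n, ((√M) ^ (n - l))⁻¹ * (b (l + 1) + b l)) + b n) := by
  have key := eLpNorm_multilevel_le hM
    (A := fun l p => m.jump ε s t x y (fun s' z => m.phi M l s' z p.2) p.1)
    (by fun_prop) (measurable_jump (m := m) (v := fun _ _ => 0) measurable_const ε s t x y)
    (measurable_jump measurable_sol ε s t x y) (fun l => measurable_jump_phi M l ε s t x y)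
    (fun p => by simp only [phi_zero]) hbg hb0 hb hG h0 hA
  refine le_of_eq_of_le ?_ key
  congr 1
  funext σ
  rw [← sol_sub_eq hs ht, ← phi_sub_eq]
  ring

end Model

/-! ### Error estimates -/

theorem eLpNorm_const_mul_abs_le {α : Type*} [MeasurableSpace α] {μ : Measure α} {f : α → ℝ}
    {c b : ℝ} (hc : 0 ≤ c) (h : eLpNorm f 2 μ ≤ ENNReal.ofReal b) :
    eLpNorm (fun x => c * |f x|) 2 μ ≤ ENNReal.ofReal (c * b) := by
  have e : (fun x => c * |f x|) = c • fun x => ‖f x‖ := by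
    funext x; simp
  rw [e, eLpNorm_const_smul, eLpNorm_norm, ENNReal.ofReal_mul hc, Real.enorm_eq_ofReal hc]
  gcongr

theorem eLpNorm_le_of_abs_le_add {α : Type*} [MeasurableSpace α] {μ : Measure α}
    {F f₁ f₂ f₃ : α → ℝ} (h₁ : Measurable f₁) (h₂ : Measurable f₂) (h₃ : Measurable f₃)
    {c₁ c₂ c₃ b₁ b₂ b₃ : ℝ} (hc₁ : 0 ≤ c₁) (hc₂ : 0 ≤ c₂) (hc₃ : 0 ≤ c₃)
    (hb₁ : 0 ≤ b₁) (hb₂ : 0 ≤ b₂) (hb₃ : 0 ≤ b₃)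
    (hF : ∀ x, |F x| ≤ c₁ * |f₁ x| + c₂ * |f₂ x| + c₃ * |f₃ x|)
    (n₁ : eLpNorm f₁ 2 μ ≤ ENNReal.ofReal b₁) (n₂ : eLpNorm f₂ 2 μ ≤ ENNReal.ofReal b₂)
    (n₃ : eLpNorm f₃ 2 μ ≤ ENNReal.ofReal b₃) :
    eLpNorm F 2 μ ≤ ENNReal.ofReal (c₁ * b₁ + c₂ * b₂ + c₃ * b₃) := by
  have m₁ : Measurable fun x => c₁ * |f₁ x| := h₁.abs.const_mul c₁
  have m₂ : Measurable fun x => c₂ * |f₂ x| := h₂.abs.const_mul c₂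
  have m₃ : Measurable fun x => c₃ * |f₃ x| := h₃.abs.const_mul c₃
  rw [ENNReal.ofReal_add (by positivity) (by positivity),
    ENNReal.ofReal_add (by positivity) (by positivity)]
  calc eLpNorm F 2 μ
      ≤ eLpNorm (((fun x => c₁ * |f₁ x|) + fun x => c₂ * |f₂ x|) + fun x => c₃ * |f₃ x|) 2 μ :=
        eLpNorm_mono_real hF
    _ ≤ eLpNorm (fun x => c₁ * |f₁ x|) 2 μ + eLpNorm (fun x => c₂ * |f₂ x|) 2 μ
        + eLpNorm (fun x => c₃ * |f₃ x|) 2 μ := by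
        refine (eLpNorm_add_le (m₁.add m₂).aestronglyMeasurable m₃.aestronglyMeasurable
          (by norm_num)).trans ?_
        gcongr
        exact eLpNorm_add_le m₁.aestronglyMeasurable m₂.aestronglyMeasurable (by norm_num)
    _ ≤ _ := add_le_add (add_le_add (eLpNorm_const_mul_abs_le hc₁ n₁)
        (eLpNorm_const_mul_abs_le hc₂ n₂)) (eLpNorm_const_mul_abs_le hc₃ n₃)

theorem ae_driveLaw_mem (d : ℕ) : ∀ᵐ w ∂driveLaw d, w.1 ∈ Icc (0 : ℝ) 1 := by
  have h : ∀ᵐ r ∂(volume.restrict (Icc (0 : ℝ) 1)), r ∈ Icc (0 : ℝ) 1 :=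
    ae_restrict_mem measurableSet_Icc
  exact (measurePreserving_fst (μ := volume.restrict (Icc (0 : ℝ) 1))
    (ν := stdNormal d)).quasiMeasurePreserving.ae h

theorem eLpNorm_driveLaw_le {d : ℕ} {H Q : ℝ × (Fin d → ℝ) → ℝ} (hQ : Measurable Q) {q : ℝ}
    (hq : 0 ≤ q) (hHQ : ∀ r ∈ Icc (0 : ℝ) 1, ∀ z, |H (r, z)| ≤ Q (r, z))
    (hQq : ∀ r ∈ Icc (0 : ℝ) 1,
      ∫⁻ z, ENNReal.ofReal (Q (r, z) ^ 2) ∂stdNormal d ≤ ENNReal.ofReal (q ^ 2)) :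
    eLpNorm H 2 (driveLaw d) ≤ ENNReal.ofReal q := by
  have h1 : eLpNorm H 2 (driveLaw d) ≤ eLpNorm Q 2 (driveLaw d) :=
    eLpNorm_mono_ae_real ((ae_driveLaw_mem d).mono fun w hw => hHQ w.1 hw w.2)
  refine h1.trans ((eLpNorm_two_le_iff hq).2 ?_)
  rw [driveLaw, lintegral_prod _ (by fun_prop)]
  calc _ ≤ ∫⁻ _ in Icc (0 : ℝ) 1, ENNReal.ofReal (q ^ 2) :=
        setLIntegral_mono measurable_const hQq
    _ = _ := by rw [lintegral_const, measure_univ, mul_one]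

/-- The squared bound contains K²τ e^{Mτ(1-r)} = (K²/M) · Mτ e^{Mτ(1-r)}, whose time integral is at
most (K²/M) e^{Mτ}. The weight reproduces itself and a factor M^{-1/2} is gained. -/
theorem eLpNorm_prod_exp_le {d : ℕ} {A : (ℝ × (Fin d → ℝ)) × Noise d → ℝ} (hA : Measurable A)
    {Q : ℝ × (Fin d → ℝ) → ℝ} (hQ : Measurable Q) (hQ0 : ∀ w, 0 ≤ Q w) {K q M τ : ℝ}
    (hK : 0 ≤ K) (hq : 0 ≤ q) (hM : 0 < M) (hτ : 0 ≤ τ)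
    (hAQ : ∀ r ∈ Icc (0 : ℝ) 1, ∀ z, eLpNorm (fun σ => A ((r, z), σ)) 2 (noiseLaw d)
      ≤ ENNReal.ofReal (K * √τ * Real.exp (M * τ / 2 * (1 - r)) * Q (r, z)))
    (hQq : ∀ r ∈ Icc (0 : ℝ) 1,
      ∫⁻ z, ENNReal.ofReal (Q (r, z) ^ 2) ∂stdNormal d ≤ ENNReal.ofReal (q ^ 2)) :
    eLpNorm A 2 ((driveLaw d).prod (noiseLaw d))
      ≤ ENNReal.ofReal (K * Real.exp (M * τ / 2) * q / √M) := by
  refine eLpNorm_two_prod_le hA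
    (B := fun w => K * √τ * Real.exp (M * τ / 2 * (1 - w.1)) * Q w)
    ((ae_driveLaw_mem d).mono fun w hw => ⟨mul_nonneg (by positivity) (hQ0 w),
      hAQ w.1 hw w.2⟩) (by positivity) ?_
  rw [driveLaw, lintegral_prod _ (by fun_prop)]
  have hθ : 0 ≤ M * τ := mul_nonneg hM.le hτ
  have hexp : ∀ r : ℝ, (K * √τ * Real.exp (M * τ / 2 * (1 - r))) ^ 2
      = K ^ 2 / M * (M * τ * Real.exp (M * τ * (1 - r))) := by
    intro r
    rw [mul_pow, mul_pow, Real.sq_sqrt hτ, ← Real.exp_nat_mul]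
    field_simp
    push_cast
    ring_nf
  calc ∫⁻ r in Icc (0 : ℝ) 1, ∫⁻ z,
        ENNReal.ofReal ((K * √τ * Real.exp (M * τ / 2 * (1 - r)) * Q (r, z)) ^ 2) ∂stdNormal d
      ≤ ∫⁻ r in Icc (0 : ℝ) 1, (ENNReal.ofReal (K ^ 2 / M)
        * ENNReal.ofReal (M * τ * Real.exp (M * τ * (1 - r)))) * ENNReal.ofReal (q ^ 2) := by
        refine setLIntegral_mono (by fun_prop) fun r hr => ?_
        refine le_trans (le_of_eq ?_) (mul_le_mul_right (hQq r hr) _)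
        rw [← lintegral_const_mul _ (by fun_prop)]
        refine lintegral_congr fun z => ?_
        rw [mul_pow _ (Q (r, z)), ENNReal.ofReal_mul (sq_nonneg _), hexp,
          ENNReal.ofReal_mul (by positivity)]
    _ = ENNReal.ofReal (K ^ 2 / M)
        * (∫⁻ r in Icc (0 : ℝ) 1, ENNReal.ofReal (M * τ * Real.exp (M * τ * (1 - r))))
          * ENNReal.ofReal (q ^ 2) := by
        rw [lintegral_mul_const _ (by fun_prop), lintegral_const_mul _ (by fun_prop)]
    _ ≤ ENNReal.ofReal (K ^ 2 / M) * ENNReal.ofReal (Real.exp (M * τ))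
          * ENNReal.ofReal (q ^ 2) := by
        gcongr
        exact lintegral_exp_le hθ
    _ = _ := by
        rw [← ENNReal.ofReal_mul (by positivity), ← ENNReal.ofReal_mul (by positivity)]
        congr 1
        rw [div_pow, mul_pow, mul_pow, Real.sq_sqrt hM.le, ← Real.exp_nat_mul]
        push_cast
        rw [show (2 : ℝ) * (M * τ / 2) = M * τ by ring]
        ring

/-- The exponents n - l and l + 1 add up to n + 1, so all terms carry at least the factor μ^{-(n+1)}
and only a geometric sum in C remains. It contributes 2C^n, the bias one more C^n. -/
theorem sum_geometric_error_le {μ C κ : ℝ} (hμ : 1 ≤ μ) (hC : 3 ≤ C) (hκ : 0 ≤ κ) (n : ℕ) :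
    ∑ l ∈ Finset.range n, (μ ^ (n - l))⁻¹ *
        (κ * C ^ (l + 1) * (μ ^ (l + 2))⁻¹ + κ * C ^ l * (μ ^ (l + 1))⁻¹)
      + κ * C ^ n * (μ ^ (n + 1))⁻¹ ≤ 3 * κ * C ^ n * (μ ^ (n + 1))⁻¹ := by
  have hμ0 : 0 < μ := zero_lt_one.trans_le hμ
  have hC0 : 0 < C := by linarith
  have h1 : ∑ l ∈ Finset.range n, (μ ^ (n - l))⁻¹ *
        (κ * C ^ (l + 1) * (μ ^ (l + 2))⁻¹ + κ * C ^ l * (μ ^ (l + 1))⁻¹)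
      ≤ ∑ l ∈ Finset.range n, κ * (C ^ (l + 1) + C ^ l) * (μ ^ (n + 1))⁻¹ := by
    refine Finset.sum_le_sum fun l hl => ?_
    have hl' := Finset.mem_range.1 hl
    have e1 : (μ ^ (n - l))⁻¹ * (μ ^ (l + 1))⁻¹ = (μ ^ (n + 1))⁻¹ := by
      rw [← mul_inv, ← pow_add]
      congr 2
      omega
    have e2 : (μ ^ (n - l))⁻¹ * (μ ^ (l + 2))⁻¹ ≤ (μ ^ (n + 1))⁻¹ := by
      rw [← mul_inv, ← pow_add]
      refine inv_anti₀ (by positivity) (pow_le_pow_right₀ hμ (by omega))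
    calc _ = κ * C ^ (l + 1) * ((μ ^ (n - l))⁻¹ * (μ ^ (l + 2))⁻¹)
          + κ * C ^ l * ((μ ^ (n - l))⁻¹ * (μ ^ (l + 1))⁻¹) := by ring
      _ ≤ κ * C ^ (l + 1) * (μ ^ (n + 1))⁻¹ + κ * C ^ l * (μ ^ (n + 1))⁻¹ := by
          rw [e1]; gcongr
      _ = _ := by ring
  -- The induction step needs 3C^n ≤ C^{n+1}, which is the hypothesis C ≥ 3.
  have h2 : ∑ l ∈ Finset.range n, (C ^ (l + 1) + C ^ l) ≤ 2 * C ^ n := by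
    clear h1
    induction n with
    | zero => simp
    | succ n ih =>
      rw [Finset.sum_range_succ]
      have : 0 < C ^ n := by positivity
      rw [pow_succ]
      nlinarith
  rw [← Finset.sum_mul, ← Finset.mul_sum] at h1
  calc _ ≤ κ * (∑ l ∈ Finset.range n, (C ^ (l + 1) + C ^ l)) * (μ ^ (n + 1))⁻¹
        + κ * C ^ n * (μ ^ (n + 1))⁻¹ := by linarith
    _ ≤ κ * (2 * C ^ n) * (μ ^ (n + 1))⁻¹ + κ * C ^ n * (μ ^ (n + 1))⁻¹ := by gcongr
    _ = _ := by ring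

namespace Model

open Noise

variable {d : ℕ} {m : Model d}

/-! ### Pointwise error -/

theorem measurable_phi_apply (M n : ℕ) (t x) : Measurable fun σ : Noise d => m.phi M n t x σ :=
  (measurable_phi M n).comp (f := fun σ : Noise d => (t, x, σ)) (by fun_prop)

variable (m) in
/-- The rescaled remaining time. -/
noncomputable def rem (t : ℝ) : ℝ := (m.T - t) / m.T

theorem rem_nonneg {t : ℝ} (ht : t ∈ Icc 0 m.T) : 0 ≤ m.rem t :=
  div_nonneg (by linarith [ht.2]) m.T_pos.le

theorem rem_le_one {t : ℝ} (ht : t ∈ Icc 0 m.T) : m.rem t ≤ 1 := by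
  unfold rem; rw [div_le_one m.T_pos]; linarith [ht.1]

theorem rem_tm (t : ℝ) (w : ℝ × (Fin d → ℝ)) : m.rem (m.tm t w) = m.rem t * (1 - w.1) := by
  unfold rem; rw [T_sub_tm]; ring

theorem T_mul_rem (t : ℝ) : m.T * m.rem t = m.T - t := mul_div_cancel₀ _ m.T_pos.ne'

/-- Since the rescaled remaining time τ is at most 1, τ ≤ √τ. This supplies the factor √τ required
by `eLpNorm_prod_exp_le`. -/
theorem T_sub_le {t : ℝ} (ht : t ∈ Icc 0 m.T) : m.T - t ≤ m.T * √(m.rem t) := by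
  rw [← T_mul_rem t]
  refine mul_le_mul_of_nonneg_left (Real.le_sqrt_of_sq_le ?_) m.T_pos.le
  nlinarith [rem_nonneg ht, rem_le_one ht]

variable (m) in
/-- The bound for the pointwise error. -/
def PointError (M l : ℕ) (e : ℝ) : Prop := ∀ t ∈ Icc 0 m.T, ∀ x,
  eLpNorm (fun σ => m.phi M l t x σ - m.sol t x) 2 (noiseLaw d)
    ≤ ENNReal.ofReal (e * Real.exp (M * m.rem t / 2) * m.wt t x ^ m.β)

theorem eLpNorm_drift_sub_le {M l : ℕ} (hM : 1 ≤ M) {e : ℝ} (he : 0 ≤ e)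
    (h : m.PointError M l e) {t : ℝ} (ht : t ∈ Icc 0 m.T) (x) :
    eLpNorm (fun p : (ℝ × (Fin d → ℝ)) × Noise d =>
      m.jump 0 t t x x (fun s' z => m.phi M l s' z p.2) p.1 - m.jump 0 t t x x m.sol p.1) 2
        ((driveLaw d).prod (noiseLaw d))
      ≤ ENNReal.ofReal (m.L * m.T * e * Real.exp (M * m.rem t / 2) * m.wt t x ^ m.β / √M) := by
  have hLT : 0 ≤ m.L * m.T := mul_nonneg m.L_nonneg m.T_pos.le
  have hw : ∀ t x, 0 ≤ m.wt t x ^ m.β := fun t x => Real.rpow_nonneg (m.wt_pos _ _).le _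
  refine eLpNorm_prod_exp_le ((measurable_jump_phi M l 0 t t x x).sub
      ((measurable_jump measurable_sol 0 t t x x).comp measurable_fst))
    (Q := fun w => m.wt (m.tm t w) (m.sp t x w) ^ m.β) (by fun_prop) (fun w => hw _ _)
    (mul_nonneg hLT he) (hw t x) (by exact_mod_cast hM) (rem_nonneg ht) (fun r hr z => ?_)
    (fun r hr => ?_)
  · have hmem := tm_mem (m := m) (w := (r, z)) ht hr
    have h1 := h _ hmem (m.sp t x (r, z))
    have ht0 : 0 ≤ m.T - t := by linarith [ht.2]
    rw [rem_tm] at h1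
    have hL := m.L_nonneg
    refine (eLpNorm_mono_real (fun σ => ?_)).trans ((eLpNorm_const_mul_abs_le
      (c := (m.T - t) * m.L) (mul_nonneg ht0 m.L_nonneg) h1).trans
        (ENNReal.ofReal_le_ofReal ?_))
    · simp only [Pi.sub_apply, Function.comp_apply, jump, zero_mul, sub_zero, drift,
        Real.norm_eq_abs]
      rw [← mul_sub, abs_mul, abs_of_nonneg ht0, mul_assoc]
      exact mul_le_mul_of_nonneg_left (m.f_lip_right _ _ _ _) ht0
    · have h2 := T_sub_le (m := m) ht
      have hw' := hw (m.tm t (r, z)) (m.sp t x (r, z))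
      calc _ ≤ (m.T * √(m.rem t)) * m.L * (e * Real.exp (M * (m.rem t * (1 - r)) / 2)
            * m.wt (m.tm t (r, z)) (m.sp t x (r, z)) ^ m.β) := by gcongr
        _ = _ := by
          rw [show (M : ℝ) * (m.rem t * (1 - r)) / 2 = M * m.rem t / 2 * (1 - r) by ring]
          ring
  · have := lintegral_wt_sp_rpow_le (m := m) (p := m.β * 2) ht hr
      (by linarith [m.β_pos]) (by linarith [m.β_le]) x
    simpa only [Real.rpow_mul (m.wt_pos _ _).le, Real.rpow_two] using this

theorem eLpNorm_terminal_le {t : ℝ} (ht : t ∈ Icc 0 m.T) (x) :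
    eLpNorm (fun w => m.g (m.ep t x w) - 0 * m.g (m.ep t x w)) 2 (driveLaw d)
      ≤ ENNReal.ofReal (m.wt t x ^ m.β) := by
  refine eLpNorm_driveLaw_le (Q := fun w => m.wt m.T (m.ep t x w) ^ m.β) (by fun_prop)
    (Real.rpow_nonneg (m.wt_pos _ _).le _) (fun r _ z => ?_) (fun r _ => ?_)
  · simpa using (m.g_bound _).trans (V_rpow_le le_rfl _)
  · have := lintegral_wt_ep_rpow_le (m := m) (p := m.β * 2) (r := r) ht
      (by linarith [m.β_pos]) (by linarith [m.β_le]) x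
    simpa only [Real.rpow_mul (m.wt_pos _ _).le, Real.rpow_two] using this

theorem eLpNorm_drift_zero_le {t : ℝ} (ht : t ∈ Icc 0 m.T) (x) :
    eLpNorm (m.jump 0 t t x x fun _ _ => 0) 2 (driveLaw d) ≤ ENNReal.ofReal (m.wt t x ^ m.β) := by
  refine eLpNorm_driveLaw_le (Q := fun w => m.wt (m.tm t w) (m.sp t x w) ^ m.β) (by fun_prop)
    (Real.rpow_nonneg (m.wt_pos _ _).le _) (fun r hr z => ?_) (fun r hr => ?_)
  · have hmem := tm_mem (m := m) (w := (r, z)) ht hr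
    have ht0 : 0 ≤ m.T - t := by linarith [ht.2]
    simp only [jump, zero_mul, sub_zero, drift]
    rw [abs_mul, abs_of_nonneg ht0]
    have h1 := (m.f_bound (m.tm t (r, z)) (m.sp t x (r, z)))
    have h2 := V_rpow_le (m := m) hmem.2 (m.sp t x (r, z))
    have h3 : (m.T - t) * m.T⁻¹ ≤ 1 := by
      rw [← div_eq_mul_inv, div_le_one m.T_pos]; linarith [ht.1]
    have h4 : 0 ≤ m.V (m.sp t x (r, z)) ^ m.β := Real.rpow_nonneg (m.V_pos _).le _
    calc _ ≤ (m.T - t) * (m.T⁻¹ * m.V (m.sp t x (r, z)) ^ m.β) := by gcongr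
      _ = ((m.T - t) * m.T⁻¹) * m.V (m.sp t x (r, z)) ^ m.β := by ring
      _ ≤ 1 * m.V (m.sp t x (r, z)) ^ m.β := by gcongr
      _ ≤ _ := by rw [one_mul]; exact h2
  · have := lintegral_wt_sp_rpow_le (m := m) (p := m.β * 2) ht hr
      (by linarith [m.β_pos]) (by linarith [m.β_le]) x
    simpa only [Real.rpow_mul (m.wt_pos _ _).le, Real.rpow_two] using this

variable (m) in
/-- The exponential base `e^{LT/2}` in terms of which all constants are expressed. -/
noncomputable def expHalf : ℝ := Real.exp (m.L * m.T / 2)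

theorem one_le_expHalf : 1 ≤ m.expHalf :=
  Real.one_le_exp (div_nonneg (mul_nonneg m.L_nonneg m.T_pos.le) (by norm_num))

theorem LT_le_expHalf : m.L * m.T ≤ m.expHalf := self_le_exp_half _

theorem expHalf_pow (k : ℕ) : m.expHalf ^ k = Real.exp (k * (m.L * m.T / 2)) := by
  rw [expHalf, ← Real.exp_nat_mul]

/-- Strong induction on the level, fed by the recursion of `phi_error_le`. The start is the growth
bound of the solution, whose constant 6e^{3LT/2} is kept as a prefactor. -/
theorem pointError_phi {M : ℕ} (hM : 1 ≤ M) (n : ℕ) :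
    m.PointError M n (6 * m.expHalf ^ 3 * (50 * m.expHalf ^ 4) ^ n * ((√M) ^ n)⁻¹) := by
  have hE := one_le_expHalf (m := m)
  have hE3 : 1 ≤ m.expHalf ^ 3 := one_le_pow₀ hE
  have hE4 : 1 ≤ m.expHalf ^ 4 := one_le_pow₀ hE
  have hE14 : m.expHalf ≤ m.expHalf ^ 4 := le_self_pow₀ hE (by norm_num)
  have hμ : 1 ≤ √(M : ℝ) := Real.one_le_sqrt.2 (by exact_mod_cast hM)
  have ha : 0 ≤ m.L * m.T := mul_nonneg m.L_nonneg m.T_pos.le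
  have haE := LT_le_expHalf (m := m)
  set E := m.expHalf with hEdef
  set μ := √(M : ℝ) with hμdef
  induction n using Nat.strong_induction_on with
  | _ n ih =>
  intro t ht x
  have hX : 1 ≤ Real.exp (M * m.rem t / 2) :=
    Real.one_le_exp (div_nonneg (mul_nonneg (Nat.cast_nonneg M) (rem_nonneg ht)) (by norm_num))
  have hw : 0 ≤ m.wt t x ^ m.β := Real.rpow_nonneg (m.wt_pos _ _).le _
  cases n with
  | zero =>
    simp only [phi_zero, zero_sub, pow_zero, mul_one, inv_one]
    rw [eLpNorm_const _ (by norm_num) (IsProbabilityMeasure.ne_zero _), measure_univ,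
      ENNReal.one_rpow, mul_one, enorm_neg, Real.enorm_eq_ofReal_abs]
    refine ENNReal.ofReal_le_ofReal ((sol_growth t ht x).trans ?_)
    have h1 : Real.exp (3 / 2 * m.L * (m.T - t)) ≤ E ^ 3 := by
      rw [hEdef, expHalf_pow]
      refine Real.exp_le_exp.2 ?_
      push_cast
      nlinarith [mul_nonneg m.L_nonneg ht.1]
    calc _ ≤ 6 * E ^ 3 * 1 * m.wt t x ^ m.β := by rw [mul_one]; gcongr
      _ ≤ _ := by gcongr
  | succ n =>
    set X := Real.exp (M * m.rem t / 2) with hXdef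
    set q := m.wt t x ^ m.β with hqdef
    set C := 50 * E ^ 4 with hC
    have hC50 : 50 ≤ C := by linarith
    have hC0 : 0 ≤ C := by linarith
    set κ := m.L * m.T * (6 * E ^ 3) * X * q with hκ
    have hκ0 : 0 ≤ κ := by positivity
    have key := phi_error_le (m := m) hM ht ht x x 0
      (b := fun l => κ * C ^ l * (μ ^ (l + 1))⁻¹) hw hw (fun l => by positivity)
      (eLpNorm_terminal_le ht x) (eLpNorm_drift_zero_le ht x) (n := n) (fun l hl => by
        refine (eLpNorm_drift_sub_le hM (by positivity) (ih l (by omega)) ht x).trans_eq ?_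
        congr 1
        rw [hκ, pow_succ μ, mul_inv, ← hμdef, ← hXdef, ← hqdef, div_eq_mul_inv]
        ring)
    simp only [zero_mul, sub_zero] at key
    refine key.trans (ENNReal.ofReal_le_ofReal ?_)
    have hsum := sum_geometric_error_le hμ (C := C) (by linarith) hκ0 n
    have hμ' : 0 ≤ (μ ^ (n + 1))⁻¹ := by positivity
    have hCn : 1 ≤ C ^ n := one_le_pow₀ (by linarith)
    -- The induction closes as soon as 1 + 3LT ≤ C, which holds since LT ≤ e^{LT/2}. Here C =
    -- 50e^{2LT} has room to spare; its size is dictated by the increments.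
    have hfin : 2 * q + 3 * κ * C ^ n ≤ 6 * E ^ 3 * C ^ (n + 1) * X * q := by
      have h1 : 3 * (m.L * m.T) + 1 ≤ C := by linarith
      have h2 : 1 ≤ E ^ 3 * C ^ n * X := by
        calc (1 : ℝ) = 1 * 1 * 1 := by norm_num
          _ ≤ _ := by gcongr
      calc 2 * q + 3 * κ * C ^ n = 2 * 1 * q + 6 * (3 * (m.L * m.T)) * (E ^ 3 * C ^ n * X) * q := by
            rw [hκ]; ring
        _ ≤ 6 * (E ^ 3 * C ^ n * X) * q + 6 * (3 * (m.L * m.T)) * (E ^ 3 * C ^ n * X) * q := by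
            gcongr
            norm_num
        _ = 6 * (3 * (m.L * m.T) + 1) * (E ^ 3 * C ^ n * X) * q := by ring
        _ ≤ 6 * C * (E ^ 3 * C ^ n * X) * q := by gcongr
        _ = _ := by ring
    calc _ = 2 * q * (μ ^ (n + 1))⁻¹ + (∑ l ∈ Finset.range n, (μ ^ (n - l))⁻¹ *
          (κ * C ^ (l + 1) * (μ ^ (l + 2))⁻¹ + κ * C ^ l * (μ ^ (l + 1))⁻¹)
            + κ * C ^ n * (μ ^ (n + 1))⁻¹) := by ring
      _ ≤ 2 * q * (μ ^ (n + 1))⁻¹ + 3 * κ * C ^ n * (μ ^ (n + 1))⁻¹ := by gcongr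
      _ = (2 * q + 3 * κ * C ^ n) * (μ ^ (n + 1))⁻¹ := by ring
      _ ≤ (6 * E ^ 3 * C ^ (n + 1) * X * q) * (μ ^ (n + 1))⁻¹ := by gcongr
      _ = _ := by ring

end Model
namespace Model

open Noise

variable {d : ℕ} {m : Model d}

/-! ### The error of increments -/

variable (m) in
/-- The bound for the error of increments. -/
def PairError (M l : ℕ) (h : ℝ) : Prop := ∀ s ∈ Icc 0 m.T, ∀ t ∈ Icc 0 m.T, s ≤ t → ∀ x y,
  eLpNorm (fun σ => (m.phi M l s x σ - m.sol s x) - (m.phi M l t y σ - m.sol t y)) 2 (noiseLaw d)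
    ≤ ENNReal.ofReal (h * Real.exp (M * m.rem s / 2)
      * ((√m.T)⁻¹ * m.dst s t x y * (m.wt s x + m.wt t y) ^ (1 / 4 : ℝ)))

section coupled

variable {s t r : ℝ}

theorem abs_tm_sub_tm_le (hr : r ∈ Icc (0 : ℝ) 1) (z : Fin d → ℝ) :
    |m.tm s (r, z) - m.tm t (r, z)| ≤ |s - t| := by
  have e : m.tm s (r, z) - m.tm t (r, z) = (s - t) * (1 - r) := by
    simp only [tm]; ring
  rw [e, abs_mul, abs_of_nonneg (by linarith [hr.2] : (0 : ℝ) ≤ 1 - r)]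
  exact mul_le_of_le_one_right (abs_nonneg _) (by linarith [hr.1])

theorem tm_le_tm (hst : s ≤ t) (hr : r ∈ Icc (0 : ℝ) 1) (z : Fin d → ℝ) :
    m.tm s (r, z) ≤ m.tm t (r, z) := by
  simp only [tm]
  nlinarith [hr.2]

theorem nrm_sp_sub_sp_le (hs : s ∈ Icc 0 m.T) (ht : t ∈ Icc 0 m.T)
    (hr : r ∈ Icc (0 : ℝ) 1) (x y z : Fin d → ℝ) :
    m.nrm (m.sp s x (r, z) - m.sp t y (r, z)) ≤ m.nrm (x - y) + √|s - t| * m.nrm z := by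
  rw [sp_eq hs x (w := (r, z)) hr, sp_eq ht y (w := (r, z)) hr]
  refine m.nrm_sub_le ((abs_sqrt_sub_sqrt_le (step_nonneg hs hr) (step_nonneg ht hr)).trans
    (Real.sqrt_le_sqrt ?_)) x y z
  rw [show (m.T - s) * r - (m.T - t) * r = (s - t) * (-r) by ring, abs_mul, abs_neg,
    abs_of_nonneg hr.1]
  exact mul_le_of_le_one_right (abs_nonneg _) hr.2

theorem dst_coupled_le (hs : s ∈ Icc 0 m.T) (ht : t ∈ Icc 0 m.T)
    (hr : r ∈ Icc (0 : ℝ) 1) (x y z : Fin d → ℝ) :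
    m.dst (m.tm s (r, z)) (m.tm t (r, z)) (m.sp s x (r, z)) (m.sp t y (r, z))
      ≤ m.cdst s t x y z := by
  have h1 := Real.sqrt_le_sqrt (abs_tm_sub_tm_le (m := m) (s := s) (t := t) hr z)
  have h2 := nrm_sp_sub_sp_le hs ht hr x y z
  have := m.one_le_c
  unfold cdst dst
  nlinarith

theorem lintegral_sp_pair_sq_le (hs : s ∈ Icc 0 m.T) (ht : t ∈ Icc 0 m.T)
    (hr : r ∈ Icc (0 : ℝ) 1) (x y : Fin d → ℝ) {p : ℝ} (hp : 0 ≤ p) (hp4 : p ≤ 1 / 4) :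
    ∫⁻ z, ENNReal.ofReal (((m.wt (m.tm s (r, z)) (m.sp s x (r, z))
      + m.wt (m.tm t (r, z)) (m.sp t y (r, z))) ^ p * m.cdst s t x y z) ^ 2) ∂stdNormal d
      ≤ ENNReal.ofReal (((m.wt s x + m.wt t y) ^ p * (2 * m.dst s t x y)) ^ 2) := by
  simp only [sp_eq hs x (w := (r, _)) hr, sp_eq ht y (w := (r, _)) hr]
  exact m.lintegral_pair_le (step_nonneg hs hr) (step_le hs hr) (step_nonneg ht hr)
    (step_le ht hr) hp hp4 x y

end coupled

theorem lintegral_ep_pair_sq_le {s t : ℝ} (hs : s ∈ Icc 0 m.T) (ht : t ∈ Icc 0 m.T) (r : ℝ) (x y)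
    {p : ℝ} (hp : 0 ≤ p) (hp4 : p ≤ 1 / 4) :
    ∫⁻ z, ENNReal.ofReal (((m.wt m.T (m.ep s x (r, z))
      + m.wt m.T (m.ep t y (r, z))) ^ p * m.cdst s t x y z) ^ 2) ∂stdNormal d
      ≤ ENNReal.ofReal (((m.wt s x + m.wt t y) ^ p * (2 * m.dst s t x y)) ^ 2) := by
  simp only [ep_eq hs, ep_eq ht]
  have := m.lintegral_pair_le (s := s) (t := t) (h := m.T - s) (k := m.T - t)
    (by linarith [hs.2]) (by linarith [hs.1]) (by linarith [ht.2]) (by linarith [ht.1]) hp hp4 x y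
  simpa only [add_sub_cancel] using this

theorem rpow_wt_le {s t : ℝ} (hs : s ≤ m.T) (x y) {p : ℝ} (hp : p ≤ 1 / 4) :
    (m.wt s x + m.wt t y) ^ p ≤ (m.wt s x + m.wt t y) ^ (1 / 4 : ℝ) :=
  Real.rpow_le_rpow_of_exponent_le
    (by linarith [m.one_le_wt hs x, m.wt_pos t y]) hp

theorem sqrt_T_mul_inv : m.T * (√m.T)⁻¹ = √m.T := by rw [← div_eq_mul_inv, Real.div_sqrt]

/-- One factor √(t - s) is bounded by √(T - s), the other by the distance. The first yields √τ at
the earlier time s, the form needed for the time integration. -/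
theorem sub_le_sqrt_mul {s t δ : ℝ} (ht : t ∈ Icc 0 m.T) (hst : s ≤ t)
    (hδ : √|s - t| ≤ δ) : t - s ≤ m.T * √(m.rem s) * ((√m.T)⁻¹ * δ) := by
  have h1 : t - s = √|s - t| * √|s - t| := by
    rw [Real.mul_self_sqrt (abs_nonneg _), abs_sub_comm, abs_of_nonneg (by linarith)]
  have h2 : √|s - t| ≤ √m.T * √(m.rem s) := by
    rw [← Real.sqrt_mul m.T_pos.le, T_mul_rem]
    apply Real.sqrt_le_sqrt
    rw [abs_sub_comm, abs_of_nonneg (by linarith)]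
    linarith [ht.2]
  calc t - s = √|s - t| * √|s - t| := h1
    _ ≤ (√m.T * √(m.rem s)) * δ := mul_le_mul h2 hδ (Real.sqrt_nonneg _) (by positivity)
    _ = (m.T * (√m.T)⁻¹ * √(m.rem s)) * δ := by rw [sqrt_T_mul_inv]
    _ = _ := by ring

theorem eLpNorm_terminal_pair_le {s t : ℝ} (hs : s ∈ Icc 0 m.T) (ht : t ∈ Icc 0 m.T) (x y) :
    eLpNorm (fun w => m.g (m.ep s x w) - 1 * m.g (m.ep t y w)) 2 (driveLaw d) ≤
      ENNReal.ofReal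
        (2 * ((√m.T)⁻¹ * m.dst s t x y * (m.wt s x + m.wt t y) ^ (1 / 4 : ℝ))) := by
  have hsi : 0 ≤ (√m.T)⁻¹ := inv_nonneg.2 (Real.sqrt_nonneg _)
  have hW : ∀ s t x y, ∀ p : ℝ, 0 ≤ (m.wt s x + m.wt t y) ^ p := fun s t x y p =>
    Real.rpow_nonneg (add_pos (m.wt_pos _ _) (m.wt_pos _ _)).le _
  have hd := m.dst_nonneg s t x y
  refine eLpNorm_driveLaw_le (Q := fun w => (√m.T)⁻¹ *
    ((m.wt m.T (m.ep s x w) + m.wt m.T (m.ep t y w)) ^ (1 / 4 : ℝ) * m.cdst s t x y w.2))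
    (by unfold cdst; fun_prop) (mul_nonneg (by norm_num)
      (mul_nonneg (mul_nonneg hsi hd) (hW _ _ _ _ _))) (fun r _ z => ?_) (fun r _ => ?_)
  · rw [one_mul]
    have h1 := m.g_lip (m.ep s x (r, z)) (m.ep t y (r, z))
    have h2 := (V_add_rpow_le (m := m) le_rfl le_rfl (m.ep s x (r, z)) (m.ep t y (r, z))).trans
      (rpow_wt_le le_rfl _ _ (by linarith [m.β_le]))
    have h3 : m.nrm (m.ep s x (r, z) - m.ep t y (r, z)) ≤ m.cdst s t x y z := by
      rw [ep_eq hs, ep_eq ht]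
      refine m.nrm_sub_le_cdst ?_ x y z
      refine (abs_sqrt_sub_sqrt_le (by linarith [hs.2]) (by linarith [ht.2])).trans_eq ?_
      rw [show m.T - s - (m.T - t) = -(s - t) by ring, abs_neg]
    refine h1.trans ?_
    rw [mul_assoc]
    exact mul_le_mul_of_nonneg_left (mul_le_mul h2 h3 (apply_nonneg _ _) (hW _ _ _ _ _)) hsi
  · have h := lintegral_ep_pair_sq_le hs ht r x y (p := 1 / 4) (by norm_num) le_rfl
    simp only [mul_pow (√m.T)⁻¹, ENNReal.ofReal_mul (sq_nonneg (√m.T)⁻¹)]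
    rw [lintegral_const_mul _ (by unfold cdst; fun_prop)]
    refine (mul_le_mul_right h _).trans_eq ?_
    rw [← ENNReal.ofReal_mul (sq_nonneg _)]
    congr 1
    ring

/-- The prefactors T - s and T - t differ, so besides the increment of f there is a term (t - s) f.
Each contributes one unit, and Cauchy–Schwarz doubles the sum to 4. -/
theorem eLpNorm_drift_zero_pair_le {s t : ℝ} (hs : s ∈ Icc 0 m.T) (ht : t ∈ Icc 0 m.T)
    (hst : s ≤ t) (x y) :
    eLpNorm (m.jump 1 s t x y fun _ _ => 0) 2 (driveLaw d) ≤ ENNReal.ofReal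
        (4 * ((√m.T)⁻¹ * m.dst s t x y * (m.wt s x + m.wt t y) ^ (1 / 4 : ℝ))) := by
  have hsi : 0 ≤ (√m.T)⁻¹ := inv_nonneg.2 (Real.sqrt_nonneg _)
  have hW : ∀ s t x y, ∀ p : ℝ, 0 ≤ (m.wt s x + m.wt t y) ^ p := fun s t x y p =>
    Real.rpow_nonneg (add_pos (m.wt_pos _ _) (m.wt_pos _ _)).le _
  have hd := m.dst_nonneg s t x y
  refine eLpNorm_driveLaw_le (Q := fun w => (2 * (√m.T)⁻¹) *
    ((m.wt (m.tm s w) (m.sp s x w) + m.wt (m.tm t w) (m.sp t y w)) ^ (1 / 4 : ℝ)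
      * m.cdst s t x y w.2))
    (by unfold cdst; fun_prop) (mul_nonneg (by norm_num)
      (mul_nonneg (mul_nonneg hsi hd) (hW _ _ _ _ _))) (fun r hr z => ?_) (fun r hr => ?_)
  · have hms := tm_mem (m := m) (w := (r, z)) hs hr
    have hmt := tm_mem (m := m) (w := (r, z)) ht hr
    set s' := m.tm s (r, z) with hs'
    set t' := m.tm t (r, z) with ht'
    set X := m.sp s x (r, z) with hX
    set Y := m.sp t y (r, z) with hY
    set W := (m.wt s' X + m.wt t' Y) ^ (1 / 4 : ℝ) with hWdef
    set D := m.cdst s t x y z with hD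
    have hW0 : 0 ≤ W := hW _ _ _ _ _
    have hD0 : 0 ≤ D := m.cdst_nonneg s t x y z
    have ht0 : 0 ≤ m.T - t := by linarith [ht.2]
    have hts : 0 ≤ t - s := by linarith
    have hTi : 0 ≤ m.T⁻¹ := inv_nonneg.2 m.T_pos.le
    have h1 := m.f_lip s' t' X Y 0 0
    have h2 := (V_add_rpow_le (m := m) hms.2 hmt.2 X Y).trans
      (rpow_wt_le hms.2 _ _ (by linarith [m.β_le]))
    have h3 : √|s' - t'| + m.nrm (X - Y) ≤ D := by
      refine le_trans ?_ (dst_coupled_le hs ht hr x y z)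
      unfold dst
      have := m.one_le_c
      nlinarith [Real.sqrt_nonneg |s' - t'|]
    have h4 : |m.f s' X 0| ≤ m.T⁻¹ * W := by
      refine (m.f_bound s' X).trans (mul_le_mul_of_nonneg_left ?_ hTi)
      refine le_trans ?_ h2
      exact Real.rpow_le_rpow (m.V_pos X).le (by linarith [m.V_pos Y]) m.β_pos.le
    have h5 : (t - s) * m.T⁻¹ ≤ (√m.T)⁻¹ * D := by
      have h6 := sub_le_sqrt_mul ht hst
        ((m.sqrt_le_dst s t x y).trans (m.dst_le_cdst s t x y z))
      have h7 : √(m.rem s) ≤ 1 := Real.sqrt_le_one.2 (rem_le_one hs)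
      have h8 : 0 ≤ (√m.T)⁻¹ * D := mul_nonneg hsi hD0
      calc (t - s) * m.T⁻¹ ≤ (m.T * √(m.rem s) * ((√m.T)⁻¹ * D)) * m.T⁻¹ := by gcongr
        _ = (m.T * m.T⁻¹) * √(m.rem s) * ((√m.T)⁻¹ * D) := by ring
        _ ≤ 1 * 1 * ((√m.T)⁻¹ * D) := by
            rw [mul_inv_cancel₀ m.T_pos.ne']
            gcongr
        _ = _ := by ring
    have h9 : (m.T - t) * m.T⁻¹ ≤ 1 := by
      rw [← div_eq_mul_inv, div_le_one m.T_pos]; linarith [ht.1]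
    have e : m.jump 1 s t x y (fun _ _ => 0) (r, z)
        = (m.T - t) * (m.f s' X 0 - m.f t' Y 0) + (t - s) * m.f s' X 0 := by
      simp only [jump, drift]
      ring
    rw [e]
    refine (abs_add_le _ _).trans ?_
    rw [abs_mul, abs_mul, abs_of_nonneg ht0, abs_of_nonneg hts]
    rw [sub_self, abs_zero, mul_zero, add_zero] at h1
    have hnn : 0 ≤ √|s' - t'| + m.nrm (X - Y) :=
      add_nonneg (Real.sqrt_nonneg _) (apply_nonneg _ _)
    have hVV : 0 ≤ (m.V X + m.V Y) ^ m.β :=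
      Real.rpow_nonneg (add_pos (m.V_pos _) (m.V_pos _)).le _
    calc _ ≤ (m.T - t) * (m.T⁻¹ * (√m.T)⁻¹ * W * D) + (t - s) * (m.T⁻¹ * W) := by
          refine add_le_add (mul_le_mul_of_nonneg_left (h1.trans ?_) ht0)
            (mul_le_mul_of_nonneg_left h4 hts)
          gcongr
      _ = ((m.T - t) * m.T⁻¹) * ((√m.T)⁻¹ * W * D) + ((t - s) * m.T⁻¹) * W := by ring
      _ ≤ 1 * ((√m.T)⁻¹ * W * D) + ((√m.T)⁻¹ * D) * W := by gcongr
      _ = _ := by ring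
  · have h := lintegral_sp_pair_sq_le hs ht hr x y (p := 1 / 4) (by norm_num) le_rfl
    simp only [mul_pow (2 * (√m.T)⁻¹), ENNReal.ofReal_mul (sq_nonneg (2 * (√m.T)⁻¹))]
    rw [lintegral_const_mul _ (by unfold cdst; fun_prop)]
    refine (mul_le_mul_right h _).trans_eq ?_
    rw [← ENNReal.ofReal_mul (sq_nonneg _)]
    congr 1
    ring

/-- The assumption on differences of f is applied with the approximations against the solution. It
yields the pair error with factor LT and the pointwise error with factor 1 from the distance term
and 50e^{2LT} from the increment of the solution. The mismatch t - s of the prefactors adds another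
LT times the pointwise error. -/
theorem eLpNorm_drift_pair_sub_le {M l : ℕ} (hM : 1 ≤ M) {e h : ℝ} (he : 0 ≤ e) (hh : 0 ≤ h)
    (hpt : m.PointError M l e) (hpr : m.PairError M l h) {s t : ℝ} (hs : s ∈ Icc 0 m.T)
    (ht : t ∈ Icc 0 m.T) (hst : s ≤ t) (x y) :
    eLpNorm (fun p : (ℝ × (Fin d → ℝ)) × Noise d =>
      m.jump 1 s t x y (fun s' z => m.phi M l s' z p.2) p.1 - m.jump 1 s t x y m.sol p.1) 2
        ((driveLaw d).prod (noiseLaw d))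
      ≤ ENNReal.ofReal ((m.L * m.T * h + (1 + 50 * m.expHalf ^ 4 + m.L * m.T) * e)
        * Real.exp (M * m.rem s / 2)
        * (2 * ((√m.T)⁻¹ * m.dst s t x y * (m.wt s x + m.wt t y) ^ (1 / 4 : ℝ))) / √M) := by
  have hLT : 0 ≤ m.L * m.T := mul_nonneg m.L_nonneg m.T_pos.le
  have hsi : 0 ≤ (√m.T)⁻¹ := inv_nonneg.2 (Real.sqrt_nonneg _)
  have hE : 0 ≤ m.expHalf := (Real.exp_pos _).le
  have hW : ∀ s t x y, ∀ p : ℝ, 0 ≤ (m.wt s x + m.wt t y) ^ p := fun s t x y p =>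
    Real.rpow_nonneg (add_pos (m.wt_pos _ _) (m.wt_pos _ _)).le _
  have hd := m.dst_nonneg s t x y
  have hκ : 0 ≤ m.L * m.T * h + (1 + 50 * m.expHalf ^ 4 + m.L * m.T) * e := by positivity
  refine eLpNorm_prod_exp_le ((measurable_jump_phi M l 1 s t x y).sub
      ((measurable_jump measurable_sol 1 s t x y).comp measurable_fst))
    (Q := fun w => (√m.T)⁻¹ *
    ((m.wt (m.tm s w) (m.sp s x w) + m.wt (m.tm t w) (m.sp t y w)) ^ (1 / 4 : ℝ)
      * m.cdst s t x y w.2)) (by unfold cdst; fun_prop)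
    (fun w => mul_nonneg hsi (mul_nonneg (hW _ _ _ _ _) (m.cdst_nonneg _ _ _ _ _)))
    hκ (mul_nonneg (by norm_num) (mul_nonneg (mul_nonneg hsi hd) (hW _ _ _ _ _)))
    (by exact_mod_cast hM) (rem_nonneg hs) (fun r hr z => ?_) (fun r hr => ?_)
  · have hms := tm_mem (m := m) (w := (r, z)) hs hr
    have hmt := tm_mem (m := m) (w := (r, z)) ht hr
    have hmst := tm_le_tm (m := m) hst hr z
    have hX1 := hpt _ hms (m.sp s x (r, z))
    have hX2 := hpt _ hmt (m.sp t y (r, z))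
    have hX3 := hpr _ hms _ hmt hmst (m.sp s x (r, z)) (m.sp t y (r, z))
    have hdc := dst_coupled_le hs ht hr x y z
    have hsol := sol_holder hms hmt (m.sp s x (r, z)) (m.sp t y (r, z))
    have hexp4 : Real.exp (2 * (m.L * m.T)) = m.expHalf ^ 4 := by
      rw [expHalf_pow]
      congr 1
      push_cast
      ring
    rw [hexp4] at hsol
    -- The order s ≤ t is preserved by the common uniform time, so the exponential weight at the
    -- earlier time dominates the one at the later time.
    have hremt : m.rem (m.tm t (r, z)) ≤ m.rem (m.tm s (r, z)) := by
      unfold rem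
      have := m.T_pos
      gcongr
    have hrem : (M : ℝ) * m.rem (m.tm s (r, z)) / 2 = M * m.rem s / 2 * (1 - r) := by
      rw [rem_tm]; ring
    have hF := fun (v w : ℝ) => m.f_diff (m.tm s (r, z)) (m.tm t (r, z)) (m.sp s x (r, z))
      (m.sp t y (r, z)) v w (m.sol (m.tm s (r, z)) (m.sp s x (r, z)))
      (m.sol (m.tm t (r, z)) (m.sp t y (r, z)))
    have hFl := fun v : ℝ => m.f_lip_right (m.tm s (r, z)) (m.sp s x (r, z)) v
      (m.sol (m.tm s (r, z)) (m.sp s x (r, z)))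
    have hjump : ∀ σ : Noise d, m.jump 1 s t x y (fun s' z => m.phi M l s' z σ) (r, z)
        - m.jump 1 s t x y m.sol (r, z)
        = (m.T - t) * ((m.f (m.tm s (r, z)) (m.sp s x (r, z))
              (m.phi M l (m.tm s (r, z)) (m.sp s x (r, z)) σ)
            - m.f (m.tm s (r, z)) (m.sp s x (r, z)) (m.sol (m.tm s (r, z)) (m.sp s x (r, z))))
          - (m.f (m.tm t (r, z)) (m.sp t y (r, z))
              (m.phi M l (m.tm t (r, z)) (m.sp t y (r, z)) σ)
            - m.f (m.tm t (r, z)) (m.sp t y (r, z)) (m.sol (m.tm t (r, z)) (m.sp t y (r, z)))))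
          + (t - s) * (m.f (m.tm s (r, z)) (m.sp s x (r, z))
              (m.phi M l (m.tm s (r, z)) (m.sp s x (r, z)) σ)
            - m.f (m.tm s (r, z)) (m.sp s x (r, z)) (m.sol (m.tm s (r, z)) (m.sp s x (r, z)))) := by
      intro σ
      simp only [jump, drift]
      ring
    have hV := V_add_rpow_le (m := m) hms.2 hmt.2 (m.sp s x (r, z)) (m.sp t y (r, z))
    have hws : m.wt (m.tm s (r, z)) (m.sp s x (r, z)) ^ m.β ≤
        (m.wt (m.tm s (r, z)) (m.sp s x (r, z)) + m.wt (m.tm t (r, z)) (m.sp t y (r, z))) ^ m.β :=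
      Real.rpow_le_rpow (m.wt_pos _ _).le (le_add_of_nonneg_right (m.wt_pos _ _).le) m.β_pos.le
    have hwt : m.wt (m.tm t (r, z)) (m.sp t y (r, z)) ^ m.β ≤
        (m.wt (m.tm s (r, z)) (m.sp s x (r, z)) + m.wt (m.tm t (r, z)) (m.sp t y (r, z))) ^ m.β :=
      Real.rpow_le_rpow (m.wt_pos _ _).le (le_add_of_nonneg_left (m.wt_pos _ _).le) m.β_pos.le
    have hβ := m.β_le
    have hβ0 := m.β_pos
    have hone : 1 ≤ m.wt (m.tm s (r, z)) (m.sp s x (r, z)) + m.wt (m.tm t (r, z)) (m.sp t y (r, z)) :=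
      by linarith [m.one_le_wt hms.2 (m.sp s x (r, z)), m.wt_pos (m.tm t (r, z)) (m.sp t y (r, z))]
    have hmφ1 := measurable_phi_apply (m := m) M l (m.tm s (r, z)) (m.sp s x (r, z))
    have hmφ2 := measurable_phi_apply (m := m) M l (m.tm t (r, z)) (m.sp t y (r, z))
    have hrs := T_sub_le (m := m) hs
    have hts' := sub_le_sqrt_mul ht hst
      ((m.sqrt_le_dst s t x y).trans (m.dst_le_cdst s t x y z))
    have hd' := m.dst_nonneg (m.tm s (r, z)) (m.tm t (r, z)) (m.sp s x (r, z)) (m.sp t y (r, z))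
    rw [hrem] at hX1 hX3
    set s' := m.tm s (r, z) with hs'
    set t' := m.tm t (r, z) with ht'
    set X := m.sp s x (r, z) with hXdef
    set Y := m.sp t y (r, z) with hYdef
    set D := m.cdst s t x y z with hD
    set ω := m.wt s' X + m.wt t' Y with hω
    set q := ω ^ m.β with hq
    set W := ω ^ (1 / 4 : ℝ) with hWdef
    set Ex := Real.exp (M * m.rem s / 2 * (1 - r)) with hEx
    set E4 := m.expHalf ^ 4 with hE4
    set τ := √(m.rem s) with hτ
    set R := (√m.T)⁻¹ * D with hR
    have hE40 : 0 ≤ E4 := by positivity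
    have hω0 : 0 < ω := by linarith
    have hq0 : 0 ≤ q := Real.rpow_nonneg hω0.le _
    have hW0 : 0 ≤ W := Real.rpow_nonneg hω0.le _
    have hq1 : q ≤ W := Real.rpow_le_rpow_of_exponent_le hone (by linarith)
    have hq2 : q * q ≤ W := by
      rw [hq, ← Real.rpow_add hω0]
      exact Real.rpow_le_rpow_of_exponent_le hone (by linarith)
    -- The weights of the assumption on f, of the Hölder bound of the solution and of the pointwise
    -- error meet here, so 3β ≤ 1/4 is needed, exactly β ≤ 1/12.
    have hq3 : q * q * q ≤ W := by
      rw [hq, ← Real.rpow_add hω0, ← Real.rpow_add hω0]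
      exact Real.rpow_le_rpow_of_exponent_le hone (by linarith)
    have hD0 : 0 ≤ D := m.cdst_nonneg s t x y z
    have hR0 : 0 ≤ R := mul_nonneg hsi hD0
    have hEx0 : 0 ≤ Ex := (Real.exp_pos _).le
    have hτ0 : 0 ≤ τ := Real.sqrt_nonneg _
    have ht0 : 0 ≤ m.T - t := by linarith [ht.2]
    have htsn : 0 ≤ t - s := by linarith
    have hTi : 0 ≤ m.T⁻¹ := inv_nonneg.2 m.T_pos.le
    have hT0 := m.T_pos.le
    have hL := m.L_nonneg
    have hTt : m.T - t ≤ m.T * τ := by linarith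
    have hTt' : (m.T - t) * m.T⁻¹ ≤ τ := by
      calc _ ≤ m.T * τ * m.T⁻¹ := by gcongr
        _ = (m.T * m.T⁻¹) * τ := by ring
        _ = τ := by rw [mul_inv_cancel₀ m.T_pos.ne', one_mul]
    have hn1 : eLpNorm (fun σ => m.phi M l s' X σ - m.sol s' X) 2 (noiseLaw d)
        ≤ ENNReal.ofReal (e * Ex * q) := by
      refine hX1.trans (ENNReal.ofReal_le_ofReal ?_)
      gcongr
    have hn2 : eLpNorm (fun σ => m.phi M l t' Y σ - m.sol t' Y) 2 (noiseLaw d)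
        ≤ ENNReal.ofReal (e * Ex * q) := by
      refine hX2.trans (ENNReal.ofReal_le_ofReal ?_)
      have : Real.exp (M * m.rem t' / 2) ≤ Ex := by
        rw [hEx, ← hrem]
        gcongr
      have := Real.rpow_nonneg (m.wt_pos t' Y).le m.β
      gcongr
    have hn3 : eLpNorm (fun σ => (m.phi M l s' X σ - m.sol s' X) - (m.phi M l t' Y σ - m.sol t' Y))
        2 (noiseLaw d) ≤ ENNReal.ofReal (h * Ex * (R * W)) := by
      refine hX3.trans (ENNReal.ofReal_le_ofReal ?_)
      rw [hR]
      gcongr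
    have hsol' : |m.sol s' X - m.sol t' Y| ≤ 25 * E4 * (R * q) := by
      refine hsol.trans ?_
      rw [hR]
      gcongr
    have hVn : 0 ≤ (m.V X + m.V Y) ^ m.β :=
      Real.rpow_nonneg (add_pos (m.V_pos _) (m.V_pos _)).le _
    refine (eLpNorm_le_of_abs_le_add
      (f₁ := fun σ => (m.phi M l s' X σ - m.sol s' X) - (m.phi M l t' Y σ - m.sol t' Y))
      (f₂ := fun σ => m.phi M l s' X σ - m.sol s' X) (f₃ := fun σ => m.phi M l t' Y σ - m.sol t' Y)
      (c₁ := (m.T - t) * m.L)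
      (c₂ := (m.T - t) * (m.T⁻¹ * q * R + m.T⁻¹ * q * (25 * E4 * (R * q))) + (t - s) * m.L)
      (c₃ := (m.T - t) * (m.T⁻¹ * q * (25 * E4 * (R * q))))
      ((hmφ1.sub_const (m.sol s' X)).sub (hmφ2.sub_const (m.sol t' Y)))
      (hmφ1.sub_const (m.sol s' X)) (hmφ2.sub_const (m.sol t' Y))
      (by positivity) (by positivity) (by positivity) (by positivity) (by positivity)
      (by positivity) (fun σ => ?_) hn3 hn1 hn2).trans (ENNReal.ofReal_le_ofReal ?_)
    · refine (congrArg abs (hjump σ)).trans_le ((abs_add_le _ _).trans ?_)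
      rw [abs_mul, abs_mul, abs_of_nonneg ht0, abs_of_nonneg htsn]
      set A := m.phi M l s' X σ with hA
      set B := m.phi M l t' Y σ with hB
      have hb1 := hF A B
      have hb2 := hFl A
      have hb1' : |(m.f s' X A - m.f s' X (m.sol s' X)) - (m.f t' Y B - m.f t' Y (m.sol t' Y))|
          ≤ m.L * |(A - m.sol s' X) - (B - m.sol t' Y)|
            + m.T⁻¹ * q * R * |A - m.sol s' X|
            + m.T⁻¹ * q * (|A - m.sol s' X| + |B - m.sol t' Y|) * (25 * E4 * (R * q)) := by
        refine hb1.trans (add_le_add (add_le_add le_rfl ?_) ?_)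
        · rw [hR]
          calc m.T⁻¹ * (√m.T)⁻¹ * (m.V X + m.V Y) ^ m.β * (m.c * √|s' - t'| + m.nrm (X - Y))
                * |A - m.sol s' X|
              ≤ m.T⁻¹ * (√m.T)⁻¹ * q * D * |A - m.sol s' X| := by
                gcongr
                exact hdc
            _ = _ := by ring
        · gcongr
      calc _ ≤ (m.T - t) * (m.L * |(A - m.sol s' X) - (B - m.sol t' Y)|
            + m.T⁻¹ * q * R * |A - m.sol s' X|
            + m.T⁻¹ * q * (|A - m.sol s' X| + |B - m.sol t' Y|) * (25 * E4 * (R * q)))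
            + (t - s) * (m.L * |A - m.sol s' X|) := by gcongr
        _ = _ := by ring
    -- The coefficient 50 is twice the Hölder constant 25, since the pointwise errors at both points
    -- multiply the increment of the solution.
    · calc _ = (m.T - t) * (m.L * h * Ex * (R * W))
            + ((m.T - t) * m.T⁻¹) * (R * e * Ex * ((q * q) + 50 * E4 * (q * q * q)))
            + (t - s) * (m.L * e * Ex * q) := by ring
        _ ≤ (m.T * τ) * (m.L * h * Ex * (R * W))
            + τ * (R * e * Ex * (W + 50 * E4 * W))
            + (m.T * τ * R) * (m.L * e * Ex * W) := by gcongr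
        _ = _ := by ring
  · have h := lintegral_sp_pair_sq_le hs ht hr x y (p := 1 / 4) (by norm_num) le_rfl
    simp only [mul_pow (√m.T)⁻¹, ENNReal.ofReal_mul (sq_nonneg (√m.T)⁻¹)]
    rw [lintegral_const_mul _ (by unfold cdst; fun_prop)]
    refine (mul_le_mul_right h _).trans_eq ?_
    rw [← ENNReal.ofReal_mul (sq_nonneg _)]
    congr 1
    ring

/-- This fixes the constant 50. As a ≤ E, every term is at most a multiple of E⁸, and the
coefficients sum to 2178 ≤ 50². -/
theorem pair_constant_le {E a : ℝ} (hE : 1 ≤ E) (ha : a ≤ E) :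
    6 + 3 * (2 * (a * (50 * E ^ 4) + (1 + 50 * E ^ 4 + a) * (6 * E ^ 3)))
      ≤ (50 * E ^ 4) ^ 2 := by
  have h3 : E ^ 3 ≤ E ^ 8 := pow_le_pow_right₀ hE (by norm_num)
  have h4 : E ^ 4 ≤ E ^ 8 := pow_le_pow_right₀ hE (by norm_num)
  have h5 : E ^ 5 ≤ E ^ 8 := pow_le_pow_right₀ hE (by norm_num)
  have h7 : E ^ 7 ≤ E ^ 8 := pow_le_pow_right₀ hE (by norm_num)
  have h0 : 1 ≤ E ^ 8 := one_le_pow₀ hE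
  have hE0 : 0 ≤ E := by linarith
  have i1 : a * E ^ 4 ≤ E ^ 5 := by
    calc a * E ^ 4 ≤ E * E ^ 4 := by gcongr
      _ = _ := by ring
  have i2 : a * E ^ 3 ≤ E ^ 4 := by
    calc a * E ^ 3 ≤ E * E ^ 3 := by gcongr
      _ = _ := by ring
  have e : (50 * E ^ 4) ^ 2 = 2500 * E ^ 8 := by ring
  have e2 : 6 + 3 * (2 * (a * (50 * E ^ 4) + (1 + 50 * E ^ 4 + a) * (6 * E ^ 3)))
      = 6 + 300 * (a * E ^ 4) + 36 * E ^ 3 + 1800 * E ^ 7 + 36 * (a * E ^ 3) := by ring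
  rw [e, e2]
  linarith

/-- Same induction as for the pointwise error, which enters as known input of every level. The
terminal and zero-level terms contribute 2 + 4 = 6 units. -/
theorem pairError_phi {M : ℕ} (hM : 1 ≤ M) (n : ℕ) :
    m.PairError M n ((50 * m.expHalf ^ 4) ^ (n + 1) * ((√M) ^ n)⁻¹) := by
  have hE := one_le_expHalf (m := m)
  have hE3 : 1 ≤ m.expHalf ^ 3 := one_le_pow₀ hE
  have hE4 : 1 ≤ m.expHalf ^ 4 := one_le_pow₀ hE
  have hμ : 1 ≤ √(M : ℝ) := Real.one_le_sqrt.2 (by exact_mod_cast hM)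
  have ha : 0 ≤ m.L * m.T := mul_nonneg m.L_nonneg m.T_pos.le
  have hnum := pair_constant_le hE (LT_le_expHalf (m := m))
  have hexp4 : Real.exp (2 * (m.L * m.T)) = m.expHalf ^ 4 := by
    rw [expHalf_pow]
    congr 1
    push_cast
    ring
  set E := m.expHalf with hEdef
  set μ := √(M : ℝ) with hμdef
  induction n using Nat.strong_induction_on with
  | _ n ih =>
  intro s hs t ht hst x y
  have hX : 1 ≤ Real.exp (M * m.rem s / 2) :=
    Real.one_le_exp (div_nonneg (mul_nonneg (Nat.cast_nonneg M) (rem_nonneg hs)) (by norm_num))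
  have hsi : 0 ≤ (√m.T)⁻¹ := inv_nonneg.2 (Real.sqrt_nonneg _)
  have hd := m.dst_nonneg s t x y
  have hW : ∀ p : ℝ, 0 ≤ (m.wt s x + m.wt t y) ^ p := fun p =>
    Real.rpow_nonneg (add_pos (m.wt_pos _ _) (m.wt_pos _ _)).le _
  have hZ : 0 ≤ (√m.T)⁻¹ * m.dst s t x y * (m.wt s x + m.wt t y) ^ (1 / 4 : ℝ) :=
    mul_nonneg (mul_nonneg hsi hd) (hW _)
  cases n with
  | zero =>
    simp only [phi_zero, zero_sub, pow_zero, inv_one, mul_one, zero_add, pow_one]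
    rw [eLpNorm_const _ (by norm_num) (IsProbabilityMeasure.ne_zero _), measure_univ,
      ENNReal.one_rpow, mul_one, Real.enorm_eq_ofReal_abs,
      show -m.sol s x - -m.sol t y = -(m.sol s x - m.sol t y) by ring, abs_neg]
    refine ENNReal.ofReal_le_ofReal ((sol_holder hs ht x y).trans ?_)
    rw [hexp4]
    -- At level 0 the error is the solution itself, and its Hölder bound with power β is weakened to
    -- the power 1/4.
    have h1 := rpow_wt_le (m := m) (t := t) hs.2 x y (p := m.β) (by linarith [m.β_le])
    calc _ ≤ 50 * E ^ 4 * 1 * ((√m.T)⁻¹ * m.dst s t x y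
          * (m.wt s x + m.wt t y) ^ (1 / 4 : ℝ)) := by
          rw [mul_one]
          gcongr
          · exact mul_nonneg (mul_nonneg hsi hd) (hW _)
          · norm_num
      _ ≤ _ := by gcongr
  | succ n =>
    set X := Real.exp (M * m.rem s / 2) with hXdef
    set Z := (√m.T)⁻¹ * m.dst s t x y * (m.wt s x + m.wt t y) ^ (1 / 4 : ℝ) with hZdef
    set C := 50 * E ^ 4 with hC
    have hC50 : 50 ≤ C := by linarith
    have hC0 : 0 ≤ C := by linarith
    set κ₀ := 2 * (m.L * m.T * C + (1 + C + m.L * m.T) * (6 * E ^ 3)) with hκ₀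
    set κ := κ₀ * X * Z with hκ
    have hκ₀0 : 0 ≤ κ₀ := by positivity
    have hκ0 : 0 ≤ κ := by positivity
    have key := phi_error_le (m := m) hM hs ht x y 1
      (b := fun l => κ * C ^ l * (μ ^ (l + 1))⁻¹) (mul_nonneg two_pos.le hZ)
      (mul_nonneg four_pos.le hZ) (fun l => by positivity)
      (eLpNorm_terminal_pair_le hs ht x y) (eLpNorm_drift_zero_pair_le hs ht hst x y) (n := n)
      (fun l hl => by
        refine (eLpNorm_drift_pair_sub_le hM (by positivity) (by positivity) (pointError_phi hM l)
          (ih l (by omega)) hs ht hst x y).trans_eq ?_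
        congr 1
        rw [hκ, hκ₀, pow_succ μ, mul_inv, ← hμdef, ← hXdef, ← hZdef, ← hEdef, ← hC,
          div_eq_mul_inv]
        ring)
    simp only [one_mul] at key
    refine key.trans (ENNReal.ofReal_le_ofReal ?_)
    have hsum := sum_geometric_error_le hμ (C := C) (by linarith) hκ0 n
    have hμ' : 0 ≤ (μ ^ (n + 1))⁻¹ := by positivity
    have hCn : 1 ≤ C ^ n := one_le_pow₀ (by linarith)
    have hfin : 6 * Z + 3 * κ * C ^ n ≤ C ^ (n + 1 + 1) * X * Z := by
      have h2 : 1 ≤ C ^ n * X := by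
        calc (1 : ℝ) = 1 * 1 := by norm_num
          _ ≤ _ := by gcongr
      calc 6 * Z + 3 * κ * C ^ n = 6 * 1 * Z + 3 * κ₀ * (C ^ n * X) * Z := by
            rw [hκ]; ring
        _ ≤ 6 * (C ^ n * X) * Z + 3 * κ₀ * (C ^ n * X) * Z := by gcongr
        _ = (6 + 3 * κ₀) * (C ^ n * X) * Z := by ring
        _ ≤ C ^ 2 * (C ^ n * X) * Z := by gcongr
        _ = _ := by ring
    calc _ = 6 * Z * (μ ^ (n + 1))⁻¹ + (∑ l ∈ Finset.range n, (μ ^ (n - l))⁻¹ *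
          (κ * C ^ (l + 1) * (μ ^ (l + 2))⁻¹ + κ * C ^ l * (μ ^ (l + 1))⁻¹)
            + κ * C ^ n * (μ ^ (n + 1))⁻¹) := by ring
      _ ≤ 6 * Z * (μ ^ (n + 1))⁻¹ + 3 * κ * C ^ n * (μ ^ (n + 1))⁻¹ := by gcongr
      _ = (6 * Z + 3 * κ * C ^ n) * (μ ^ (n + 1))⁻¹ := by ring
      _ ≤ (C ^ (n + 1 + 1) * X * Z) * (μ ^ (n + 1))⁻¹ := by gcongr
      _ = _ := by ring

end Model

/-! ### The noise attached to an index -/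

/-- The index reached from `θ` by a sequence of steps. -/
def Index.extend (θ : Index) (η : List (ℤ × ℤ)) : Index :=
  η.foldl (fun θ p => θ.append p.1 p.2) θ

theorem Index.extend_val (θ : Index) (η : List (ℤ × ℤ)) :
    (θ.extend η).1 = θ.1 ++ η.flatMap fun p => [p.1, p.2] := by
  induction η generalizing θ with
  | nil => simp [Index.extend]
  | cons p η ih =>
    have := ih (θ.append p.1 p.2)
    simp only [Index.extend, List.foldl_cons, List.flatMap_cons] at this ⊢
    rw [this]
    simp [Index.append]

theorem flatMap_pair_injective :
    Function.Injective fun η : List (ℤ × ℤ) => η.flatMap fun p => [p.1, p.2] := by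
  intro η
  induction η with
  | nil =>
    intro ζ h
    cases ζ with
    | nil => rfl
    | cons q ζ => simp at h
  | cons p η ih =>
    intro ζ h
    cases ζ with
    | nil => simp at h
    | cons q ζ =>
      simp only [List.flatMap_cons, List.cons_append, List.nil_append, List.cons.injEq] at h
      rw [Prod.ext h.1 h.2.1, ih h.2.2]

theorem Index.extend_injective (θ : Index) : Function.Injective θ.extend := by
  intro η ζ h
  have h2 := congrArg Subtype.val h
  rw [extend_val, extend_val] at h2
  exact flatMap_pair_injective (List.append_cancel_left h2)

/-- The index at a position below `θ`. -/
def Index.node (θ : Index) (p : Node) : Index := θ.extend (p.1 :: p.2)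

/-- Different positions below an index read different members of the random families, so
independence of the families carries over to the noise. -/
theorem Index.node_injective (θ : Index) : Function.Injective θ.node := by
  intro p q h
  have := θ.extend_injective h
  exact Prod.ext (List.cons.inj this).1 (List.cons.inj this).2

theorem flow_eq {Ω : Type*} {d : ℕ} (z : Ω → Fin d → ℝ) (s t : ℝ) (x : Fin d → ℝ) (ω : Ω) :
    flow z s t x ω = x + √|s - t| • z ω := by
  rw [flow, abs_sub_comm]

section noise

variable {Ω : Type*} {d : ℕ} {r : Index → Ω → ℝ} {z : Index → Ω → Fin d → ℝ}

variable (r z) in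
/-- The random inputs below the index `θ`. -/
def noiseAt (θ : Index) (ω : Ω) : Noise d := fun p => (r (θ.node p) ω, z (θ.node p) ω)

theorem head_noiseAt (θ a b) (ω : Ω) :
    Noise.head a b (noiseAt r z θ ω) = (r (θ.append a b) ω, z (θ.append a b) ω) := rfl

theorem sub_noiseAt (θ a b) (ω : Ω) :
    Noise.sub a b (noiseAt r z θ ω) = noiseAt r z (θ.append a b) ω := rfl

variable [MeasurableSpace Ω] {μ : Measure Ω}

theorem measurable_noiseAt (hr : ∀ θ, Measurable (r θ)) (hz : ∀ θ, Measurable (z θ)) (θ) :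
    Measurable (noiseAt r z θ) :=
  measurable_pi_lambda _ fun _ => (hr _).prodMk (hz _)

/-- The pairs at the injectively numbered positions are independent, and each has the law
`driveLaw`. Their joint law is therefore the infinite product, the same for every index. -/
theorem measurePreserving_noiseAt [IsProbabilityMeasure μ] (hr : ∀ θ, Measurable (r θ))
    (hr01 : ∀ θ ω, r θ ω ∈ Icc (0 : ℝ) 1)
    (hrlaw : ∀ θ, ∀ t ∈ Ioo (0 : ℝ) 1, μ {ω | r θ ω ≤ t} = ENNReal.ofReal t)
    (hrindep : iIndepFun r μ) (hz : ∀ θ, Measurable (z θ))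
    (hzlaw : ∀ θ, μ.map (z θ) = stdNormal d) (hzindep : iIndepFun z μ)
    (hrz : IndepFun (fun ω θ => r θ ω) (fun ω θ => z θ ω) μ) (θ : Index) :
    MeasurePreserving (noiseAt r z θ) μ (noiseLaw d) := by
  refine ⟨measurable_noiseAt hr hz θ, ?_⟩
  have h1 := (iIndepFun_prodMk hr hz hrindep hzindep hrz).precomp θ.node_injective
  have h2 := h1.map_fun_eq_infinitePi_map fun p => (hr (θ.node p)).prodMk (hz (θ.node p))
  refine h2.trans ?_
  unfold noiseLaw
  congr 1
  funext p
  have h3 : IndepFun (r (θ.node p)) (z (θ.node p)) μ :=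
    hrz.comp (measurable_pi_apply (θ.node p)) (measurable_pi_apply (θ.node p))
  exact (h3.map_prod_eq_prod_map_map (hr _).aemeasurable (hz _).aemeasurable).trans (by
    rw [map_eq_uniform (hr _) (hr01 _) (hrlaw _), hzlaw, driveLaw])

end noise

namespace Model

variable {d : ℕ} {m : Model d} {Ω : Type*} {f : ℝ → (Fin d → ℝ) → ℝ → ℝ}

/-! ### The approximations as functions of the noise -/

/-- The recursions agree term by term. The restriction to [0, T] is preserved because the uniform
variables lie in [0, 1] for every outcome, so `f` and its extension in the model are only compared
where they coincide. -/
theorem approx_eq_phi (hf : ∀ t ∈ Icc 0 m.T, ∀ x v, f t x v = m.f t x v) {r : Index → Ω → ℝ}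
    (hr01 : ∀ θ ω, r θ ω ∈ Icc (0 : ℝ) 1) (z : Index → Ω → Fin d → ℝ) (M n : ℕ) (θ : Index)
    {t : ℝ} (ht : t ∈ Icc 0 m.T) (x) (ω : Ω) :
    approx m.T f m.g r z M n θ t x ω = m.phi M n t x (noiseAt r z θ ω) := by
  induction n using Nat.strong_induction_on generalizing θ t x with
  | _ n ih =>
  rw [approx, phi]
  simp only [flow_eq]
  refine congrArg₂ (· + ·) rfl (Finset.sum_congr rfl fun l _ => ?_)
  rw [div_mul_eq_mul_div, div_eq_inv_mul, Finset.mul_sum]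
  refine congrArg _ (Finset.sum_congr rfl fun i _ => ?_)
  have hs : t + (m.T - t) * r (θ.append l.1 i) ω ∈ Icc 0 m.T :=
    tm_mem (m := m) ht (w := (r (θ.append l.1 i) ω, 0)) (hr01 _ ω)
  have h1 := ih l.1 l.2 (θ.append l.1 i) hs (x +
    √|t - (t + (m.T - t) * r (θ.append l.1 i) ω)| • z (θ.append l.1 i) ω)
  simp only [nemytskii, drift, sub_noiseAt, head_noiseAt]
  rw [hf _ hs, h1, mul_sub]
  refine congrArg₂ (· - ·) rfl ?_
  -- At level 0 the truncated predecessor is again 0, but the indicator removes the term.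
  rcases eq_or_ne l.1 0 with h0 | h0
  · simp [h0]
  · rw [if_neg h0, one_mul, one_mul, hf _ hs, ih (l.1 - 1) (by omega) _ hs]
    rfl

variable [MeasurableSpace Ω] {μ : Measure Ω}

theorem measurable_approx (hf : ∀ t ∈ Icc 0 m.T, ∀ x v, f t x v = m.f t x v)
    {r : Index → Ω → ℝ} (hr : ∀ θ, Measurable (r θ)) (hr01 : ∀ θ ω, r θ ω ∈ Icc (0 : ℝ) 1)
    {z : Index → Ω → Fin d → ℝ} (hz : ∀ θ, Measurable (z θ)) (M n : ℕ) (θ : Index) :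
    Measurable fun p : Icc (0 : ℝ) m.T × (Fin d → ℝ) × Ω =>
      approx m.T f m.g r z M n θ p.1 p.2.1 p.2.2 := by
  have e : (fun p : Icc (0 : ℝ) m.T × (Fin d → ℝ) × Ω =>
      approx m.T f m.g r z M n θ p.1 p.2.1 p.2.2)
      = fun p => m.phi M n p.1 p.2.1 (noiseAt r z θ p.2.2) :=
    funext fun p => approx_eq_phi hf hr01 z M n θ p.1.2 _ _
  rw [e]
  have hn := measurable_noiseAt hr hz θ
  exact (measurable_phi M n).comp (f := fun p : Icc (0 : ℝ) m.T × (Fin d → ℝ) × Ω =>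
    ((p.1 : ℝ), p.2.1, noiseAt r z θ p.2.2)) (by fun_prop)

/-! ### Solutions of the fixed point equation -/

variable {Z : Ω → Fin d → ℝ}

theorem wt_rpow_le (t) (ht : t ∈ Icc 0 m.T) (x) :
    m.wt t x ^ m.β ≤ Real.exp (m.ρ * m.T * m.β) * m.V x ^ m.β := by
  have h1 : m.wt t x ≤ Real.exp (m.ρ * m.T) * m.V x := by
    have := m.ρ_nonneg
    unfold wt weight
    gcongr
    · exact (m.V_pos x).le
    · linarith [ht.1]
  refine (Real.rpow_le_rpow (m.wt_pos t x).le h1 m.β_pos.le).trans_eq ?_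
  rw [Real.mul_rpow (Real.exp_pos _).le (m.V_pos x).le, ← Real.exp_mul]

theorem measurable_drive {v : ℝ → (Fin d → ℝ) → ℝ}
    (hv : Measurable fun p : ℝ × (Fin d → ℝ) => v p.1 p.2) (t s x) :
    Measurable fun z : Fin d → ℝ => m.f s (x + √|t - s| • z) (v s (x + √|t - s| • z)) :=
  m.measurable_f measurable_const (by fun_prop)
    (hv.comp (f := fun z : Fin d → ℝ => (s, x + √|t - s| • z)) (by fun_prop))

theorem lintegral_terminal_lt_top (hZ : MeasurePreserving Z μ (stdNormal d)) {t : ℝ}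
    (ht : t ∈ Icc 0 m.T) (x) : ∫⁻ ω, ENNReal.ofReal |m.g (flow Z t m.T x ω)| ∂μ < ⊤ := by
  have h1 := lintegral_wt_ep_rpow_le (m := m) ht (r := 0) m.β_pos.le (by linarith [m.β_le]) x
  refine lt_of_le_of_lt ?_ (h1.trans_lt ENNReal.ofReal_lt_top)
  have h2 : Measurable fun z => ENNReal.ofReal (m.wt m.T (m.ep t x (0, z)) ^ m.β) := by fun_prop
  rw [← hZ.lintegral_comp h2]
  refine lintegral_mono fun ω => ENNReal.ofReal_le_ofReal ?_
  rw [flow_eq]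
  refine (m.g_bound _).trans ?_
  exact Real.rpow_le_rpow (m.V_pos _).le (m.V_le_wt le_rfl _) m.β_pos.le

theorem lintegral_nemytskii_lt_top (hf : ∀ t ∈ Icc 0 m.T, ∀ x v, f t x v = m.f t x v)
    (hZ : MeasurePreserving Z μ (stdNormal d)) {t : ℝ} (ht : t ∈ Icc 0 m.T) (x) :
    ∫⁻ s in Icc t m.T, (∫⁻ ω, ENNReal.ofReal |nemytskii f m.sol s (flow Z t s x ω)| ∂μ) < ⊤ := by
  have hle : ∀ s ∈ Icc t m.T, ∫⁻ ω, ENNReal.ofReal |nemytskii f m.sol s (flow Z t s x ω)| ∂μ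
      ≤ ENNReal.ofReal
        ((m.T⁻¹ + m.L * (6 * Real.exp (3 / 2 * m.L * m.T))) * m.wt t x ^ m.β) := by
    intro s hs
    refine le_trans (le_of_eq ?_) (integrand_bound (by norm_num) sol_growth ht hs x)
    rw [← hZ.lintegral_comp (measurable_drive measurable_sol t s x).abs.ennreal_ofReal]
    refine lintegral_congr fun ω => ?_
    rw [nemytskii, flow_eq, hf s ⟨ht.1.trans hs.1, hs.2⟩]
  refine (setLIntegral_mono measurable_const hle).trans_lt ?_
  rw [setLIntegral_const]
  exact ENNReal.mul_lt_top ENNReal.ofReal_lt_top (by simp)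

theorem iSup_sol_lt_top : (⨆ s ∈ Icc (0 : ℝ) m.T, ⨆ y : Fin d → ℝ,
    ENNReal.ofReal (|m.sol s y| / |m.V y| ^ m.β)) < ⊤ := by
  refine lt_of_le_of_lt (iSup₂_le fun s hs => iSup_le fun y => ENNReal.ofReal_le_ofReal ?_)
    (ENNReal.ofReal_lt_top
      (r := 6 * Real.exp (3 / 2 * m.L * m.T) * Real.exp (m.ρ * m.T * m.β)))
  rw [abs_of_pos (m.V_pos y), div_le_iff₀ (Real.rpow_pos_of_pos (m.V_pos y) _)]
  have hL := m.L_nonneg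
  have hw := Real.rpow_nonneg (m.wt_pos s y).le m.β
  have hs0 := hs.1
  calc |m.sol s y| ≤ 6 * Real.exp (3 / 2 * m.L * (m.T - s)) * m.wt s y ^ m.β :=
        sol_growth s hs y
    _ ≤ 6 * Real.exp (3 / 2 * m.L * m.T) * (Real.exp (m.ρ * m.T * m.β) * m.V y ^ m.β) := by
        gcongr
        · linarith
        · exact wt_rpow_le s hs y
    _ = _ := by ring

theorem picard_eq_expectation (hf : ∀ t ∈ Icc 0 m.T, ∀ x v, f t x v = m.f t x v)
    (hZ : MeasurePreserving Z μ (stdNormal d)) {v w : ℝ → (Fin d → ℝ) → ℝ}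
    (hwv : ∀ t ∈ Icc 0 m.T, ∀ x, w t x = v t x)
    (hw : Measurable fun p : ℝ × (Fin d → ℝ) => w p.1 p.2) {A : ℝ} (hA : 0 ≤ A)
    (hwA : m.Growth A w) {t : ℝ} (ht : t ∈ Icc 0 m.T) (x) :
    m.picard w t x = (∫ ω, m.g (flow Z t m.T x ω) ∂μ)
      + ∫ s in t..m.T, (∫ ω, nemytskii f v s (flow Z t s x ω) ∂μ) := by
  rw [picard_eq hw hA hwA ht x]
  refine congrArg₂ (· + ·) ?_ (intervalIntegral.integral_congr fun s hs => ?_)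
  · rw [← hZ.map_eq, integral_map hZ.measurable.aemeasurable
      (Measurable.aestronglyMeasurable (by fun_prop))]
    simp only [flow_eq]
  · rw [uIcc_of_le ht.2] at hs
    have hsT : s ∈ Icc 0 m.T := ⟨ht.1.trans hs.1, hs.2⟩
    simp only [mean]
    rw [← hZ.map_eq, integral_map hZ.measurable.aemeasurable
      (measurable_drive hw t s x).aestronglyMeasurable]
    simp only [nemytskii, flow_eq, hf s hsT, hwv s hsT]

theorem isSolution_sol (hf : ∀ t ∈ Icc 0 m.T, ∀ x v, f t x v = m.f t x v)
    (hZ : MeasurePreserving Z μ (stdNormal d)) : IsSolution μ m.T m.β f m.g m.V Z m.sol where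
  measurable := measurable_sol.comp (f := fun p : Icc (0 : ℝ) m.T × (Fin d → ℝ) =>
    ((p.1 : ℝ), p.2)) (by fun_prop)
  finite t ht x := ENNReal.add_lt_top.2 ⟨ENNReal.add_lt_top.2
    ⟨lintegral_terminal_lt_top hZ ht x, lintegral_nemytskii_lt_top hf hZ ht x⟩, iSup_sol_lt_top⟩
  equation t ht x := (picard_sol ht x).symm.trans (picard_eq_expectation hf hZ
    (fun _ _ _ => rfl) measurable_sol (by norm_num) sol_growth ht x)

/-- A solution is measurable only on [0, T]. Freezing it outside gives a globally measurable
function, the finite supremum serves as its growth constant, and uniqueness for the fixed point map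
applies. -/
theorem eq_sol_of_isSolution (hf : ∀ t ∈ Icc 0 m.T, ∀ x v, f t x v = m.f t x v)
    (hZ : MeasurePreserving Z μ (stdNormal d)) {v : ℝ → (Fin d → ℝ) → ℝ}
    (hv : IsSolution μ m.T m.β f m.g m.V Z v) {t : ℝ} (ht : t ∈ Icc 0 m.T) (x) :
    v t x = m.sol t x := by
  have h0T : (0 : ℝ) ≤ m.T := m.T_pos.le
  set w : ℝ → (Fin d → ℝ) → ℝ := fun t x => v (projIcc 0 m.T h0T t) x with hw
  have hwv : ∀ t ∈ Icc 0 m.T, ∀ x, w t x = v t x := fun t ht x => by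
    simp only [hw, projIcc_of_mem h0T ht]
  have hwm : Measurable fun p : ℝ × (Fin d → ℝ) => w p.1 p.2 :=
    hv.measurable.comp (f := fun p : ℝ × (Fin d → ℝ) => (projIcc 0 m.T h0T p.1, p.2))
      ((continuous_projIcc.measurable.comp measurable_fst).prodMk measurable_snd)
  have hfin : (⨆ s ∈ Icc (0 : ℝ) m.T, ⨆ y : Fin d → ℝ,
      ENNReal.ofReal (|v s y| / |m.V y| ^ m.β)) < ⊤ :=
    (ENNReal.add_lt_top.1 (hv.finite 0 ⟨le_rfl, h0T⟩ 0)).2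
  set K := (⨆ s ∈ Icc (0 : ℝ) m.T, ⨆ y : Fin d → ℝ,
      ENNReal.ofReal (|v s y| / |m.V y| ^ m.β)) with hK
  have hgrowth : m.Growth K.toReal w := by
    intro s hs y
    rw [hwv s hs]
    have h1 : ENNReal.ofReal (|v s y| / |m.V y| ^ m.β) ≤ K :=
      le_iSup₂_of_le s hs (le_iSup (fun y => ENNReal.ofReal (|v s y| / |m.V y| ^ m.β)) y)
    have h2 := (ENNReal.ofReal_le_iff_le_toReal hfin.ne).1 h1
    rw [abs_of_pos (m.V_pos y), div_le_iff₀ (Real.rpow_pos_of_pos (m.V_pos y) _)] at h2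
    have h3 : m.V y ^ m.β ≤ m.wt s y ^ m.β :=
      Real.rpow_le_rpow (m.V_pos y).le (m.V_le_wt hs.2 y) m.β_pos.le
    have h4 : 1 ≤ Real.exp (3 / 2 * m.L * (m.T - s)) :=
      Real.one_le_exp (mul_nonneg (mul_nonneg (by norm_num) m.L_nonneg) (by linarith [hs.2]))
    have h5 : 0 ≤ K.toReal := ENNReal.toReal_nonneg
    have h6 : 0 ≤ m.wt s y ^ m.β := Real.rpow_nonneg (m.wt_pos s y).le _
    calc |v s y| ≤ K.toReal * m.V y ^ m.β := h2
      _ ≤ K.toReal * 1 * m.wt s y ^ m.β := by rw [mul_one]; gcongr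
      _ ≤ _ := by gcongr
  rw [← hwv t ht]
  refine eq_sol_of_picard hwm ENNReal.toReal_nonneg hgrowth (fun t ht x => ?_) ht x
  rw [hwv t ht, hv.equation t ht,
    picard_eq_expectation hf hZ hwv hwm ENNReal.toReal_nonneg hgrowth ht]

/-! ### Transfer of the error bounds -/

variable (m) in
/-- The error bound of the multilevel Picard approximations. -/
noncomputable def errorBound (M N : ℕ) : ℝ :=
  Real.exp (M / 2) * (M : ℝ) ^ (-(N / 2) : ℝ) * (50 * Real.exp (2 * m.L * m.T)) ^ (N + 1)

/-- The rescaled remaining time is at most 1, so the time-dependent weight is bounded by e^{M/2}. -/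
theorem le_errorBound {M N : ℕ} {t a : ℝ} (ht : t ∈ Icc 0 m.T)
    (ha : a ≤ (50 * m.expHalf ^ 4) ^ (N + 1)) :
    a * ((√(M : ℝ)) ^ N)⁻¹ * Real.exp (M * m.rem t / 2) ≤ m.errorBound M N := by
  have h1 : ((√(M : ℝ)) ^ N)⁻¹ = (M : ℝ) ^ (-(N / 2) : ℝ) := by
    rw [Real.rpow_neg (Nat.cast_nonneg M), Real.sqrt_eq_rpow, ← Real.rpow_natCast,
      ← Real.rpow_mul (Nat.cast_nonneg M)]
    congr 2
    ring
  have h2 : m.expHalf ^ 4 = Real.exp (2 * m.L * m.T) := by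
    rw [expHalf_pow]
    congr 1
    push_cast
    ring
  have h3 : Real.exp (M * m.rem t / 2) ≤ Real.exp (M / 2) := by
    have := mul_le_of_le_one_right (Nat.cast_nonneg (α := ℝ) M) (rem_le_one ht)
    gcongr
  rw [h2] at ha
  calc _ ≤ (50 * Real.exp (2 * m.L * m.T)) ^ (N + 1) * ((√(M : ℝ)) ^ N)⁻¹
        * Real.exp (M / 2) := by gcongr
    _ = _ := by rw [h1, errorBound]; ring

theorem pointError_le {M : ℕ} (hM : 1 ≤ M) (N : ℕ) {t : ℝ} (ht : t ∈ Icc 0 m.T) (x) :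
    eLpNorm (fun σ => m.phi M N t x σ - m.sol t x) 2 (noiseLaw d)
      ≤ ENNReal.ofReal (m.errorBound M N) * ENNReal.ofReal (m.wt t x ^ m.β) := by
  refine (pointError_phi hM N t ht x).trans ?_
  rw [← ENNReal.ofReal_mul (by unfold errorBound; positivity)]
  refine ENNReal.ofReal_le_ofReal
    (mul_le_mul_of_nonneg_right ?_ (Real.rpow_nonneg (m.wt_pos t x).le _))
  refine le_errorBound ht ?_
  have hE := one_le_expHalf (m := m)
  have h34 : m.expHalf ^ 3 ≤ m.expHalf ^ 4 := pow_le_pow_right₀ hE (by norm_num)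
  have h3 : 0 ≤ m.expHalf ^ 3 := by positivity
  calc _ ≤ (50 * m.expHalf ^ 4) * (50 * m.expHalf ^ 4) ^ N := by gcongr; linarith
    _ = _ := by ring

theorem pairError_le_of_le {M : ℕ} (hM : 1 ≤ M) (N : ℕ) {s t : ℝ} (hs : s ∈ Icc 0 m.T)
    (ht : t ∈ Icc 0 m.T) (hst : s ≤ t) (x y) :
    ENNReal.ofReal √m.T * eLpNorm (fun σ => (m.phi M N s x σ - m.sol s x)
        - (m.phi M N t y σ - m.sol t y)) 2 (noiseLaw d)
      ≤ ENNReal.ofReal (m.errorBound M N)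
        * ENNReal.ofReal (m.dst s t x y * (m.wt s x + m.wt t y) ^ (1 / 4 : ℝ)) := by
  refine (mul_le_mul_right (pairError_phi hM N s hs t ht hst x y) _).trans ?_
  rw [← ENNReal.ofReal_mul (Real.sqrt_nonneg _),
    ← ENNReal.ofReal_mul (by unfold errorBound; positivity)]
  refine ENNReal.ofReal_le_ofReal ?_
  have hd : 0 ≤ m.dst s t x y * (m.wt s x + m.wt t y) ^ (1 / 4 : ℝ) :=
    mul_nonneg (m.dst_nonneg _ _ _ _)
      (Real.rpow_nonneg (add_pos (m.wt_pos _ _) (m.wt_pos _ _)).le _)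
  have hT := mul_inv_cancel₀ m.sqrt_T_pos.ne'
  calc _ = (√m.T * (√m.T)⁻¹) * ((50 * m.expHalf ^ 4) ^ (N + 1) * ((√(M : ℝ)) ^ N)⁻¹
        * Real.exp (M * m.rem s / 2)) * (m.dst s t x y * (m.wt s x + m.wt t y) ^ (1 / 4 : ℝ)) := by
        ring
    _ ≤ _ := by
        rw [hT, one_mul]
        exact mul_le_mul_of_nonneg_right (le_errorBound hs le_rfl) hd

theorem pairError_le {M : ℕ} (hM : 1 ≤ M) (N : ℕ) {s t : ℝ} (hs : s ∈ Icc 0 m.T)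
    (ht : t ∈ Icc 0 m.T) (x y) :
    ENNReal.ofReal √m.T * eLpNorm (fun σ => (m.phi M N s x σ - m.sol s x)
        - (m.phi M N t y σ - m.sol t y)) 2 (noiseLaw d)
      ≤ ENNReal.ofReal (m.errorBound M N)
        * ENNReal.ofReal (m.dst s t x y * (m.wt s x + m.wt t y) ^ (1 / 4 : ℝ)) := by
  rcases le_total s t with h | h
  · exact pairError_le_of_le hM N hs ht h x y
  -- The increment estimate assumes ordered times; exchanging the points only changes the sign of
  -- the increment.
  · rw [m.dst_comm, add_comm (m.wt s x), ← eLpNorm_neg]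
    convert pairError_le_of_le hM N ht hs h y x using 3
    funext σ
    simp

/-! ### The model of the given data -/

theorem exists_model [IsProbabilityMeasure μ]
    {T L ρ β : ℝ} (hT : 0 < T) (hL : 0 ≤ L) (hρ : 0 ≤ ρ) (hβ : 0 < β) (hβ' : β ≤ 1 / 12)
    (hf : ContinuousOn (fun p : ℝ × (Fin d → ℝ) × ℝ => f p.1 p.2.1 p.2.2)
      (Icc (0 : ℝ) T ×ˢ univ))
    {g : (Fin d → ℝ) → ℝ} (hg : Continuous g)
    {V : (Fin d → ℝ) → ℝ} (hV : Measurable V) (hV1 : ∀ x, 1 ≤ V x)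
    (nrm : Seminorm ℝ (Fin d → ℝ)) (hZ : Measurable Z) (hZlaw : μ.map Z = stdNormal d)
    (hfg : ∀ s ∈ Icc (0 : ℝ) T, ∀ t ∈ Icc (0 : ℝ) T, ∀ x y : Fin d → ℝ, ∀ v₁ v₂ : ℝ,
      max |f s x v₁ - f t y v₂| (T⁻¹ * |g x - g y|) ≤
        T ^ (-(3 / 2) : ℝ) * |V x + V y| ^ β * (√|s - t| + nrm (x - y)) + L * |v₁ - v₂|)
    (hff : ∀ s ∈ Icc (0 : ℝ) T, ∀ t ∈ Icc (0 : ℝ) T, ∀ x y : Fin d → ℝ, ∀ v₁ v₂ w₁ w₂ : ℝ,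
      |(f s x v₁ - f s x w₁) - (f t y v₂ - f t y w₂)| ≤
        L * |(v₁ - w₁) - (v₂ - w₂)|
        + T ^ (-(3 / 2) : ℝ) * |V x + V y| ^ β *
            (momentConst μ nrm Z * √|s - t| + nrm (x - y)) * |v₁ - w₁|
        + T⁻¹ * |V x + V y| ^ β * (|v₁ - w₁| + |v₂ - w₂|) * |w₁ - w₂|)
    (hfV : ∀ s ∈ Icc (0 : ℝ) T, ∀ t ∈ Icc (0 : ℝ) T, ∀ x : Fin d → ℝ,
      |T * f t x 0| ^ (1 / β) ≤ Real.exp (ρ * |t - s|) * V x)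
    (hgV : ∀ s ∈ Icc (0 : ℝ) T, ∀ t ∈ Icc (0 : ℝ) T, ∀ x : Fin d → ℝ,
      |g x| ^ (1 / β) ≤ Real.exp (ρ * |t - s|) * V x)
    (hVV : ∀ s ∈ Icc (0 : ℝ) T, ∀ t ∈ Icc (0 : ℝ) T, ∀ x : Fin d → ℝ,
      ∫⁻ ω, ENNReal.ofReal (V (flow Z s t x ω)) ∂μ ≤
        ENNReal.ofReal (Real.exp (ρ * |t - s|) * V x)) :
    ∃ m : Model d, m.T = T ∧ m.L = L ∧ m.ρ = ρ ∧ m.β = β ∧ m.c = momentConst μ nrm Z ∧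
      m.g = g ∧ m.V = V ∧ m.nrm = nrm ∧ ∀ t ∈ Icc 0 T, ∀ x v, f t x v = m.f t x v := by
  have hV0 : ∀ x, 0 < V x := fun x => zero_lt_one.trans_le (hV1 x)
  have hVa : ∀ x y, |V x + V y| = V x + V y := fun x y =>
    abs_of_pos (add_pos (hV0 x) (hV0 y))
  have hT32 : T ^ (-(3 / 2) : ℝ) = T⁻¹ * (√T)⁻¹ := by
    rw [show (-(3 / 2) : ℝ) = -1 + -(1 / 2) by norm_num, Real.rpow_add hT, Real.rpow_neg_one,
      Real.rpow_neg hT.le, ← Real.sqrt_eq_rpow]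
  simp only [hVa, hT32] at hfg hff
  have hmem : ∀ t, (projIcc 0 T hT.le t : ℝ) ∈ Icc 0 T := fun t => (projIcc 0 T hT.le t).2
  have hproj : ∀ s t, √|(projIcc 0 T hT.le s : ℝ) - projIcc 0 T hT.le t| ≤ √|s - t| :=
    fun s t => Real.sqrt_le_sqrt (abs_projIcc_sub_projIcc hT.le)
  have h0 : (0 : ℝ) ∈ Icc 0 T := ⟨le_rfl, hT.le⟩
  have hrpow : ∀ a b : ℝ, |a| ^ (1 / β) ≤ b → |a| ≤ b ^ β := by
    intro a b hab
    have := Real.rpow_le_rpow (Real.rpow_nonneg (abs_nonneg a) _) hab hβ.le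
    rwa [← Real.rpow_mul (abs_nonneg a), one_div_mul_cancel hβ.ne', Real.rpow_one] at this
  have hc1 : 1 ≤ momentConst μ nrm Z :=
    Real.one_le_rpow (le_max_right _ _) (by norm_num)
  have hc4 : momentConst μ nrm Z ^ 4 = max (∫ z, nrm z ^ 4 ∂stdNormal d) 1 := by
    rw [momentConst, ← Real.rpow_natCast, ← Real.rpow_mul (by positivity), ← hZlaw,
      integral_map hZ.aemeasurable (f := fun z => nrm z ^ 4)
        (((continuous_seminorm nrm).pow 4).aestronglyMeasurable)]
    norm_num
  refine ⟨{
    T := T, L := L, ρ := ρ, β := β, c := momentConst μ nrm Z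
    -- Time is frozen outside [0, T]. The projection is 1-Lipschitz, so the Hölder bounds persist
    -- with the same constants.
    f := fun t x v => f (projIcc 0 T hT.le t) x v
    g := g, V := V, nrm := nrm
    T_pos := hT, L_nonneg := hL, ρ_nonneg := hρ, β_pos := hβ, β_le := hβ'
    one_le_c := hc1
    f_cont := hf.comp_continuous (f := fun p : ℝ × (Fin d → ℝ) × ℝ =>
      ((projIcc 0 T hT.le p.1 : ℝ), p.2))
      ((continuous_subtype_val.comp (continuous_projIcc.comp continuous_fst)).prodMk
        continuous_snd) (fun p => ⟨hmem _, mem_univ _⟩)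
    g_cont := hg, V_meas := hV, one_le_V := hV1
    moment := ?_, f_lip := ?_, g_lip := ?_, f_diff := ?_, f_bound := ?_, g_bound := ?_
    V_int := ?_ }, rfl, rfl, rfl, rfl, rfl, rfl, rfl, rfl, fun t ht x v => ?_⟩
  · rw [hc4, ← ofReal_integral_eq_lintegral_ofReal (integrable_seminorm_pow_four nrm)
      (.of_forall fun z => pow_nonneg (apply_nonneg _ _) 4)]
    exact ENNReal.ofReal_le_ofReal (le_max_left _ _)
  · intro s t x y v w
    refine ((le_max_left _ _).trans (hfg _ (hmem s) _ (hmem t) x y v w)).trans ?_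
    have := Real.rpow_nonneg (add_pos (hV0 x) (hV0 y)).le β
    have h1 := hproj s t
    have h2 : 0 ≤ T⁻¹ * (√T)⁻¹ * (V x + V y) ^ β := by positivity
    exact add_le_add (mul_le_mul_of_nonneg_left (add_le_add h1 le_rfl) h2) le_rfl
  · intro x y
    have h := (le_max_right _ _).trans (hfg 0 h0 0 h0 x y 0 0)
    simp only [sub_self, abs_zero, Real.sqrt_zero, zero_add, mul_zero, add_zero] at h
    have h2 := mul_le_mul_of_nonneg_left h hT.le
    have hTT := mul_inv_cancel₀ hT.ne'
    calc |g x - g y| = (T * T⁻¹) * |g x - g y| := by rw [hTT, one_mul]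
      _ = T * (T⁻¹ * |g x - g y|) := by ring
      _ ≤ _ := h2
      _ = (T * T⁻¹) * ((√T)⁻¹ * (V x + V y) ^ β * nrm (x - y)) := by ring
      _ = _ := by rw [hTT, one_mul]
  · intro s t x y v₁ v₂ w₁ w₂
    refine (hff _ (hmem s) _ (hmem t) x y v₁ v₂ w₁ w₂).trans ?_
    have := Real.rpow_nonneg (add_pos (hV0 x) (hV0 y)).le β
    have := mul_le_mul_of_nonneg_left (hproj s t) (zero_le_one.trans hc1)
    have : 0 ≤ T⁻¹ * (√T)⁻¹ * (V x + V y) ^ β := by positivity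
    refine add_le_add (add_le_add le_rfl ?_) le_rfl
    refine mul_le_mul_of_nonneg_right (mul_le_mul_of_nonneg_left ?_ this) (abs_nonneg _)
    linarith
  · intro t x
    have h := hrpow _ _ (hfV _ (hmem t) _ (hmem t) x)
    rw [sub_self, abs_zero, mul_zero, Real.exp_zero, one_mul, abs_mul, abs_of_pos hT] at h
    rw [← div_eq_inv_mul, le_div_iff₀ hT, mul_comm]
    exact h
  · intro x
    have h := hrpow _ _ (hgV 0 h0 0 h0 x)
    rwa [sub_self, abs_zero, mul_zero, Real.exp_zero, one_mul] at h
  -- A step of length h is realised by the flow from time 0 to time h.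
  · intro h hh hhT x
    have h1 := hVV 0 h0 h ⟨hh, hhT⟩ x
    simp only [flow, sub_zero, abs_of_nonneg hh] at h1
    rwa [← hZlaw, lintegral_map (by fun_prop) hZ]
  · simp only [projIcc_of_mem hT.le ht]

end Model
end MLP

/-! ### Assembly of the result -/

theorem proposition4p2 {Ω : Type*} [MeasurableSpace Ω] (μ : Measure Ω) [IsProbabilityMeasure μ]
    (T L ρ β : ℝ) (hT : 0 < T) (hL : 0 ≤ L) (hρ : 0 ≤ ρ) (hβ : 0 < β) (hβ' : β ≤ 1 / 12)
    (d : ℕ) (hd : 1 ≤ d)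
    (f : ℝ → (Fin d → ℝ) → ℝ → ℝ)
    (hf : ContinuousOn (fun p : ℝ × (Fin d → ℝ) × ℝ => f p.1 p.2.1 p.2.2)
      (Icc (0 : ℝ) T ×ˢ univ))
    (g : (Fin d → ℝ) → ℝ) (hg : Continuous g)
    (V : (Fin d → ℝ) → ℝ) (hV : Measurable V) (hV1 : ∀ x, 1 ≤ V x)
    -- an arbitrary norm on `ℝᵈ`
    (nrm : Seminorm ℝ (Fin d → ℝ)) (hnrm : ∀ x, nrm x = 0 → x = 0)
    -- i.i.d. uniformly distributed random variables with values in `[0, 1]`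
    (r : MLP.Index → Ω → ℝ) (hr : ∀ θ, Measurable (r θ)) (hr01 : ∀ θ ω, r θ ω ∈ Icc (0 : ℝ) 1)
    (hrlaw : ∀ θ, ∀ t ∈ Ioo (0 : ℝ) 1, μ {ω | r θ ω ≤ t} = ENNReal.ofReal t)
    (hrindep : iIndepFun r μ)
    -- i.i.d. standard normal random vectors, independent of the uniform variables
    (z : MLP.Index → Ω → Fin d → ℝ) (hz : ∀ θ, Measurable (z θ))
    (hzlaw : ∀ θ, μ.map (z θ) = MLP.stdNormal d)
    (hzindep : iIndepFun z μ)
    (hrz : IndepFun (fun ω θ => r θ ω) (fun ω θ => z θ ω) μ)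
    (hfg : ∀ s ∈ Icc (0 : ℝ) T, ∀ t ∈ Icc (0 : ℝ) T, ∀ x y : Fin d → ℝ, ∀ v₁ v₂ : ℝ,
      max |f s x v₁ - f t y v₂| (T⁻¹ * |g x - g y|) ≤
        T ^ (-(3 / 2) : ℝ) * |V x + V y| ^ β * (√|s - t| + nrm (x - y)) + L * |v₁ - v₂|)
    (hff : ∀ s ∈ Icc (0 : ℝ) T, ∀ t ∈ Icc (0 : ℝ) T, ∀ x y : Fin d → ℝ, ∀ v₁ v₂ w₁ w₂ : ℝ,
      |(f s x v₁ - f s x w₁) - (f t y v₂ - f t y w₂)| ≤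
        L * |(v₁ - w₁) - (v₂ - w₂)|
        + T ^ (-(3 / 2) : ℝ) * |V x + V y| ^ β *
            (MLP.momentConst μ nrm (z MLP.Index.zero) * √|s - t| + nrm (x - y)) * |v₁ - w₁|
        + T⁻¹ * |V x + V y| ^ β * (|v₁ - w₁| + |v₂ - w₂|) * |w₁ - w₂|)
    (hfV : ∀ s ∈ Icc (0 : ℝ) T, ∀ t ∈ Icc (0 : ℝ) T, ∀ x : Fin d → ℝ,
      |T * f t x 0| ^ (1 / β) ≤ Real.exp (ρ * |t - s|) * V x)
    (hgV : ∀ s ∈ Icc (0 : ℝ) T, ∀ t ∈ Icc (0 : ℝ) T, ∀ x : Fin d → ℝ,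
      |g x| ^ (1 / β) ≤ Real.exp (ρ * |t - s|) * V x)
    (hVV : ∀ s ∈ Icc (0 : ℝ) T, ∀ t ∈ Icc (0 : ℝ) T, ∀ x : Fin d → ℝ,
      ∫⁻ ω, ENNReal.ofReal (V (MLP.flow (z MLP.Index.zero) s t x ω)) ∂μ ≤
        ENNReal.ofReal (Real.exp (ρ * |t - s|) * V x)) :
    -- existence and uniqueness on `[0, T] × ℝᵈ` of the solution
    (∃ u : ℝ → (Fin d → ℝ) → ℝ,
      MLP.IsSolution μ T β f g V (z MLP.Index.zero) u ∧
      ∀ v : ℝ → (Fin d → ℝ) → ℝ, MLP.IsSolution μ T β f g V (z MLP.Index.zero) v →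
        ∀ t ∈ Icc (0 : ℝ) T, ∀ x, v t x = u t x) ∧
    -- measurability of the approximations on `[0, T] × ℝᵈ × Ω`
    (∀ (θ : MLP.Index) (n M : ℕ), 1 ≤ M →
      Measurable fun p : Icc (0 : ℝ) T × (Fin d → ℝ) × Ω =>
        MLP.approx T f g r z M n θ p.1 p.2.1 p.2.2) ∧
    -- the error bounds for the solution
    (∀ u : ℝ → (Fin d → ℝ) → ℝ, MLP.IsSolution μ T β f g V (z MLP.Index.zero) u →
      (∀ M N : ℕ, 1 ≤ M →
        ⨆ s ∈ Icc (0 : ℝ) T, ⨆ x : Fin d → ℝ,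
          eLpNorm (fun ω => MLP.approx T f g r z M N MLP.Index.zero s x ω - u s x) 2 μ
            / ENNReal.ofReal (MLP.weight T ρ V s x ^ β)
        ≤ ENNReal.ofReal (Real.exp (M / 2) * (M : ℝ) ^ (-(N / 2) : ℝ)
            * (50 * Real.exp (2 * L * T)) ^ (N + 1))) ∧
      (∀ M N : ℕ, 1 ≤ M →
        ⨆ s ∈ Icc (0 : ℝ) T, ⨆ t ∈ Icc (0 : ℝ) T, ⨆ (_ : s ≠ t),
        ⨆ x : Fin d → ℝ, ⨆ y : Fin d → ℝ, ⨆ (_ : x ≠ y),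
          ENNReal.ofReal √T *
            eLpNorm (fun ω => (MLP.approx T f g r z M N MLP.Index.zero s x ω - u s x)
              - (MLP.approx T f g r z M N MLP.Index.zero t y ω - u t y)) 2 μ
            / ENNReal.ofReal
              ((MLP.momentConst μ nrm (z MLP.Index.zero) * √|s - t| + nrm (x - y))
                * (MLP.weight T ρ V s x + MLP.weight T ρ V t y) ^ (1 / 4 : ℝ))
        ≤ ENNReal.ofReal (Real.exp (M / 2) * (M : ℝ) ^ (-(N / 2) : ℝ)
            * (50 * Real.exp (2 * L * T)) ^ (N + 1)))) := by
  have hZ : MeasurePreserving (z MLP.Index.zero) μ (MLP.stdNormal d) := ⟨hz _, hzlaw _⟩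
  have hN := MLP.measurePreserving_noiseAt hr hr01 hrlaw hrindep hz hzlaw hzindep hrz
    MLP.Index.zero
  obtain ⟨m, rfl, rfl, rfl, rfl, hc, rfl, rfl, rfl, hfm⟩ :=
    MLP.Model.exists_model hT hL hρ hβ hβ' hf hg hV hV1 nrm (hz _) (hzlaw _) hfg hff hfV hgV hVV
  refine ⟨⟨m.sol, MLP.Model.isSolution_sol hfm hZ, fun v hv t ht x =>
    MLP.Model.eq_sol_of_isSolution hfm hZ hv ht x⟩,
    fun θ n M _ => MLP.Model.measurable_approx hfm hr hr01 hz M n θ, fun u hu => ?_⟩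
  -- The error bounds are stated for an arbitrary solution; uniqueness replaces it by the Picard
  -- limit.
  have hsol := fun t ht x => MLP.Model.eq_sol_of_isSolution hfm hZ hu (t := t) ht x
  -- Each quotient is bounded after multiplying by its denominator. The resulting L² norms are moved
  -- to the canonical noise space by measure preservation.
  refine ⟨fun M N hM => iSup₂_le fun s hs => iSup_le fun x => ENNReal.div_le_of_le_mul ?_,
    fun M N hM => iSup₂_le fun s hs => iSup₂_le fun t ht => iSup_le fun _ => iSup₂_le fun x y =>
      iSup_le fun _ => ENNReal.div_le_of_le_mul ?_⟩
  · have hφ := MLP.Model.measurable_phi_apply (m := m) M N s x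
    have h := eLpNorm_comp_measurePreserving (p := 2)
      (hφ.sub_const (m.sol s x)).aestronglyMeasurable hN
    refine le_trans (le_of_eq ?_) (MLP.Model.pointError_le (m := m) hM N hs x)
    rw [← h]
    simp only [MLP.Model.approx_eq_phi hfm hr01 z M N _ hs, hsol s hs]
    rfl
  · have hφ := MLP.Model.measurable_phi_apply (m := m) M N s x
    have hφ' := MLP.Model.measurable_phi_apply (m := m) M N t y
    have h := eLpNorm_comp_measurePreserving (p := 2)
      ((hφ.sub_const (m.sol s x)).sub (hφ'.sub_const (m.sol t y))).aestronglyMeasurable hN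
    rw [← hc]
    refine le_trans (le_of_eq ?_) (MLP.Model.pairError_le (m := m) hM N hs ht x y)
    refine congrArg _ ?_
    simp only [MLP.Model.approx_eq_phi hfm hr01 z M N _ hs,
      MLP.Model.approx_eq_phi hfm hr01 z M N _ ht, hsol s hs, hsol t ht]
    exact h
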